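/- **Setting.** Let $m\ge 3$, $n\ge 2$, and let $G=(V,E)$ be a tree on $V=\{1,\dots,m\}$ with set of leaves $\Gamma$ and diameter $d(G)$ (the largest distance between two vertices). Every edge carries a non-negative cost matrix $C^{(k,l)}\in\mathbb R_+^{n\times n}$ with $C^{(l,k)}=(C^{(k,l)})^{T}$, and every leaf $k$ carries a probability vector $\mu_k\in\mathbb R_+^n$. Put $\mathbf C(x_1,\dots,x_m)=\sum_{(k,l)\in E}C^{(k,l)}(x_k,x_l)$. For a tensor $\mathbf B\in\mathbb R^{n^m}$ let $P_k(\mathbf B)$, $P_{k,l}(\mathbf B)$ be its marginals at a vertex and at a pair of vertices, and let $\Pi_\Gamma=\{\mathbf B\ge 0: P_k(\mathbf B)=\mu_k\ \forall k\in\Gamma\}$. A tensor $\widehat{\mathbf B}$ is an $\epsilon$-approximate solution of the tree-structured multi-marginal optimal transport problem if $\widehat{\mathbf B}\in\Pi_\Gamma$ and $\langle\mathbf C,\widehat{\mathbf B}\rangle\le\min_{\mathbf B\in\Pi_\Gamma}\langle\mathbf C,\mathbf B\rangle+\epsilon$. For a leaf $k$ let $\ell_k$ be its neighbour, and let $R_C^\Gamma=\max_{k\in\Gamma}\max_{x,y}C^{(k,\ell_k)}(x,y)$;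 assume $R_C^\Gamma>0$. **Algorithm.** Given $\epsilon>0$, set $\eta=\frac{\epsilon}{2m\log n}$, $\epsilon'=\frac{\epsilon}{8R_C^\Gamma}$, $K^{(k,l)}=\exp(-C^{(k,l)}/\eta)$ entrywise. For scaling vectors $u=(u_k)_{k\in\Gamma}$ let $\mathbf B_u(x)=e^{-\mathbf C(x)/\eta}\prod_{k\in\Gamma}u_k(x_k)\mu_k(x_k)$. Messages are $m_{l\to k}(x_k)=\sum_{x_l}K^{(k,l)}(x_k,x_l)\,w_{l\to k}(x_l)$, where $w_{l\to k}=u_l\mu_l$ if $l\in\Gamma$, and $w_{l\to k}=\prod_{j\in N(l)\setminus k}m_{j\to l}$ otherwise. (The product of all messages into each vertex is kept in memory; the product without one of them is obtained by a division.) 1. *Sinkhorn belief propagation.* Start with $u_k^{(0)}=\mathbf 1$ and some $k^{(0)}\in\Gamma$; compute all messages directed towards $k^{(0)}$ and set $u^{(1)}_{k^{(0)}}=1/m_{\ell_k\to k}$ with $k=k^{(0)}$, all other $u_k^{(1)}=u_k^{(0)}$. For $t=1,2,\dots$, as long as $\sum_{k\in\Gamma}\|P_k(\mathbf B_{u^{(t)}})-\mu_k\|_1\ge\epsilon'$: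 pick $k=k^{(t)}$ uniformly at random from $\Gamma\setminus\{k^{(t-1)}\}$, update the messages along the path from $k^{(t-1)}$ to $k^{(t)}$, and set $u_k^{(t+1)}=1/m_{\ell_k\to k}$, leaving the other scaling vectors unchanged. Return the last $u=u^{(t)}$. 2. *Construction.* Compute the edge marginals $P_{k,l}(\mathbf B_u)$, $(k,l)\in E$, by one sweep of messages towards $k^{(0)}$ and one sweep back. 3. *Rounding.* For every $k\in\Gamma$, replace $F=P_{\ell_k,k}(\mathbf B_u)$ by its rounding (Altschuler–Weed–Rigollet) to row sums $r=P_{\ell_k}(\mathbf B_u)$ and column sums $c=\mu_k$: multiply each row $i$ of $F$ by $\min(r_i/r_i(F),1)$, then each column $j$ of the result $F'$ by $\min(c_j/c_j(F'),1)$ to get $F''$, and return $F''+e_re_c^{T}/\|e_r\|_1$ (or $F''$ if $e_r=0$), where $e_r$, $e_c$ are the remaining row and column defects. The output is the resulting family $(\widehat B_{k,l})_{(k,l)\in E}$; it represents the tensor $\widehat{\mathbf B}(x)=\prod_{(k,l)\in E}\widehat B_{k,l}(x_k,x_l)\big/\prod_{k}\hat b_k(x_k)^{\deg k-1}$, where $\hat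 b_k$ is the marginal at $k$ of the matrices on the edges at $k$. Let $T$ be the number of arithmetic operations ($+,-,\cdot,/,\exp,\log,\min,|\cdot|$, comparisons) spent on computing the parameters, all message and scaling updates, the construction and the rounding; the evaluation of the loop test of step 1 is not counted. ($T=\infty$ if the loop does not stop.) **Theorem.** There is a universal constant $c>0$ such that, in this setting, for every $\epsilon>0$ the algorithm stops almost surely, its output satisfies $P_{k,l}(\widehat{\mathbf B})=\widehat B_{k,l}$ for all $(k,l)\in E$, and $\widehat{\mathbf B}$ is an $\epsilon$-approximate solution. If moreover $\epsilon\le16|\Gamma|R_C^\Gamma$ (equivalently $\epsilon'\le2|\Gamma|$), then $$\mathbb E[T]\le c\,\frac{d(G)\,m\,|\Gamma|^2\,n^2\,(R_C^\Gamma)^2\log n}{\epsilon^2},$$ and for all $\delta\in(0,1/2)$ $$\mathbb P\left(T\le c\,\frac{d(G)\,m\,|\Gamma|^2\,n^2\,(R_C^\Gamma)^2\log (n)\,\log(1/\delta)}{\epsilon^2}\right)\ge1-\delta.$$ -/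

import Mathlib

open MeasureTheory
open scoped ENNReal

noncomputable section

/-! ### Real arithmetic with an operation counter

A value of type `Counted α` is the result of a computation with real numbers, together with the
number of arithmetic operations (`+`, `-`, `*`, `/`, `exp`, `log`, `min`, `abs`, comparisons) that
were executed. Reading and writing memory is free. -/

/-- A result together with the number of arithmetic operations spent on it. -/
structure Counted (α : Type) where
  val : α
  ops : ℕ

namespace Counted

instance : Monad Counted where
  pure a := ⟨a, 0⟩
  bind x f := ⟨(f x.val).val, x.ops + (f x.val).ops⟩

def add (a b : ℝ) : Counted ℝ := ⟨a + b, 1⟩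
def sub (a b : ℝ) : Counted ℝ := ⟨a - b, 1⟩
def mul (a b : ℝ) : Counted ℝ := ⟨a * b, 1⟩
def div (a b : ℝ) : Counted ℝ := ⟨a / b, 1⟩
def neg (a : ℝ) : Counted ℝ := ⟨-a, 1⟩
def exp (a : ℝ) : Counted ℝ := ⟨Real.exp a, 1⟩
def log (a : ℝ) : Counted ℝ := ⟨Real.log a, 1⟩
def min (a b : ℝ) : Counted ℝ := ⟨Min.min a b, 1⟩
def abs (a : ℝ) : Counted ℝ := ⟨|a|, 1⟩

/-- Compute a family entry by entry; the operations of all entries are added up. -/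
def vec {ι α : Type} [Fintype ι] (f : ι → Counted α) : Counted (ι → α) :=
  ⟨fun i => (f i).val, ∑ i, (f i).ops⟩

/-- Compute the entries of a finite family and accumulate their sum, one addition per entry. -/
def sum {ι : Type} [Fintype ι] (f : ι → Counted ℝ) : Counted ℝ :=
  ⟨∑ i, (f i).val, ∑ i, ((f i).ops + 1)⟩

/-- The largest of finitely many stored numbers, one comparison per entry. -/
def max {ι : Type} [Fintype ι] (f : ι → ℝ) : Counted ℝ :=
  ⟨⨆ i, f i, Fintype.card ι⟩

end Counted

/-! ### Rounding of a matrix to prescribed row and column sums -/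

section Rounding

variable {n : ℕ}

def rowSums (F : Fin n → Fin n → ℝ) : Counted (Fin n → ℝ) :=
  Counted.vec fun i => Counted.sum fun j => pure (F i j)

def colSums (F : Fin n → Fin n → ℝ) : Counted (Fin n → ℝ) :=
  Counted.vec fun j => Counted.sum fun i => pure (F i j)

/-- The rounding procedure of Altschuler, Weed and Rigollet: scale down the rows of `F` whose sum
exceeds `r`, then the columns whose sum exceeds `c`, and add the rank-one correction
`err_r err_cᵀ / ‖err_r‖₁`. (A quotient with denominator `0` only occurs for a zero row, a zero
column, or a zero correction, and is then `0`.) -/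
def roundMatrix (F : Fin n → Fin n → ℝ) (r c : Fin n → ℝ) :
    Counted (Fin n → Fin n → ℝ) := do
  let rF ← rowSums F
  let x ← Counted.vec fun i => do
    let a ← Counted.div (r i) (rF i)
    Counted.min a 1
  let F₁ ← Counted.vec fun i => Counted.vec fun j => Counted.mul (x i) (F i j)
  let cF ← colSums F₁
  let y ← Counted.vec fun j => do
    let a ← Counted.div (c j) (cF j)
    Counted.min a 1
  let F₂ ← Counted.vec fun i => Counted.vec fun j => Counted.mul (F₁ i j) (y j)
  let r₂ ← rowSums F₂
  let c₂ ← colSums F₂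
  let errR ← Counted.vec fun i => Counted.sub (r i) (r₂ i)
  let errC ← Counted.vec fun j => Counted.sub (c j) (c₂ j)
  let total ← Counted.sum fun i => Counted.abs (errR i)
  Counted.vec fun i => Counted.vec fun j => do
    let p ← Counted.mul (errR i) (errC j)
    let q ← Counted.div p total
    Counted.add (F₂ i j) q

end Rounding

/-! ### Tree-structured multi-marginal optimal transport -/

/-- A tree-structured multi-marginal optimal transport problem with `m` marginals on `n` points.
`cost k l x y` is `C^{(k,l)}(x_k, x_l)`, which is relevant only for edges `{k, l}`, and `μ k` is
the prescribed marginal, which is relevant only for leaves `k`. -/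
structure TreeMOT (m n : ℕ) where
  G : SimpleGraph (Fin m)
  isTree : G.IsTree
  cost : Fin m → Fin m → Fin n → Fin n → ℝ
  cost_symm : ∀ k l, G.Adj k l → ∀ x y, cost k l x y = cost l k y x
  cost_nonneg : ∀ k l, G.Adj k l → ∀ x y, 0 ≤ cost k l x y
  μ : Fin m → Fin n → ℝ
  μ_nonneg : ∀ k, (∃! l, G.Adj k l) → ∀ x, 0 ≤ μ k x
  μ_sum : ∀ k, (∃! l, G.Adj k l) → ∑ x, μ k x = 1

namespace TreeMOT

variable {m n : ℕ} (S : TreeMOT m n)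

open Classical in
/-- `Γ`: the set of leaves of the tree. -/
def leaves : Finset (Fin m) := Finset.univ.filter fun k => ∃! l, S.G.Adj k l

open Classical in
/-- A neighbour of `k`; for a leaf this is its unique neighbour `ℓ_k`. -/
def nbr (k : Fin m) : Fin m := if h : ∃ l, S.G.Adj k l then h.choose else k

open Classical in
/-- The cost tensor `C(x) = ∑_{(k,l) ∈ E} C^{(k,l)}(x_k, x_l)`, each edge taken once. -/
def costTensor (x : Fin m → Fin n) : ℝ :=
  ∑ k, ∑ l, if S.G.Adj k l ∧ k < l then S.cost k l (x k) (x l) else 0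

/-- The projection `P_k(B)`. -/
def proj (B : (Fin m → Fin n) → ℝ) (k : Fin m) (y : Fin n) : ℝ :=
  ∑ x : Fin m → Fin n, if x k = y then B x else 0

/-- The projection `P_{k,l}(B)`. -/
def proj₂ (B : (Fin m → Fin n) → ℝ) (k l : Fin m) (y z : Fin n) : ℝ :=
  ∑ x : Fin m → Fin n, if x k = y ∧ x l = z then B x else 0

/-- The set `Π_Γ^m((μ_k)_{k ∈ Γ})` of feasible transport plans. -/
def feasible : Set ((Fin m → Fin n) → ℝ) :=
  {B | (∀ x, 0 ≤ B x) ∧ ∀ k ∈ S.leaves, proj B k = S.μ k}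

/-- `⟨C, B⟩`. -/
def totalCost (B : (Fin m → Fin n) → ℝ) : ℝ := ∑ x, S.costTensor x * B x

/-- `B` is an `ε`-approximate solution: feasible, with cost at most `ε` above the minimum. -/
def IsApproxSolution (ε : ℝ) (B : (Fin m → Fin n) → ℝ) : Prop :=
  B ∈ S.feasible ∧ ∀ B' ∈ S.feasible, S.totalCost B ≤ S.totalCost B' + ε

/-- `R_C^Γ`: the largest entry of the matrices `C^{(k, ℓ_k)}`, `k ∈ Γ`. -/
def leafCost : ℝ := ⨆ p : S.leaves × Fin n × Fin n, S.cost p.1 (S.nbr p.1) p.2.1 p.2.2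

/-- The tensor `B(Λ)`, in terms of the scaling vectors `u_k = exp(λ_k / η)`. -/
def scaledTensor (η : ℝ) (u : Fin m → Fin n → ℝ) (x : Fin m → Fin n) : ℝ :=
  Real.exp (-S.costTensor x / η) * ∏ k ∈ S.leaves, (u k (x k) * S.μ k (x k))

/-- The quantity `∑_{k ∈ Γ} ‖P_k(B(Λ)) - μ_k‖₁` in the loop test of the Sinkhorn iteration. -/
def residual (η : ℝ) (u : Fin m → Fin n → ℝ) : ℝ :=
  ∑ k ∈ S.leaves, ∑ y, |proj (S.scaledTensor η u) k y - S.μ k y|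

open Classical in
/-- The tensor that decouples according to the tree and has edge projections `E k l`:
the product of the edge projections over the product of the vertex projections, each raised to
the degree of the vertex minus one. -/
def treeTensor (E : Fin m → Fin m → Fin n → Fin n → ℝ) (x : Fin m → Fin n) : ℝ :=
  (∏ k, ∏ l, if S.G.Adj k l ∧ k < l then E k l (x k) (x l) else 1) /
    ∏ k, (∑ y, E k (S.nbr k) (x k) y) ^ (S.G.degree k - 1)

/-! ### Belief propagation -/

/-- The memory of the Sinkhorn belief propagation algorithm: `scal k` is `u_k`, `msg l k` is the
current message `m_{l → k}` (a function of `x_k`), and `bel k` holds the product of all current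
messages `m_{j → k}`, `j ∈ N(k)`. -/
structure State (m n : ℕ) where
  scal : Fin m → Fin n → ℝ
  msg : Fin m → Fin m → Fin n → ℝ
  bel : Fin m → Fin n → ℝ

/-- Memory with scaling vectors `u` in which all messages are still `1`. -/
def freshState (u : Fin m → Fin n → ℝ) : State m n := ⟨u, fun _ _ _ => 1, fun _ _ => 1⟩

/-- `K^{(k,l)}(x, y) = exp(-C^{(k,l)}(x, y) / η)`. -/
def kernel (η : ℝ) (k l : Fin m) (x y : Fin n) : Counted ℝ := do
  let a ← Counted.neg (S.cost k l x y)
  let b ← Counted.div a η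
  Counted.exp b

/-- The factor at `l` of the message from `l` to `k`: it is `u_l μ_l` for a leaf `l`, and the
product of the messages `m_{j → l}` over `j ∈ N(l) \ {k}` otherwise, which is obtained as
the product over all of `N(l)`, divided by `m_{k → l}`. -/
def outgoing (s : State m n) (l k : Fin m) : Counted (Fin n → ℝ) :=
  if l ∈ S.leaves then Counted.vec fun y => Counted.mul (s.scal l y) (S.μ l y)
  else Counted.vec fun y => Counted.div (s.bel l y) (s.msg k l y)

/-- Update the message `m_{l → k}` (and the stored product of the messages into `k`). -/
def send (η : ℝ) (s : State m n) (e : Fin m × Fin m) : Counted (State m n) := do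
  let l := e.1
  let k := e.2
  let w ← S.outgoing s l k
  let new ← Counted.vec fun x => Counted.sum fun y => do
    let q ← S.kernel η k l x y
    Counted.mul q (w y)
  let b ← Counted.vec fun x => do
    let p ← Counted.mul (s.bel k x) (new x)
    Counted.div p (s.msg l k x)
  pure { s with
    msg := Function.update s.msg l (Function.update (s.msg l) k new)
    bel := Function.update s.bel k b }

/-- Update the messages along a list of directed edges, in the given order. -/
def sendAll (η : ℝ) (es : List (Fin m × Fin m)) (s : State m n) : Counted (State m n) :=
  es.foldlM (S.send η) s

/-- The path from `a` to `b` in the tree. -/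
def path (a b : Fin m) : S.G.Walk a b := (S.isTree.existsUnique_path a b).choose

/-- The directed edges on the path from `a` to `b`, in order. -/
def pathEdges (a b : Fin m) : List (Fin m × Fin m) :=
  (S.path a b).darts.map fun d => (d.fst, d.snd)

/-- The vertices other than the root `r`, ordered by increasing distance from `r`. -/
def order (r : Fin m) : List (Fin m) :=
  (List.range m).flatMap fun i =>
    (List.finRange m).filter fun v => v ≠ r ∧ S.G.dist v r = i

/-- The edges directed towards `r`, the farthest first. -/
def inwardEdges (r : Fin m) : List (Fin m × Fin m) :=
  (S.order r).reverse.map fun v => (v, (S.path v r).snd)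

/-- The edges directed away from `r`, the nearest first. -/
def outwardEdges (r : Fin m) : List (Fin m × Fin m) :=
  (S.order r).map fun v => ((S.path v r).snd, v)

/-! ### The algorithm -/

/-- The Sinkhorn update `u_k ← (m_{ℓ_k → k})⁻¹`. -/
def updateScaling (k : Fin m) (s : State m n) : Counted (State m n) := do
  let v ← Counted.vec fun x => Counted.div 1 (s.msg (S.nbr k) k x)
  pure { s with scal := Function.update s.scal k v }

/-- Sinkhorn belief propagation with the update order `κ 0, κ 1, …`, without the loop test. The
scaling vectors start at `u_k = 1`; the messages towards `κ 0` are computed and `κ 0` is updated,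
which gives `iterate κ 0`. Every further step updates the messages on the path from the previous
vertex to the next one, and then the scaling vector of the latter. -/
def iterate (η : ℝ) (κ : ℕ → Fin m) : ℕ → Counted (State m n)
  | 0 => do
    let s ← S.sendAll η (S.inwardEdges (κ 0)) (freshState fun _ _ => 1)
    S.updateScaling (κ 0) s
  | t + 1 => do
    let s ← iterate η κ t
    let s' ← S.sendAll η (S.pathEdges (κ t) (κ (t + 1))) s
    S.updateScaling (κ (t + 1)) s'

open Classical in
/-- Sinkhorn belief propagation: iterate as long as the residual is at least `ε'`, and return the
scaling vectors (`none` if the loop does not terminate). The operations counted are those that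
update the messages and the scaling vectors; the evaluation of the loop test is not counted. -/
def sinkhornBP (ε' η : ℝ) (κ : ℕ → Fin m) : Option (Counted (Fin m → Fin n → ℝ)) :=
  if h : ∃ t, S.residual η (S.iterate η κ t).val.scal < ε' then
    some (do
      let s ← S.iterate η κ (Nat.find h)
      pure s.scal)
  else none

open Classical in
/-- The edge projections `P_{k,l}(B(Λ))` (for all directed edges), computed from the scaling
vectors by passing messages towards a root `r` and back. -/
def edgeProjections (η : ℝ) (r : Fin m) (u : Fin m → Fin n → ℝ) :
    Counted (Fin m → Fin m → Fin n → Fin n → ℝ) := do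
  let s ← S.sendAll η (S.inwardEdges r) (freshState u)
  let s' ← S.sendAll η (S.outwardEdges r) s
  Counted.vec fun k => Counted.vec fun l =>
    if S.G.Adj k l then do
      let a ← S.outgoing s' k l
      let b ← S.outgoing s' l k
      Counted.vec fun x => Counted.vec fun y => do
        let q ← S.kernel η k l x y
        let p ← Counted.mul (a x) q
        Counted.mul p (b y)
    else pure fun _ _ => 0

open Classical in
/-- The rounding step: for every leaf `k` the matrix on the edge `{ℓ_k, k}` is rounded to the
row sums `P_{ℓ_k}(B)` and the column sums `μ_k`; all other matrices are kept. -/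
def round (E : Fin m → Fin m → Fin n → Fin n → ℝ) :
    Counted (Fin m → Fin m → Fin n → Fin n → ℝ) :=
  Counted.vec fun k => Counted.vec fun l =>
    if S.G.Adj k l then
      if k ∈ S.leaves then do
        let r ← rowSums (E l k)
        let F ← roundMatrix (E l k) r (S.μ k)
        pure fun x y => F y x
      else if l ∈ S.leaves then do
        let r ← rowSums (E k l)
        roundMatrix (E k l) r (S.μ l)
      else pure (E k l)
    else pure fun _ _ => 0

/-- The parameters `η = ε / (2 m log n)` and `ε' = ε / (8 R_C^Γ)`. -/
def parameters (ε : ℝ) : Counted (ℝ × ℝ) := do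
  let a ← Counted.log n
  let b ← Counted.mul 2 m
  let c ← Counted.mul b a
  let η ← Counted.div ε c
  let R ← Counted.max fun p : S.leaves × Fin n × Fin n => S.cost p.1 (S.nbr p.1) p.2.1 p.2.2
  let d ← Counted.mul 8 R
  let ε' ← Counted.div ε d
  pure (η, ε')

/-- The complete method with update order `κ`: it returns the edge projections of the rounded
tensor (`none` if the Sinkhorn loop does not terminate). -/
def solve (ε : ℝ) (κ : ℕ → Fin m) : Option (Counted (Fin m → Fin m → Fin n → Fin n → ℝ)) :=
  (S.sinkhornBP (S.parameters ε).val.2 (S.parameters ε).val.1 κ).map fun loop => do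
    let p ← S.parameters ε
    let u ← loop
    let E ← S.edgeProjections p.1 (κ 0) u
    S.round E

/-- The number of arithmetic operations of the complete method (`∞` if it does not terminate). -/
def operations (ε : ℝ) (κ : ℕ → Fin m) : ℝ≥0∞ :=
  match S.solve ε κ with
  | some r => (r.ops : ℝ≥0∞)
  | none => ⊤

end TreeMOT

/-- A random update order in `Γ`: the first vertex is in `Γ`, and given the past, the next one is
uniformly distributed on `Γ` without the current one. -/
structure IsRandomUpdateOrder {V Ω : Type*} [DecidableEq V] [MeasurableSpace V]
    [MeasurableSpace Ω] (Γ : Finset V) (P : Measure Ω) (κ : ℕ → Ω → V) : Prop where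
  measurable : ∀ t, Measurable (κ t)
  initial : ∀ᵐ ω ∂P, κ 0 ω ∈ Γ
  step : ∀ (t : ℕ) (a : ℕ → V),
    P {ω | ∀ s ≤ t + 1, κ s ω = a s} =
      P {ω | ∀ s ≤ t, κ s ω = a s} *
        if a (t + 1) ∈ Γ.erase (a t) then ((Γ.erase (a t)).card : ℝ≥0∞)⁻¹ else 0

end

/-!
Correctness. On a tree, the sum over all coordinates of a product of vertex and edge factors can
be evaluated by eliminating leaves (`sum_graphProd_edge`): the marginal at an edge `{k, r}` is
determined by any family of messages that satisfies the local message equations on the edges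
directed towards `r`. For the algorithm it is therefore enough to know which stored messages
satisfy their equation. Sending along `(l, k)` repairs the message of this edge and can only spoil
messages leaving `k` to other vertices (`send_valid`), and moving the root of a tree to a
neighbour reverses a single edge (`SimpleGraph.IsTree.towardRoot_move`). So after each step all
messages towards the current leaf are valid, every step is an exact Sinkhorn update
(`iterate_succ_isSinkhornStep`), and one sweep in and one sweep out yield the edge marginals
(`edgeProjections_val`). The same elimination, with the vertex marginals in the role of messages,
shows that the output tensor has the rounded matrices as its edge marginals
(`Consistent.proj₂_treeTensor`).

Accuracy. Write `B_u` for the scaled tensor, `E(u)` for the residual and `R` for `R_C^Γ`. The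
vectors produced by the algorithm have `log u` of oscillation at most `R / η`. Gibbs' inequality
for `B_u` and for a feasible plan `B'`, both compared with the product of the leaf marginals,
gives `⟨C, B_u⟩ ≤ ⟨C, B'⟩ + R E(u) + η m log n` (`totalCost_scaledTensor_le`), and the rounding
costs at most another `R E(u)` (`round_spec`).

Number of steps. A Sinkhorn update at `k` increases the dual objective by the Kullback-Leibler
divergence of `μ_k` from `P_k(B_u)`, which is at least a quarter of the squared `ℓ¹` distance
(`IsSinkhornStep.dual_le`); on average over `k` this is at least `E² / (4 |Γ|²)`. By concavity the dual gap
is at most `A E` with `A = 2 R / η` (`dualGap_le`). Hence the concave potential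
`∫ min(1, s⁻²) ds` of the gap, in units of `A ε'`, loses at least `1 / N` on average per step while
`E ≥ ε'`, where `N = 4 |Γ|² A / ε'`, and it is bounded by `2`. So one plus the potential, killed
when the loop stops, is a supermartingale with geometric decay (`runPotential_step`), and the
probability that the loop still runs after step `t` is at most `3 exp (-t / (3 N))`
(`measureReal_running_le`). This gives termination, the expectation and the tail bound. Every step
costs `O(d(G) n²)` operations and everything else `O(m n²)` (`solve_spec`); the condition
`ε ≤ 16 |Γ| R` bounds the latter by a constant multiple of the claimed quantity.
-/

noncomputable section

open Finset

/-! ### Distances in a tree -/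

section Tree

variable {V : Type*} {G : SimpleGraph V}

/-- `v → p` is an edge of `G` that leads towards the root `r`. -/
def TowardRoot (G : SimpleGraph V) (r v p : V) : Prop :=
  G.Adj v p ∧ G.dist r v = G.dist r p + 1

theorem TowardRoot.ne_root {r v p : V} (h : TowardRoot G r v p) : v ≠ r := by
  rintro rfl
  have := h.2
  simp at this

theorem SimpleGraph.IsTree.towardRoot_or (hG : G.IsTree) (r : V) {v p : V} (h : G.Adj v p) :
    TowardRoot G r v p ∨ TowardRoot G r p v := by
  rcases hG.dist_eq_dist_add_one_of_adj r h with h' | h'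
  · exact Or.inl ⟨h, h'⟩
  · exact Or.inr ⟨h.symm, h'⟩

theorem SimpleGraph.IsTree.towardRoot_snd (hG : G.IsTree) {r v : V} (hv : v ≠ r)
    {w : G.Walk v r} (hw : w.IsPath) : TowardRoot G r v w.snd := by
  obtain ⟨q, hq, hql⟩ := hG.connected.exists_path_of_dist v r
  obtain rfl : w = q := by
    exact congrArg Subtype.val ((hG.isAcyclic.subsingleton_path v r).elim ⟨w, hw⟩ ⟨q, hq⟩)
  have hnil : ¬ w.Nil := SimpleGraph.Walk.not_nil_of_ne hv
  have hadj := w.adj_snd hnil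
  refine ⟨hadj, ?_⟩
  have h1 : w.tail.length + 1 = w.length := SimpleGraph.Walk.length_tail_add_one hnil
  have h2 := SimpleGraph.dist_le w.tail
  have h3 := hG.dist_eq_dist_add_one_of_adj r hadj
  rw [SimpleGraph.dist_comm (u := r) (v := v), SimpleGraph.dist_comm (u := r)] at *
  omega

theorem SimpleGraph.IsTree.exists_towardRoot (hG : G.IsTree) {r v : V} (hv : v ≠ r) :
    ∃ p, TowardRoot G r v p := by
  obtain ⟨w, hw, -⟩ := hG.existsUnique_path v r
  exact ⟨_, hG.towardRoot_snd hv hw⟩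

/-- The next vertex on the way to the root is unique: a shortest walk through it is a path. -/
theorem SimpleGraph.IsTree.towardRoot_unique (hG : G.IsTree) {r v p q : V}
    (hp : TowardRoot G r v p) (hq : TowardRoot G r v q) : p = q := by
  have key : ∀ p, TowardRoot G r v p → ∃ w : G.Walk v r, w.IsPath ∧ w.snd = p := by
    intro p hp
    obtain ⟨w, hw⟩ := hG.connected.exists_walk_length_eq_dist p r
    refine ⟨SimpleGraph.Walk.cons hp.1 w, ?_, by simp⟩
    apply SimpleGraph.Walk.isPath_of_length_eq_dist
    rw [SimpleGraph.Walk.length_cons, hw, SimpleGraph.dist_comm (u := v),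
      SimpleGraph.dist_comm (u := p), hp.2]
  obtain ⟨w₁, h₁, rfl⟩ := key p hp
  obtain ⟨w₂, h₂, rfl⟩ := key q hq
  have := congrArg Subtype.val
    ((hG.isAcyclic.subsingleton_path v r).elim ⟨w₁, h₁⟩ ⟨w₂, h₂⟩)
  simp only at this
  rw [this]

/-- Moving the root along an edge reverses that edge and no other. -/
theorem SimpleGraph.IsTree.towardRoot_move (hG : G.IsTree) {r r' v p : V} (hr : G.Adj r r')
    (h : TowardRoot G r' v p) : TowardRoot G r v p ∨ v = r ∧ p = r' := by
  rcases hG.towardRoot_or r h.1 with h1 | h1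
  · exact Or.inl h1
  right
  have hd : G.dist r r' = 1 := SimpleGraph.dist_eq_one_iff_adj.2 hr
  have hd' : G.dist r' r = 1 := SimpleGraph.dist_eq_one_iff_adj.2 hr.symm
  have t1 := hG.connected.dist_triangle (u := r) (v := r') (w := p)
  have t2 := hG.connected.dist_triangle (u := r') (v := r) (w := v)
  have e1 := h.2
  have e2 := h1.2
  by_cases hv : v = r
  · refine ⟨hv, ?_⟩
    subst hv
    have : G.dist r' p = 0 := by
      rw [SimpleGraph.dist_self] at e2
      omega
    exact (hG.connected.dist_eq_zero_iff.1 this).symm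
  · obtain ⟨q, hq⟩ := hG.exists_towardRoot hv
    have t3 := hG.connected.dist_triangle (u := r') (v := r) (w := q)
    have e3 := hq.2
    have hq' : TowardRoot G r' v q := by
      refine ⟨hq.1, ?_⟩
      rcases hG.dist_eq_dist_add_one_of_adj r' hq.1 with h' | h' <;> omega
    obtain rfl := hG.towardRoot_unique h hq'
    omega

end Tree

/-! ### Summing out the vertices of a tree -/

section Elimination

variable {V X : Type*} [Fintype V] [LinearOrder V] [Fintype X]

/-- Summing over all values of one coordinate before summing over all points counts every point
once for each value. -/
theorem sum_sum_update (v : V) (F : (V → X) → ℝ) :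
    ∑ x : V → X, ∑ z, F (Function.update x v z) = Fintype.card X * ∑ x : V → X, F x := by
  have h : ∑ q : (V → X) × X, F (Function.update q.1 v q.2) = ∑ q : (V → X) × X, F q.1 := by
    refine Fintype.sum_equiv
      (⟨fun q => (Function.update q.1 v q.2, q.1 v), fun q => (Function.update q.1 v q.2, q.1 v),
        fun q => by simp, fun q => by simp⟩ : ((V → X) × X) ≃ ((V → X) × X)) _ _ fun q => rfl
  rw [← Fintype.sum_prod_type', h, Fintype.sum_prod_type, mul_sum]
  simp

variable (G : SimpleGraph V) (f : V → X → ℝ) (g : V → V → X → X → ℝ) (M : V → V → X → ℝ)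

open Classical in
/-- The product of vertex factors `f k` and edge factors `g k l` over the subgraph induced on `A`;
every edge is taken once. -/
def graphProd (A : Finset V) (x : V → X) : ℝ :=
  (∏ k ∈ A, f k (x k)) * ∏ k ∈ A, ∏ l ∈ A, if G.Adj k l ∧ k < l then g k l (x k) (x l) else 1

open Classical in
/-- The product of the messages `M l k` that enter `A` from outside. -/
def boundaryProd (A : Finset V) (x : V → X) : ℝ :=
  ∏ k ∈ A, ∏ l ∈ Aᶜ, if G.Adj l k then M l k (x k) else 1

open Classical in
/-- The factor of the message from `v` to `p`: the vertex factor of `v` times all messages into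
`v` that do not come from `p`. -/
def messageFactor (v p : V) (z : X) : ℝ :=
  f v z * ∏ j ∈ univ.filter fun j => G.Adj j v ∧ j ≠ p, M j v z

open Classical in
theorem prod_pairs_insert {V X : Type*} [LinearOrder V] {G : SimpleGraph V}
    {g : V → V → X → X → ℝ} {A : Finset V} {v : V} (hv : v ∉ A)
    (hg : ∀ k l, G.Adj k l → ∀ x y, g k l x y = g l k y x) (x : V → X) :
    (∏ k ∈ insert v A, ∏ l ∈ insert v A,
        if G.Adj k l ∧ k < l then g k l (x k) (x l) else 1) =
      (∏ l ∈ A, if G.Adj v l then g v l (x v) (x l) else 1) *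
        ∏ k ∈ A, ∏ l ∈ A, if G.Adj k l ∧ k < l then g k l (x k) (x l) else 1 := by
  rw [prod_insert hv, prod_insert hv]
  have h1 : ∀ k ∈ A, (∏ l ∈ insert v A, if G.Adj k l ∧ k < l then g k l (x k) (x l) else 1) =
      (if G.Adj k v ∧ k < v then g k v (x k) (x v) else 1) *
        ∏ l ∈ A, if G.Adj k l ∧ k < l then g k l (x k) (x l) else 1 :=
    fun k _ => prod_insert hv
  rw [prod_congr rfl h1, prod_mul_distrib, ← mul_assoc, if_neg (by simp), one_mul,
    ← prod_mul_distrib]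
  congr 1
  refine prod_congr rfl fun l hl => ?_
  have hne : v ≠ l := fun h => hv (h ▸ hl)
  by_cases hadj : G.Adj v l
  · rcases lt_or_gt_of_ne hne with h | h
    · simp [hadj, h, hadj.symm, not_lt.2 h.le]
    · simp [hadj, h, hadj.symm, not_lt.2 h.le, hg v l hadj]
  · have hadj' : ¬ G.Adj l v := fun h => hadj h.symm
    simp [hadj, hadj']

variable {G f g M}

/-- Summing over the coordinate of a vertex `v` with a single neighbour `p` in `A` replaces its
factors by the message from `v` to `p`. -/
theorem sum_graphProd_mul_boundaryProd {A : Finset V} {v p : V} (hv : v ∉ A) (hp : p ∈ A)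
    (hvp : G.Adj v p) (huniq : ∀ l ∈ A, G.Adj v l → l = p)
    (hg : ∀ k l, G.Adj k l → ∀ x y, g k l x y = g l k y x)
    (hM : ∀ y, M v p y = ∑ z, g p v y z * messageFactor G f M v p z) (x : V → X) :
    ∑ z, graphProd G f g (insert v A) (Function.update x v z) *
        boundaryProd G M (insert v A) (Function.update x v z) =
      graphProd G f g A x * boundaryProd G M A x := by
  classical
  have hne : ∀ k ∈ A, k ≠ v := fun k hk h => hv (h ▸ hk)
  have hc : Aᶜ = insert v (insert v A)ᶜ := by
    ext a
    by_cases h : a = v <;> simp [h, hv]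
  have hvc : v ∉ (insert v A)ᶜ := by simp
  have h1 : ∀ z, (∏ l ∈ A, if G.Adj v l then g v l z (x l) else 1) = g p v (x p) z := by
    intro z
    rw [prod_eq_single_of_mem p hp fun l hl hlp => if_neg fun h => hlp (huniq l hl h), if_pos hvp,
      hg v p hvp]
  have h2 : boundaryProd G M A x = M v p (x p) *
      ∏ k ∈ A, ∏ l ∈ (insert v A)ᶜ, if G.Adj l k then M l k (x k) else 1 := by
    rw [boundaryProd, hc, prod_congr rfl fun k _ => prod_insert hvc, prod_mul_distrib]
    congr 1
    rw [prod_eq_single_of_mem p hp fun l hl hlp => if_neg fun h => hlp (huniq l hl h), if_pos hvp]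
  have h3 : ∀ z, boundaryProd G M (insert v A) (Function.update x v z) =
      (∏ j ∈ univ.filter fun j => G.Adj j v ∧ j ≠ p, M j v z) *
        ∏ k ∈ A, ∏ l ∈ (insert v A)ᶜ, if G.Adj l k then M l k (x k) else 1 := by
    intro z
    rw [boundaryProd, prod_insert hv]
    congr 1
    · rw [Function.update_self, ← prod_filter]
      refine prod_congr ?_ fun _ _ => rfl
      ext j
      simp only [mem_filter, mem_compl, mem_insert, not_or, mem_univ, true_and]
      constructor
      · rintro ⟨⟨-, h⟩, h'⟩
        exact ⟨h', fun hj => h (hj ▸ hp)⟩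
      · rintro ⟨h, h'⟩
        exact ⟨⟨h.ne, fun hj => h' (huniq j hj h.symm)⟩, h⟩
    · refine prod_congr rfl fun k hk => prod_congr rfl fun l _ => ?_
      rw [Function.update_of_ne (hne k hk)]
  have h4 : ∀ z, graphProd G f g (insert v A) (Function.update x v z) =
      f v z * g p v (x p) z * graphProd G f g A x := by
    intro z
    rw [graphProd, prod_pairs_insert hv hg, prod_insert hv, Function.update_self, graphProd,
      ← h1 z]
    have e1 : ∏ k ∈ A, f k (Function.update x v z k) = ∏ k ∈ A, f k (x k) :=
      prod_congr rfl fun k hk => by rw [Function.update_of_ne (hne k hk)]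
    have e2 : (∏ l ∈ A, if G.Adj v l then g v l z (Function.update x v z l) else 1) =
        ∏ l ∈ A, if G.Adj v l then g v l z (x l) else 1 :=
      prod_congr rfl fun k hk => by rw [Function.update_of_ne (hne k hk)]
    have e3 : (∏ k ∈ A, ∏ l ∈ A, if G.Adj k l ∧ k < l then
          g k l (Function.update x v z k) (Function.update x v z l) else 1) =
        ∏ k ∈ A, ∏ l ∈ A, if G.Adj k l ∧ k < l then g k l (x k) (x l) else 1 :=
      prod_congr rfl fun k hk => prod_congr rfl fun l hl => by
        rw [Function.update_of_ne (hne k hk), Function.update_of_ne (hne l hl)]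
    rw [e1, e2, e3]
    ring
  simp_rw [h3, h4, h2, hM, messageFactor, sum_mul, mul_sum]
  exact sum_congr rfl fun z _ => by ring

/-- Leaf elimination: a sum over all coordinates of the tree product, tested against a function of
the coordinates in a subtree `A` around the root `r`, reduces to the product over `A` and the
messages entering `A`. Coordinates outside `A` stay as dummy summation variables, hence the power
of `card X`. -/
theorem sum_mul_graphProd_eq (hG : G.IsTree) (r : V)
    (hg : ∀ k l, G.Adj k l → ∀ x y, g k l x y = g l k y x) (h : (V → X) → ℝ) :
    ∀ (N : ℕ) (A : Finset V), #Aᶜ = N → r ∈ A →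
      (∀ v p, v ∈ A → TowardRoot G r v p → p ∈ A) →
      (∀ v ∉ A, ∀ x z, h (Function.update x v z) = h x) →
      (∀ v p, v ∉ A → TowardRoot G r v p →
        ∀ y, M v p y = ∑ z, g p v y z * messageFactor G f M v p z) →
      ∑ x, h x * (graphProd G f g A x * boundaryProd G M A x) =
        (Fintype.card X : ℝ) ^ N * ∑ x, h x * graphProd G f g univ x := by
  classical
  intro N
  induction N with
  | zero =>
    intro A hA _ _ _ _
    have : A = univ := by simpa using hA
    subst this
    simp [boundaryProd]
  | succ N ih =>
    intro A hA hr hcl hh hM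
    have hne : Aᶜ.Nonempty := card_pos.1 (by omega)
    -- a vertex outside `A` nearest to the root has its next vertex, and no other neighbour, in `A`
    obtain ⟨v, hv, hmin⟩ := exists_min_image Aᶜ (fun v => G.dist r v) hne
    rw [mem_compl] at hv
    have hvr : v ≠ r := fun e => hv (e ▸ hr)
    obtain ⟨p, hp⟩ := hG.exists_towardRoot hvr
    have hpA : p ∈ A := by
      by_contra hpA
      have := hmin p (mem_compl.2 hpA)
      have := hp.2
      omega
    have huniq : ∀ l ∈ A, G.Adj v l → l = p := by
      intro l hl hvl
      rcases hG.towardRoot_or r hvl with h1 | h1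
      · exact hG.towardRoot_unique h1 hp
      · exact absurd (hcl l v hl h1) hv
    have hcard : #(insert v A)ᶜ = N := by
      rw [card_compl, card_insert_of_notMem hv]
      rw [card_compl] at hA
      omega
    have step := ih (insert v A) hcard (mem_insert_of_mem hr)
      (by
        intro w q hw hq
        rcases mem_insert.1 hw with rfl | hw
        · rw [hG.towardRoot_unique hq hp]
          exact mem_insert_of_mem hpA
        · exact mem_insert_of_mem (hcl w q hw hq))
      (fun w hw => hh w fun hw' => hw (mem_insert_of_mem hw'))
      (fun w q hw => hM w q fun hw' => hw (mem_insert_of_mem hw'))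
    rw [pow_succ', mul_assoc, ← step, ← sum_sum_update v]
    refine sum_congr rfl fun x _ => ?_
    rw [← sum_graphProd_mul_boundaryProd hv hpA hp.1 huniq hg (hM v p hv hp), mul_sum]
    refine sum_congr rfl fun z _ => ?_
    rw [hh v hv]

theorem card_filter_two_coords [DecidableEq X] {k r : V} (hkr : k ≠ r) (a b : X) :
    #{x : V → X | x k = a ∧ x r = b} = Fintype.card X ^ (#({k, r} : Finset V)ᶜ) := by
  classical
  have : ({x : V → X | x k = a ∧ x r = b} : Finset (V → X)) =
      Fintype.piFinset fun v => if v = k then {a} else if v = r then {b} else univ := by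
    ext x
    simp only [mem_filter, mem_univ, true_and, Fintype.mem_piFinset]
    constructor
    · rintro ⟨rfl, rfl⟩ v
      split_ifs with h1 h2
      · simp [h1]
      · simp [h2]
      · simp
    · intro h
      have h1 := h k
      have h2 := h r
      simp [hkr.symm] at h1 h2
      exact ⟨h1, h2⟩
  rw [this, Fintype.card_piFinset]
  have hc : ∀ v, #(if v = k then {a} else if v = r then {b} else (univ : Finset X)) =
      if v ∈ ({k, r} : Finset V)ᶜ then Fintype.card X else 1 := by
    intro v
    by_cases h1 : v = k
    · simp [h1]
    · by_cases h2 : v = r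
      · subst h2
        simp [hkr.symm]
      · simp [h1, h2]
  simp_rw [hc]
  rw [prod_ite_mem, univ_inter, prod_const]

/-- The marginal of a tree product at an edge `{k, r}`, given messages directed towards `r`. -/
theorem sum_graphProd_edge [DecidableEq X] (hG : G.IsTree) {k r : V} (hkr : G.Adj k r)
    (hg : ∀ k l, G.Adj k l → ∀ x y, g k l x y = g l k y x)
    (hM : ∀ v p, v ≠ k → TowardRoot G r v p →
      ∀ y, M v p y = ∑ z, g p v y z * messageFactor G f M v p z) (a b : X) :
    (∑ x : V → X, if x k = a ∧ x r = b then graphProd G f g univ x else 0) =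
      messageFactor G f M k r a * g k r a b * messageFactor G f M r k b := by
  classical
  -- eliminate all vertices but `k` and `r`, testing against the indicator of the two values
  have key := sum_mul_graphProd_eq (f := f) (M := M) hG r hg
    (fun x => if x k = a ∧ x r = b then 1 else 0) _ {k, r} rfl (by simp)
    (by
      intro v p hv hp
      rcases mem_insert.1 hv with rfl | hv
      · have : TowardRoot G r v r := ⟨hkr, by
          simp [SimpleGraph.dist_eq_one_iff_adj.2 hkr.symm]⟩
        simp [hG.towardRoot_unique hp this]
      · exact absurd (mem_singleton.1 hv) hp.ne_root)
    (by
      intro v hv x z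
      simp only [mem_insert, mem_singleton, not_or] at hv
      simp [Function.update_of_ne (Ne.symm hv.1), Function.update_of_ne (Ne.symm hv.2)])
    (fun v p hv => hM v p fun e => hv (by simp [e]))
  have hb : ∀ x : V → X, graphProd G f g {k, r} x * boundaryProd G M {k, r} x =
      messageFactor G f M k r (x k) * g k r (x k) (x r) * messageFactor G f M r k (x r) := by
    intro x
    have hk : k ∉ ({r} : Finset V) := by simpa using hkr.ne
    have e1 : ∀ v w : V, ({v, w} : Finset V) = {k, r} → G.Adj v w →
        (∏ l ∈ ({k, r} : Finset V)ᶜ, if G.Adj l v then M l v (x v) else 1) =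
          ∏ j ∈ univ.filter fun j => G.Adj j v ∧ j ≠ w, M j v (x v) := by
      intro v w hvw hadj
      rw [← prod_filter, ← hvw]
      refine prod_congr ?_ fun _ _ => rfl
      ext j
      simp only [mem_filter, mem_compl, mem_insert, mem_singleton, not_or, mem_univ, true_and]
      constructor
      · rintro ⟨⟨-, h⟩, h'⟩
        exact ⟨h', h⟩
      · rintro ⟨h, h'⟩
        exact ⟨⟨h.ne, h'⟩, h⟩
    rw [graphProd, prod_pairs_insert hk hg, prod_insert hk, boundaryProd, prod_insert hk,
      prod_singleton, prod_singleton, prod_singleton, prod_singleton, prod_singleton,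
      e1 k r rfl hkr, e1 r k (Finset.pair_comm _ _) hkr.symm]
    simp only [hkr, if_true, lt_irrefl, and_false, if_false]
    simp only [messageFactor]
    ring
  simp_rw [hb] at key
  simp only [ite_mul, one_mul, zero_mul] at key
  have hL : (∑ x : V → X, if x k = a ∧ x r = b then
        messageFactor G f M k r (x k) * g k r (x k) (x r) * messageFactor G f M r k (x r)
        else 0) = (Fintype.card X : ℝ) ^ (#({k, r} : Finset V)ᶜ) *
          (messageFactor G f M k r a * g k r a b * messageFactor G f M r k b) := by
    rw [← Nat.cast_pow, ← card_filter_two_coords hkr.ne a b, ← sum_filter, ← nsmul_eq_mul,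
      ← sum_const]
    refine sum_congr rfl fun x hx => ?_
    obtain ⟨h1, h2⟩ := (mem_filter.1 hx).2
    rw [h1, h2]
  rw [hL] at key
  have hX : (Fintype.card X : ℝ) ≠ 0 := by
    have : Nonempty X := ⟨a⟩
    exact_mod_cast Fintype.card_ne_zero
  exact (mul_left_cancel₀ (pow_ne_zero _ hX) key).symm

end Elimination

/-! ### Message passing -/

namespace Counted

variable {α β : Type}

@[simp] theorem val_bind (x : Counted α) (f : α → Counted β) :
    (x >>= f).val = (f x.val).val := rfl

@[simp] theorem ops_bind (x : Counted α) (f : α → Counted β) :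
    (x >>= f).ops = x.ops + (f x.val).ops := rfl

@[simp] theorem val_pure (a : α) : (pure a : Counted α).val = a := rfl

@[simp] theorem ops_pure (a : α) : (pure a : Counted α).ops = 0 := rfl

end Counted

namespace TreeMOT

variable {m n : ℕ} (S : TreeMOT m n)

theorem mem_leaves {k : Fin m} : k ∈ S.leaves ↔ ∃! l, S.G.Adj k l := by
  simp [leaves]

theorem adj_nbr_of_mem {k : Fin m} (hk : k ∈ S.leaves) : S.G.Adj k (S.nbr k) := by
  have h : ∃ l, S.G.Adj k l := ((S.mem_leaves).1 hk).exists
  rw [nbr, dif_pos h]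
  exact h.choose_spec

theorem eq_nbr_of_adj {k l : Fin m} (hk : k ∈ S.leaves) (h : S.G.Adj k l) : l = S.nbr k :=
  ((S.mem_leaves).1 hk).unique h (S.adj_nbr_of_mem hk)

/-- The vertex factors `u_k μ_k` (on leaves) and `1` (elsewhere) of the scaled tensor. -/
def vertexFactor (u : Fin m → Fin n → ℝ) (l : Fin m) (y : Fin n) : ℝ :=
  if l ∈ S.leaves then u l y * S.μ l y else 1

/-- The value of the Gibbs kernel `exp (-C^{(k,l)} / η)`. -/
def gibbs (η : ℝ) (k l : Fin m) (x y : Fin n) : ℝ := Real.exp (-S.cost k l x y / η)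

theorem gibbs_pos (η : ℝ) (k l : Fin m) (x y : Fin n) : 0 < S.gibbs η k l x y := Real.exp_pos _

theorem gibbs_symm (η : ℝ) (k l : Fin m) (h : S.G.Adj k l) (x y : Fin n) :
    S.gibbs η k l x y = S.gibbs η l k y x := by
  rw [gibbs, gibbs, S.cost_symm k l h]

theorem scaledTensor_eq_graphProd (η : ℝ) (u : Fin m → Fin n → ℝ) (x : Fin m → Fin n) :
    S.scaledTensor η u x = graphProd S.G (S.vertexFactor u) (S.gibbs η) univ x := by
  classical
  rw [scaledTensor, graphProd, mul_comm, costTensor]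
  congr 1
  · simp only [vertexFactor]
    rw [prod_ite_mem, univ_inter]
  · rw [neg_div, sum_div, ← sum_neg_distrib, Real.exp_sum]
    refine prod_congr rfl fun k _ => ?_
    rw [sum_div, ← sum_neg_distrib, Real.exp_sum]
    refine prod_congr rfl fun l _ => ?_
    split_ifs <;> simp [gibbs, neg_div]

/-- The message `m_{l → k}` of the state satisfies its defining equation. -/
def Valid (η : ℝ) (s : State m n) (l k : Fin m) : Prop :=
  ∀ y, s.msg l k y =
    ∑ z, S.gibbs η k l y z * messageFactor S.G (S.vertexFactor s.scal) s.msg l k z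

open Classical in
/-- All stored numbers are positive, and the stored products of messages are correct. -/
structure Sane (s : State m n) : Prop where
  msg_pos : ∀ l k y, 0 < s.msg l k y
  scal_pos : ∀ k y, 0 < s.scal k y
  bel_eq : ∀ k y, s.bel k y = ∏ j ∈ univ.filter fun j => S.G.Adj j k, s.msg j k y

theorem sane_freshState {u : Fin m → Fin n → ℝ} (hu : ∀ k y, 0 < u k y) :
    S.Sane (freshState u) :=
  ⟨fun _ _ _ => one_pos, hu, fun _ _ => by simp [freshState]⟩

variable {S}

theorem messageFactor_of_mem_leaves {u : Fin m → Fin n → ℝ} {M : Fin m → Fin m → Fin n → ℝ}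
    {l k : Fin m} (hl : l ∈ S.leaves) (h : S.G.Adj l k) (z : Fin n) :
    messageFactor S.G (S.vertexFactor u) M l k z = u l z * S.μ l z := by
  classical
  rw [messageFactor, vertexFactor, if_pos hl, filter_false_of_mem, prod_empty, mul_one]
  rintro j - ⟨hj, hjk⟩
  exact hjk ((S.eq_nbr_of_adj hl hj.symm).trans (S.eq_nbr_of_adj hl h).symm)

theorem outgoing_val {s : State m n} (hs : S.Sane s) {l k : Fin m} (h : S.G.Adj l k) :
    (S.outgoing s l k).val = messageFactor S.G (S.vertexFactor s.scal) s.msg l k := by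
  classical
  funext z
  by_cases hl : l ∈ S.leaves
  · rw [messageFactor_of_mem_leaves hl h, outgoing, if_pos hl]
    rfl
  · rw [outgoing, if_neg hl, messageFactor, vertexFactor, if_neg hl, one_mul]
    change s.bel l z / s.msg k l z = _
    rw [hs.bel_eq, div_eq_iff (hs.msg_pos k l z).ne', ← filter_filter,
      ← prod_erase_mul (univ.filter fun j => S.G.Adj j l) _ (mem_filter.2 ⟨mem_univ k, h.symm⟩)]
    congr 1
    refine prod_congr ?_ fun _ _ => rfl
    ext j
    simp [and_comm]

theorem messageFactor_nonneg {s : State m n} (hs : S.Sane s) (l k : Fin m) (z : Fin n) :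
    0 ≤ messageFactor S.G (S.vertexFactor s.scal) s.msg l k z := by
  classical
  refine mul_nonneg ?_ (prod_nonneg fun j _ => (hs.msg_pos j l z).le)
  rw [vertexFactor]
  split_ifs with hl
  · exact mul_nonneg (hs.scal_pos l z).le (S.μ_nonneg l ((S.mem_leaves).1 hl) z)
  · exact zero_le_one

theorem exists_pos_of_sum_pos {ι : Type*} [Fintype ι] {f : ι → ℝ} (h : 0 < ∑ i, f i) :
    ∃ i, 0 < f i := by
  by_contra! h'
  exact absurd h (not_lt.2 (sum_nonpos fun i _ => h' i))

theorem sum_messageFactor_pos (hn : 0 < n) {s : State m n} (hs : S.Sane s) (l k : Fin m) :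
    0 < ∑ z, messageFactor S.G (S.vertexFactor s.scal) s.msg l k z := by
  classical
  have hprod : ∀ z, 0 < ∏ j ∈ univ.filter fun j => S.G.Adj j l ∧ j ≠ k, s.msg j l z :=
    fun z => prod_pos fun j _ => hs.msg_pos j l z
  have hex : ∃ z, 0 < S.vertexFactor s.scal l z := by
    by_cases hl : l ∈ S.leaves
    · have h1 := S.μ_sum l ((S.mem_leaves).1 hl)
      obtain ⟨z, hz⟩ := exists_pos_of_sum_pos (f := S.μ l) (by rw [h1]; exact one_pos)
      refine ⟨z, ?_⟩
      rw [vertexFactor, if_pos hl]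
      exact mul_pos (hs.scal_pos l z) hz
    · exact ⟨⟨0, hn⟩, by rw [vertexFactor, if_neg hl]; exact one_pos⟩
  obtain ⟨z, hz⟩ := hex
  exact sum_pos' (fun z _ => messageFactor_nonneg hs l k z) ⟨z, mem_univ z, mul_pos hz (hprod z)⟩

theorem send_scal (η : ℝ) (s : State m n) (e : Fin m × Fin m) :
    (S.send η s e).val.scal = s.scal := rfl

theorem send_msg_self {η : ℝ} {s : State m n} (hs : S.Sane s) {l k : Fin m} (h : S.G.Adj l k)
    (y : Fin n) : (S.send η s (l, k)).val.msg l k y =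
      ∑ z, S.gibbs η k l y z * messageFactor S.G (S.vertexFactor s.scal) s.msg l k z := by
  rw [← outgoing_val hs h]
  simp only [send, Counted.val_bind, Counted.val_pure, Function.update_self]
  rfl

theorem send_msg_of_ne (η : ℝ) (s : State m n) {l k a b : Fin m} (h : ¬(a = l ∧ b = k)) :
    (S.send η s (l, k)).val.msg a b = s.msg a b := by
  simp only [send, Counted.val_bind, Counted.val_pure]
  by_cases ha : a = l
  · subst ha
    have hb : b ≠ k := fun hb => h ⟨rfl, hb⟩
    rw [Function.update_self, Function.update_of_ne hb]
  · rw [Function.update_of_ne ha]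

theorem send_sane (hn : 0 < n) {η : ℝ} {s : State m n} (hs : S.Sane s) {l k : Fin m}
    (h : S.G.Adj l k) : S.Sane (S.send η s (l, k)).val := by
  classical
  have hpos : ∀ y, 0 < (S.send η s (l, k)).val.msg l k y := by
    intro y
    rw [send_msg_self hs h]
    obtain ⟨z, hz⟩ := exists_pos_of_sum_pos (sum_messageFactor_pos hn hs l k)
    exact sum_pos' (fun z _ => mul_nonneg (S.gibbs_pos η k l y z).le
      (messageFactor_nonneg hs l k z)) ⟨z, mem_univ z, mul_pos (S.gibbs_pos η k l y z) hz⟩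
  refine ⟨fun a b y => ?_, hs.scal_pos, fun a y => ?_⟩
  · by_cases hab : a = l ∧ b = k
    · obtain ⟨rfl, rfl⟩ := hab
      exact hpos y
    · rw [send_msg_of_ne η s hab]
      exact hs.msg_pos a b y
  · by_cases ha : a = k
    · subst ha
      have hbel : (S.send η s (l, a)).val.bel a y =
          s.bel a y * (S.send η s (l, a)).val.msg l a y / s.msg l a y := by
        simp only [send, Counted.val_bind, Counted.val_pure, Function.update_self]
        rfl
      have hl : l ∈ univ.filter fun j => S.G.Adj j a := mem_filter.2 ⟨mem_univ l, h⟩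
      rw [hbel, hs.bel_eq, div_eq_iff (hs.msg_pos l a y).ne', ← mul_prod_erase _ _ hl,
        ← mul_prod_erase _ (fun j => (S.send η s (l, a)).val.msg j a y) hl]
      have : ∏ j ∈ (univ.filter fun j => S.G.Adj j a).erase l,
          (S.send η s (l, a)).val.msg j a y =
          ∏ j ∈ (univ.filter fun j => S.G.Adj j a).erase l, s.msg j a y :=
        prod_congr rfl fun j hj => by
          rw [send_msg_of_ne η s fun e => (mem_erase.1 hj).1 e.1]
      rw [this]
      ring
    · have hbel : (S.send η s (l, k)).val.bel a y = s.bel a y := by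
        simp only [send, Counted.val_bind, Counted.val_pure]
        rw [Function.update_of_ne ha]
      rw [hbel, hs.bel_eq]
      exact prod_congr rfl fun j _ => by rw [send_msg_of_ne η s fun e => ha e.2]

theorem messageFactor_send {η : ℝ} {s : State m n} {l k a b : Fin m} (h : ¬(k = a ∧ l ≠ b)) :
    messageFactor S.G (S.vertexFactor (S.send η s (l, k)).val.scal)
      (S.send η s (l, k)).val.msg a b =
    messageFactor S.G (S.vertexFactor s.scal) s.msg a b := by
  classical
  funext z
  rw [messageFactor, messageFactor, send_scal]
  congr 1
  refine prod_congr rfl fun j hj => ?_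
  rw [send_msg_of_ne]
  rintro ⟨rfl, rfl⟩
  exact h ⟨rfl, (mem_filter.1 hj).2.2⟩

theorem send_valid_self {η : ℝ} {s : State m n} (hs : S.Sane s) {l k : Fin m}
    (h : S.G.Adj l k) : S.Valid η (S.send η s (l, k)).val l k := by
  intro y
  rw [send_msg_self hs h, messageFactor_send fun e => h.ne e.1.symm]

/-- Sending along `(l, k)` can only invalidate messages leaving `k` to vertices other than `l`. -/
theorem send_valid {η : ℝ} {s : State m n} (hs : S.Sane s) {l k a b : Fin m}
    (h : S.G.Adj l k) (hab : S.Valid η s a b) (hne : ¬(k = a ∧ l ≠ b)) :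
    S.Valid η (S.send η s (l, k)).val a b := by
  by_cases e : a = l ∧ b = k
  · obtain ⟨rfl, rfl⟩ := e
    exact send_valid_self hs h
  · intro y
    rw [send_msg_of_ne η s e, messageFactor_send hne, hab y]

theorem sendAll_cons (η : ℝ) (e : Fin m × Fin m) (es : List (Fin m × Fin m)) (s : State m n) :
    (S.sendAll η (e :: es) s).val = (S.sendAll η es (S.send η s e).val).val := rfl

theorem sendAll_scal (η : ℝ) (es : List (Fin m × Fin m)) (s : State m n) :
    (S.sendAll η es s).val.scal = s.scal := by
  induction es generalizing s with
  | nil => rfl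
  | cons e es ih => rw [sendAll_cons, ih, send_scal]

theorem sendAll_sane (hn : 0 < n) {η : ℝ} (es : List (Fin m × Fin m))
    (hadj : ∀ e ∈ es, S.G.Adj e.1 e.2) {s : State m n} (hs : S.Sane s) :
    S.Sane (S.sendAll η es s).val := by
  induction es generalizing s with
  | nil => exact hs
  | cons e es ih =>
    rw [sendAll_cons]
    exact ih (fun e' he' => hadj e' (List.mem_cons_of_mem _ he'))
      (send_sane hn hs (hadj e List.mem_cons_self))

theorem sendAll_valid_of_valid (hn : 0 < n) {η : ℝ} (es : List (Fin m × Fin m))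
    (hadj : ∀ e ∈ es, S.G.Adj e.1 e.2) {s : State m n} (hs : S.Sane s) {a b : Fin m}
    (hab : S.Valid η s a b) (hne : ∀ e ∈ es, ¬(e.2 = a ∧ e.1 ≠ b)) :
    S.Valid η (S.sendAll η es s).val a b := by
  induction es generalizing s with
  | nil => exact hab
  | cons e es ih =>
    rw [sendAll_cons]
    have he := hadj e List.mem_cons_self
    exact ih (fun e' he' => hadj e' (List.mem_cons_of_mem _ he')) (send_sane hn hs he)
      (send_valid hs he hab (hne e List.mem_cons_self))
      (fun e' he' => hne e' (List.mem_cons_of_mem _ he'))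

/-- After sending along a list of edges none of which invalidates an earlier one, all messages of
the list are valid. -/
theorem sendAll_valid (hn : 0 < n) {η : ℝ} (es : List (Fin m × Fin m))
    (hadj : ∀ e ∈ es, S.G.Adj e.1 e.2)
    (hpw : es.Pairwise fun e e' => ¬(e'.2 = e.1 ∧ e'.1 ≠ e.2)) {s : State m n} (hs : S.Sane s) :
    ∀ e ∈ es, S.Valid η (S.sendAll η es s).val e.1 e.2 := by
  induction es generalizing s with
  | nil => simp
  | cons e es ih =>
    rw [List.pairwise_cons] at hpw
    have he := hadj e List.mem_cons_self
    have hadj' : ∀ e' ∈ es, S.G.Adj e'.1 e'.2 := fun e' h => hadj e' (List.mem_cons_of_mem _ h)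
    have hs' := send_sane (η := η) hn hs he
    intro e' he'
    rw [sendAll_cons]
    rcases List.mem_cons.1 he' with rfl | he'
    · exact sendAll_valid_of_valid hn es hadj' hs' (send_valid_self hs he) hpw.1
    · exact ih hadj' hpw.2 hs' e' he'

/-- All messages directed towards `r` are valid. -/
def ValidToward (S : TreeMOT m n) (η : ℝ) (s : State m n) (r : Fin m) : Prop :=
  ∀ v p, TowardRoot S.G r v p → S.Valid η s v p

/-- Sending along a walk moves the vertex towards which all messages are valid. -/
theorem sendAll_walk (hn : 0 < n) {η : ℝ} {a b : Fin m} (w : S.G.Walk a b) {s : State m n}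
    (hs : S.Sane s) (hv : S.ValidToward η s a) :
    S.ValidToward η (S.sendAll η (w.darts.map fun d => (d.fst, d.snd)) s).val b := by
  induction w generalizing s with
  | nil => exact hv
  | cons h w ih =>
    rw [SimpleGraph.Walk.darts_cons, List.map_cons, sendAll_cons]
    refine ih (send_sane hn hs h) fun v p hvp => ?_
    rcases S.isTree.towardRoot_move h hvp with h' | ⟨rfl, rfl⟩
    · refine send_valid hs h (hv v p h') ?_
      rintro ⟨e, -⟩
      exact hvp.ne_root e.symm
    · exact send_valid_self hs h

theorem path_isPath (a b : Fin m) : (S.path a b).IsPath :=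
  (S.isTree.existsUnique_path a b).choose_spec.1

theorem path_length (a b : Fin m) : (S.path a b).length = S.G.dist a b := by
  obtain ⟨q, hq, hql⟩ := S.isTree.connected.exists_path_of_dist a b
  have := congrArg Subtype.val
    ((S.isTree.isAcyclic.subsingleton_path a b).elim ⟨_, path_isPath a b⟩ ⟨q, hq⟩)
  simp only at this
  rw [this, hql]

theorem towardRoot_path_snd {r v : Fin m} (hv : v ≠ r) :
    TowardRoot S.G r v (S.path v r).snd :=
  S.isTree.towardRoot_snd hv (path_isPath v r)

theorem mem_order {r v : Fin m} : v ∈ S.order r ↔ v ≠ r := by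
  simp only [order, List.mem_flatMap, List.mem_range, List.mem_filter, List.mem_finRange, true_and,
    decide_eq_true_eq]
  constructor
  · rintro ⟨i, -, h, -⟩
    exact h
  · intro h
    refine ⟨S.G.dist v r, ?_, h, rfl⟩
    rw [← path_length]
    simpa using (path_isPath (S := S) v r).length_lt

theorem order_pairwise (r : Fin m) :
    (S.order r).Pairwise fun v w => S.G.dist v r ≤ S.G.dist w r := by
  rw [order, List.pairwise_flatMap]
  constructor
  · intro i _
    refine List.Pairwise.imp_of_mem (R := fun _ _ => True) ?_ 
      (List.pairwise_of_forall fun _ _ => trivial)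
    intro v w hv hw _
    simp only [List.mem_filter, decide_eq_true_eq] at hv hw
    rw [hv.2.2, hw.2.2]
  · refine List.pairwise_lt_range.imp ?_
    intro i j hij v hv w hw
    simp only [List.mem_filter, decide_eq_true_eq] at hv hw
    rw [hv.2.2, hw.2.2]
    exact hij.le

theorem order_nodup (r : Fin m) : (S.order r).Nodup := by
  rw [order, List.nodup_flatMap]
  constructor
  · intro i _
    exact (List.nodup_finRange m).filter _
  · refine List.pairwise_lt_range.imp ?_
    intro i j hij v hv hw
    simp only [List.mem_filter, decide_eq_true_eq] at hv hw
    omega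

theorem order_length (r : Fin m) : (S.order r).length ≤ m := by
  simpa using (S.order_nodup r).length_le_card

theorem mem_inwardEdges {r : Fin m} {e : Fin m × Fin m} :
    e ∈ S.inwardEdges r ↔ TowardRoot S.G r e.1 e.2 := by
  simp only [inwardEdges, List.mem_map, List.mem_reverse, mem_order]
  constructor
  · rintro ⟨v, hv, rfl⟩
    exact towardRoot_path_snd hv
  · intro h
    exact ⟨e.1, h.ne_root, Prod.ext rfl
      (S.isTree.towardRoot_unique (towardRoot_path_snd h.ne_root) h)⟩

theorem mem_outwardEdges {r : Fin m} {e : Fin m × Fin m} :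
    e ∈ S.outwardEdges r ↔ TowardRoot S.G r e.2 e.1 := by
  simp only [outwardEdges, List.mem_map, mem_order]
  constructor
  · rintro ⟨v, hv, rfl⟩
    exact towardRoot_path_snd hv
  · intro h
    exact ⟨e.2, h.ne_root, Prod.ext
      (S.isTree.towardRoot_unique (towardRoot_path_snd h.ne_root) h) rfl⟩

theorem inwardEdges_pairwise (r : Fin m) :
    (S.inwardEdges r).Pairwise fun e e' => ¬(e'.2 = e.1 ∧ e'.1 ≠ e.2) := by
  rw [inwardEdges, List.pairwise_map, List.pairwise_reverse]
  refine List.Pairwise.imp_of_mem ?_ (S.order_pairwise r)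
  rintro v w hv - hvw ⟨e, -⟩
  have h := (towardRoot_path_snd (S := S) (mem_order.1 hv)).2
  simp only at e
  rw [e, SimpleGraph.dist_comm, SimpleGraph.dist_comm (u := r)] at h
  omega

theorem outwardEdges_pairwise (r : Fin m) :
    (S.outwardEdges r).Pairwise fun e e' => ¬(e'.2 = e.1 ∧ e'.1 ≠ e.2) := by
  rw [outwardEdges, List.pairwise_map]
  refine List.Pairwise.imp_of_mem ?_ (S.order_pairwise r)
  rintro v w hv - hvw ⟨e, -⟩
  have h := (towardRoot_path_snd (S := S) (mem_order.1 hv)).2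
  simp only at e
  rw [← e, SimpleGraph.dist_comm, SimpleGraph.dist_comm (u := r)] at h
  omega

theorem inward_sane (hn : 0 < n) (η : ℝ) (r : Fin m) {s : State m n} (hs : S.Sane s) :
    S.Sane (S.sendAll η (S.inwardEdges r) s).val :=
  sendAll_sane hn _ (fun _ he => (mem_inwardEdges.1 he).1) hs

theorem inward_validToward (hn : 0 < n) (η : ℝ) (r : Fin m) {s : State m n} (hs : S.Sane s) :
    S.ValidToward η (S.sendAll η (S.inwardEdges r) s).val r := fun v p h =>
  sendAll_valid hn _ (fun _ he => (mem_inwardEdges.1 he).1) (inwardEdges_pairwise r) hs (v, p)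
    (mem_inwardEdges.2 h)

theorem outward_sane (hn : 0 < n) (η : ℝ) (r : Fin m) {s : State m n} (hs : S.Sane s) :
    S.Sane (S.sendAll η (S.outwardEdges r) s).val :=
  sendAll_sane hn _ (fun _ he => (mem_outwardEdges.1 he).1.symm) hs

/-- A sweep away from `r`, with all messages towards `r` valid, makes all messages valid. -/
theorem outward_valid (hn : 0 < n) (η : ℝ) (r : Fin m) {s : State m n} (hs : S.Sane s)
    (hv : S.ValidToward η s r) {a b : Fin m} (hab : S.G.Adj a b) :
    S.Valid η (S.sendAll η (S.outwardEdges r) s).val a b := by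
  have hadj : ∀ e ∈ S.outwardEdges r, S.G.Adj e.1 e.2 :=
    fun _ he => (mem_outwardEdges.1 he).1.symm
  rcases S.isTree.towardRoot_or r hab with h | h
  · refine sendAll_valid_of_valid hn _ hadj hs (hv a b h) ?_
    rintro e he ⟨rfl, hne⟩
    exact hne (S.isTree.towardRoot_unique (mem_outwardEdges.1 he) h)
  · exact sendAll_valid hn _ hadj (outwardEdges_pairwise r) hs (a, b) (mem_outwardEdges.2 h)

/-! ### Marginals computed by belief propagation -/

theorem proj_eq_sum_proj₂ (B : (Fin m → Fin n) → ℝ) (k l : Fin m) (y : Fin n) :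
    proj B k y = ∑ z, proj₂ B k l y z := by
  simp only [proj, proj₂]
  rw [sum_comm]
  refine sum_congr rfl fun x _ => ?_
  by_cases h : x k = y <;> simp [h]

theorem proj₂_comm (B : (Fin m → Fin n) → ℝ) (k l : Fin m) (y z : Fin n) :
    proj₂ B k l y z = proj₂ B l k z y := by
  simp only [proj₂, and_comm]

theorem sum_proj (B : (Fin m → Fin n) → ℝ) (k : Fin m) :
    ∑ y, proj B k y = ∑ x, B x := by
  simp only [proj]
  rw [sum_comm]
  exact sum_congr rfl fun x _ => by simp

theorem sum_mul_proj (B : (Fin m → Fin n) → ℝ) (k : Fin m) (h : Fin n → ℝ) :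
    ∑ y, h y * proj B k y = ∑ x, h (x k) * B x := by
  simp only [proj, mul_sum]
  rw [sum_comm]
  exact sum_congr rfl fun x _ => by simp

/-- Messages valid towards one endpoint of an edge determine the marginal at this edge. -/
theorem proj₂_scaledTensor {η : ℝ} {s : State m n} {k r : Fin m} (hkr : S.G.Adj k r)
    (hv : S.ValidToward η s r) (a b : Fin n) :
    proj₂ (S.scaledTensor η s.scal) k r a b =
      messageFactor S.G (S.vertexFactor s.scal) s.msg k r a * S.gibbs η k r a b *
        messageFactor S.G (S.vertexFactor s.scal) s.msg r k b := by
  rw [← sum_graphProd_edge S.isTree hkr (S.gibbs_symm η) fun v p _ hvp y => hv v p hvp y]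
  simp only [proj₂, scaledTensor_eq_graphProd]

theorem proj_scaledTensor_leaf {η : ℝ} {s : State m n} {r : Fin m} (hr : r ∈ S.leaves)
    (hv : S.ValidToward η s r) (y : Fin n) :
    proj (S.scaledTensor η s.scal) r y =
      s.scal r y * S.μ r y * s.msg (S.nbr r) r y := by
  have hadj := S.adj_nbr_of_mem hr
  have htow : TowardRoot S.G r (S.nbr r) r :=
    ⟨hadj.symm, by simp [SimpleGraph.dist_eq_one_iff_adj.2 hadj]⟩
  rw [proj_eq_sum_proj₂ _ r (S.nbr r), hv _ _ htow y, mul_sum]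
  refine sum_congr rfl fun z _ => ?_
  rw [proj₂_comm, proj₂_scaledTensor hadj.symm hv, messageFactor_of_mem_leaves hr hadj,
    S.gibbs_symm η _ _ hadj.symm]
  ring

theorem cost_le_leafCost {k : Fin m} (hk : k ∈ S.leaves) (x y : Fin n) :
    S.cost k (S.nbr k) x y ≤ S.leafCost :=
  le_ciSup (f := fun p : S.leaves × Fin n × Fin n => S.cost p.1 (S.nbr p.1) p.2.1 p.2.2)
    (Set.finite_range _).bddAbove (⟨k, hk⟩, x, y)

theorem gibbs_le_one {η : ℝ} (hη : 0 < η) {k l : Fin m} (h : S.G.Adj k l) (x y : Fin n) :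
    S.gibbs η k l x y ≤ 1 := by
  rw [gibbs, Real.exp_le_one_iff]
  exact div_nonpos_of_nonpos_of_nonneg (neg_nonpos.2 (S.cost_nonneg k l h x y)) hη.le

theorem le_gibbs {η : ℝ} (hη : 0 < η) {k : Fin m} (hk : k ∈ S.leaves) (x y : Fin n) :
    Real.exp (-(S.leafCost / η)) ≤ S.gibbs η k (S.nbr k) x y := by
  rw [gibbs, Real.exp_le_exp, ← neg_div]
  exact div_le_div_of_nonneg_right (neg_le_neg (cost_le_leafCost hk x y)) hη.le

/-- `u'` arises from `u` by the Sinkhorn update at the leaf `k`. The vector `v` is the message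
into `k`; as an average of kernel values it has logarithmic oscillation at most `R_C^Γ / η`. -/
def IsSinkhornStep (S : TreeMOT m n) (η : ℝ) (k : Fin m) (u u' : Fin m → Fin n → ℝ) : Prop :=
  ∃ v : Fin n → ℝ, (∀ y, 0 < v y) ∧ (∀ y y', v y ≤ Real.exp (S.leafCost / η) * v y') ∧
    (∀ y, proj (S.scaledTensor η u) k y = u k y * S.μ k y * v y) ∧
    u' = Function.update u k fun y => 1 / v y

theorem updateScaling_isSinkhornStep {η : ℝ} (hη : 0 < η) {s : State m n}
    (hs : S.Sane s) {r : Fin m} (hr : r ∈ S.leaves) (hv : S.ValidToward η s r) :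
    S.IsSinkhornStep η r s.scal (updateScaling S r s).val.scal := by
  have hadj := S.adj_nbr_of_mem hr
  have htow : TowardRoot S.G r (S.nbr r) r :=
    ⟨hadj.symm, by simp [SimpleGraph.dist_eq_one_iff_adj.2 hadj]⟩
  refine ⟨s.msg (S.nbr r) r, hs.msg_pos _ _, fun y y' => ?_, proj_scaledTensor_leaf hr hv, rfl⟩
  rw [hv _ _ htow y, hv _ _ htow y', mul_sum]
  refine sum_le_sum fun z _ => ?_
  rw [← mul_assoc]
  refine mul_le_mul_of_nonneg_right ?_ (messageFactor_nonneg hs _ _ z)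
  calc S.gibbs η r (S.nbr r) y z ≤ 1 := gibbs_le_one hη hadj y z
    _ = Real.exp (S.leafCost / η) * Real.exp (-(S.leafCost / η)) := by
        rw [← Real.exp_add, add_neg_cancel, Real.exp_zero]
    _ ≤ _ := mul_le_mul_of_nonneg_left (le_gibbs hη hr y' z) (Real.exp_pos _).le

theorem updateScaling_sane {s : State m n} (hs : S.Sane s) (r : Fin m) :
    S.Sane (updateScaling S r s).val := by
  refine ⟨hs.msg_pos, fun k y => ?_, hs.bel_eq⟩
  change 0 < Function.update s.scal r (fun y => 1 / s.msg (S.nbr r) r y) k y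
  by_cases h : k = r
  · subst h
    rw [Function.update_self]
    exact one_div_pos.2 (hs.msg_pos _ _ _)
  · rw [Function.update_of_ne h]
    exact hs.scal_pos k y

/-- The messages towards `r` do not depend on the scaling vector at `r`. -/
theorem updateScaling_validToward {η : ℝ} {s : State m n} {r : Fin m}
    (hv : S.ValidToward η s r) : S.ValidToward η (updateScaling S r s).val r := by
  intro v p hvp y
  have h : ∀ z, S.vertexFactor (updateScaling S r s).val.scal v z = S.vertexFactor s.scal v z := by
    intro z
    change S.vertexFactor (Function.update s.scal r fun y => 1 / s.msg (S.nbr r) r y) v z = _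
    simp only [vertexFactor]
    rw [Function.update_of_ne hvp.ne_root]
  change s.msg v p y = _
  rw [hv v p hvp y]
  refine sum_congr rfl fun z _ => ?_
  simp only [messageFactor]
  rw [h]
  rfl

/-- After step `t` all messages towards the last updated leaf are valid. -/
theorem iterate_spec (hn : 0 < n) (η : ℝ) (κ : ℕ → Fin m) (t : ℕ) :
    S.Sane (S.iterate η κ t).val ∧ S.ValidToward η (S.iterate η κ t).val (κ t) := by
  induction t with
  | zero =>
    have h0 : S.Sane (freshState fun _ _ => 1) := S.sane_freshState fun _ _ => one_pos
    exact ⟨updateScaling_sane (inward_sane hn η _ h0) _,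
      updateScaling_validToward (inward_validToward hn η _ h0)⟩
  | succ t ih =>
    have hs := sendAll_sane hn (η := η) (S.pathEdges (κ t) (κ (t + 1)))
      (by
        intro e he
        obtain ⟨d, -, rfl⟩ := List.mem_map.1 he
        exact d.adj) ih.1
    exact ⟨updateScaling_sane hs _,
      updateScaling_validToward (sendAll_walk hn (S.path (κ t) (κ (t + 1))) ih.1 ih.2)⟩

theorem iterate_zero_isSinkhornStep (hn : 0 < n) {η : ℝ} (hη : 0 < η) (κ : ℕ → Fin m)
    (h : κ 0 ∈ S.leaves) :
    S.IsSinkhornStep η (κ 0) (fun _ _ => 1) (S.iterate η κ 0).val.scal := by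
  have h0 : S.Sane (freshState fun _ _ => 1) := S.sane_freshState fun _ _ => one_pos
  have key := updateScaling_isSinkhornStep hη (inward_sane hn η (κ 0) h0) h
    (inward_validToward hn η _ h0)
  rw [sendAll_scal] at key
  exact key

theorem iterate_succ_isSinkhornStep (hn : 0 < n) {η : ℝ} (hη : 0 < η) (κ : ℕ → Fin m) (t : ℕ)
    (h : κ (t + 1) ∈ S.leaves) :
    S.IsSinkhornStep η (κ (t + 1)) (S.iterate η κ t).val.scal
      (S.iterate η κ (t + 1)).val.scal := by
  obtain ⟨hs, hv⟩ := iterate_spec (S := S) hn η κ t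
  have hs' := sendAll_sane hn (η := η) (S.pathEdges (κ t) (κ (t + 1)))
    (by
      intro e he
      obtain ⟨d, -, rfl⟩ := List.mem_map.1 he
      exact d.adj) hs
  have key := updateScaling_isSinkhornStep hη hs' h
    (sendAll_walk hn (S.path (κ t) (κ (t + 1))) hs hv)
  change S.IsSinkhornStep η (κ (t + 1)) (S.sendAll η (S.pathEdges _ _) _).val.scal _ at key
  rw [sendAll_scal] at key
  exact key

theorem iterate_congr {η : ℝ} {κ κ' : ℕ → Fin m} {t : ℕ} (h : ∀ s ≤ t, κ s = κ' s) :
    S.iterate η κ t = S.iterate η κ' t := by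
  induction t with
  | zero => simp only [iterate, h 0 le_rfl]
  | succ t ih =>
    simp only [iterate, h (t + 1) le_rfl, h t (Nat.le_succ t),
      ih fun s hs => h s (hs.trans (Nat.le_succ t))]

theorem edgeProjections_val (hn : 0 < n) (η : ℝ) (r : Fin m) {u : Fin m → Fin n → ℝ}
    (hu : ∀ k y, 0 < u k y) (k l : Fin m) :
    (S.edgeProjections η r u).val k l =
      open Classical in if S.G.Adj k l then proj₂ (S.scaledTensor η u) k l else fun _ _ => 0 := by
  have h0 := S.sane_freshState hu
  have h1 := inward_sane hn η r h0
  have h2 := outward_sane hn η r h1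
  have hv := fun a b (hab : S.G.Adj a b) =>
    outward_valid hn η r h1 (inward_validToward hn η r h0) hab
  set s := (S.sendAll η (S.outwardEdges r) (S.sendAll η (S.inwardEdges r)
    (freshState u)).val).val with hs
  have hscal : s.scal = u := by
    rw [hs, sendAll_scal, sendAll_scal]
    rfl
  by_cases h : S.G.Adj k l
  · rw [if_pos h]
    funext x y
    have key : proj₂ (S.scaledTensor η u) k l x y =
        (S.outgoing s k l).val x * S.gibbs η k l x y * (S.outgoing s l k).val y := by
      rw [← hscal, proj₂_scaledTensor h fun v p hvp => hv v p hvp.1, ← outgoing_val h2 h,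
        ← outgoing_val h2 h.symm]
    rw [key]
    simp only [edgeProjections, Counted.val_bind, Counted.vec, if_pos h]
    rfl
  · rw [if_neg h]
    simp only [edgeProjections, Counted.val_bind, Counted.vec, if_neg h]
    rfl

end TreeMOT

/-! ### Entropy estimates for finite probability vectors -/

section Entropy

variable {ι : Type*} [Fintype ι]

/-- The `ℓ¹` distance of two probability vectors is at most twice their Hellinger distance. -/
theorem sq_sum_abs_sub_le {p q : ι → ℝ} (hp : ∀ i, 0 ≤ p i) (hq : ∀ i, 0 ≤ q i)
    (hp1 : ∑ i, p i = 1) (hq1 : ∑ i, q i = 1) :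
    (∑ i, |p i - q i|) ^ 2 ≤ 4 * ∑ i, (√(p i) - √(q i)) ^ 2 := by
  have h1 : ∀ i, |p i - q i| = |√(p i) - √(q i)| * (√(p i) + √(q i)) := by
    intro i
    have : p i - q i = (√(p i) - √(q i)) * (√(p i) + √(q i)) := by
      linear_combination -Real.sq_sqrt (hp i) + Real.sq_sqrt (hq i)
    rw [this, abs_mul, abs_of_nonneg (a := √(p i) + √(q i)) (by positivity)]
  have h2 : ∑ i, (√(p i) + √(q i)) ^ 2 ≤ 4 := by
    calc ∑ i, (√(p i) + √(q i)) ^ 2 ≤ ∑ i, (2 * p i + 2 * q i) := by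
          refine sum_le_sum fun i _ => ?_
          have e1 := Real.sq_sqrt (hp i)
          have e2 := Real.sq_sqrt (hq i)
          nlinarith [sq_nonneg (√(p i) - √(q i))]
      _ = 4 := by
          rw [sum_add_distrib, ← mul_sum, ← mul_sum, hp1, hq1]
          norm_num
  simp_rw [h1]
  calc (∑ i, |√(p i) - √(q i)| * (√(p i) + √(q i))) ^ 2
      ≤ (∑ i, |√(p i) - √(q i)| ^ 2) * ∑ i, (√(p i) + √(q i)) ^ 2 :=
        sum_mul_sq_le_sq_mul_sq _ _ _
    _ ≤ (∑ i, |√(p i) - √(q i)| ^ 2) * 4 :=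
        mul_le_mul_of_nonneg_left h2 (sum_nonneg fun i _ => sq_nonneg _)
    _ = _ := by simp_rw [sq_abs]; ring

/-- The pointwise form of the lower bound of the Kullback-Leibler divergence of `p` from `p t` by
the squared Hellinger distance. -/
theorem sq_sqrt_sub_sqrt_le {p t : ℝ} (hp : 0 ≤ p) (ht : 0 < t) :
    (√p - √(p * t)) ^ 2 ≤ -(p * Real.log t) - p + p * t := by
  have h1 : Real.log t = 2 * Real.log √t := by
    rw [Real.log_sqrt ht.le]
    ring
  have h2 := Real.log_le_sub_one_of_pos (Real.sqrt_pos.2 ht)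
  rw [Real.sqrt_mul hp]
  have e1 := Real.sq_sqrt hp
  have e2 := Real.sq_sqrt ht.le
  have e3 : (√p - √p * √t) ^ 2 = p - 2 * p * √t + p * t := by
    linear_combination (1 - 2 * √t + √t ^ 2) * e1 + p * e2
  rw [e3, h1]
  nlinarith

end Entropy

namespace TreeMOT

variable {m n : ℕ} {S : TreeMOT m n}

/-! ### The dual objective -/

theorem prod_leaves_pos {u : Fin m → Fin n → ℝ} (hu : ∀ k y, 0 < u k y) (x : Fin m → Fin n) :
    0 < ∏ k ∈ S.leaves, u k (x k) := prod_pos fun k _ => hu k (x k)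

theorem scaledTensor_eq (η : ℝ) (u : Fin m → Fin n → ℝ) (x : Fin m → Fin n) :
    S.scaledTensor η u x =
      (∏ k ∈ S.leaves, u k (x k)) *
        (Real.exp (-S.costTensor x / η) * ∏ k ∈ S.leaves, S.μ k (x k)) := by
  rw [scaledTensor, prod_mul_distrib]
  ring

theorem scaledTensor_nonneg (η : ℝ) {u : Fin m → Fin n → ℝ} (hu : ∀ k y, 0 < u k y)
    (x : Fin m → Fin n) : 0 ≤ S.scaledTensor η u x :=
  mul_nonneg (Real.exp_pos _).le (prod_nonneg fun k hk =>
    mul_nonneg (hu k _).le (S.μ_nonneg k ((S.mem_leaves).1 hk) _))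

/-- The objective of the dual of the entropically regularized problem (up to scaling and an
additive constant), as a function of the scaling vectors. -/
def dual (S : TreeMOT m n) (η : ℝ) (u : Fin m → Fin n → ℝ) : ℝ :=
  (∑ k ∈ S.leaves, ∑ y, S.μ k y * Real.log (u k y)) - ∑ x, S.scaledTensor η u x

/-- Positive scaling vectors whose logarithms oscillate by at most `R_C^Γ / η`. -/
structure Regular (S : TreeMOT m n) (η : ℝ) (u : Fin m → Fin n → ℝ) : Prop where
  pos : ∀ k y, 0 < u k y
  osc : ∀ k ∈ S.leaves, ∀ y y', u k y ≤ Real.exp (S.leafCost / η) * u k y'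

theorem Regular.abs_log_sub_le {η : ℝ} {u : Fin m → Fin n → ℝ} (hu : S.Regular η u) {k : Fin m}
    (hk : k ∈ S.leaves) (y y' : Fin n) :
    |Real.log (u k y) - Real.log (u k y')| ≤ S.leafCost / η := by
  have key : ∀ y y', Real.log (u k y) - Real.log (u k y') ≤ S.leafCost / η := by
    intro y y'
    have h := Real.log_le_log (hu.pos k y) (hu.osc k hk y y')
    rw [Real.log_mul (Real.exp_pos _).ne' (hu.pos k y').ne', Real.log_exp] at h
    linarith
  exact abs_le.2 ⟨by linarith [key y' y], key y y'⟩

theorem one_le_exp_leafCost_div {η : ℝ} (hη : 0 < η) (hR : 0 ≤ S.leafCost) :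
    1 ≤ Real.exp (S.leafCost / η) := Real.one_le_exp (div_nonneg hR hη.le)

theorem regular_one {η : ℝ} (hη : 0 < η) (hR : 0 ≤ S.leafCost) :
    S.Regular η fun _ _ => 1 :=
  ⟨fun _ _ => one_pos, fun _ _ _ _ => by simpa using one_le_exp_leafCost_div hη hR⟩

theorem IsSinkhornStep.regular {η : ℝ} {k : Fin m} {u u' : Fin m → Fin n → ℝ}
    (h : S.IsSinkhornStep η k u u') (hu : S.Regular η u) : S.Regular η u' := by
  obtain ⟨v, hv, hosc, -, rfl⟩ := h
  refine ⟨fun l y => ?_, fun l hl y y' => ?_⟩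
  · by_cases h : l = k
    · subst h
      rw [Function.update_self]
      exact one_div_pos.2 (hv y)
    · rw [Function.update_of_ne h]
      exact hu.pos l y
  · by_cases h : l = k
    · subst h
      rw [Function.update_self, mul_one_div, div_le_div_iff₀ (hv y) (hv y'), one_mul]
      exact hosc y' y
    · rw [Function.update_of_ne h]
      exact hu.osc l hl y y'

/-- A Sinkhorn step enforces the prescribed marginal at `k`. -/
theorem IsSinkhornStep.proj_eq {η : ℝ} {k : Fin m} (hk : k ∈ S.leaves)
    {u u' : Fin m → Fin n → ℝ} (h : S.IsSinkhornStep η k u u') (hu : ∀ k y, 0 < u k y) :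
    proj (S.scaledTensor η u') k = S.μ k := by
  obtain ⟨v, hv, -, hproj, rfl⟩ := h
  funext y
  have hB : ∀ x, S.scaledTensor η (Function.update u k fun y => 1 / v y) x =
      S.scaledTensor η u x * (1 / (u k (x k) * v (x k))) := by
    intro x
    have hu0 := (hu k (x k)).ne'
    have hv0 := (hv (x k)).ne'
    rw [scaledTensor, scaledTensor, ← mul_prod_erase _ _ hk, ← mul_prod_erase S.leaves _ hk,
      Function.update_self]
    have : ∏ l ∈ S.leaves.erase k,
        ((Function.update u k fun y => 1 / v y) l (x l) * S.μ l (x l)) =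
        ∏ l ∈ S.leaves.erase k, (u l (x l) * S.μ l (x l)) :=
      prod_congr rfl fun l hl => by rw [Function.update_of_ne (mem_erase.1 hl).1]
    rw [this]
    field_simp
  have hu0 := (hu k y).ne'
  have hv0 := (hv y).ne'
  have hy : proj (S.scaledTensor η (Function.update u k fun y => 1 / v y)) k y =
      proj (S.scaledTensor η u) k y * (1 / (u k y * v y)) := by
    simp only [proj, sum_mul]
    refine sum_congr rfl fun x _ => ?_
    split_ifs with hx
    · rw [hB, hx]
    · simp
  rw [hy, hproj]
  field_simp

theorem IsSinkhornStep.sum_eq_one {η : ℝ} {k : Fin m} (hk : k ∈ S.leaves)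
    {u u' : Fin m → Fin n → ℝ} (h : S.IsSinkhornStep η k u u') (hu : ∀ k y, 0 < u k y) :
    ∑ x, S.scaledTensor η u' x = 1 := by
  rw [← sum_proj _ k, h.proj_eq hk hu, S.μ_sum k ((S.mem_leaves).1 hk)]

/-- A Sinkhorn step at `k` increases the dual objective by the Kullback-Leibler divergence of `μ_k`
from `P_k(B_u)`, hence at least by a quarter of the squared `ℓ¹` distance. -/
theorem IsSinkhornStep.dual_le {η : ℝ} {k : Fin m} (hk : k ∈ S.leaves)
    {u u' : Fin m → Fin n → ℝ} (h : S.IsSinkhornStep η k u u') (hu : ∀ k y, 0 < u k y)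
    (hmass : ∑ x, S.scaledTensor η u x = 1) :
    S.dual η u + 1 / 4 * (∑ y, |proj (S.scaledTensor η u) k y - S.μ k y|) ^ 2 ≤
      S.dual η u' := by
  have hsum := h.sum_eq_one hk hu
  obtain ⟨v, hv, -, hproj, rfl⟩ := h
  have hμ := S.μ_nonneg k ((S.mem_leaves).1 hk)
  have hμ1 := S.μ_sum k ((S.mem_leaves).1 hk)
  have hq : ∀ y, proj (S.scaledTensor η u) k y = S.μ k y * (u k y * v y) := fun y => by
    rw [hproj]
    ring
  have hq1 : ∑ y, S.μ k y * (u k y * v y) = 1 := by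
    simp_rw [← hq]
    rw [sum_proj, hmass]
  have hH := sq_sum_abs_sub_le hμ
    (fun y => mul_nonneg (hμ y) (mul_pos (hu k y) (hv y)).le) hμ1 hq1
  have hK : ∑ y, (√(S.μ k y) - √(S.μ k y * (u k y * v y))) ^ 2 ≤
      ∑ y, -(S.μ k y * Real.log (u k y * v y)) := by
    calc _ ≤ ∑ y, (-(S.μ k y * Real.log (u k y * v y)) - S.μ k y + S.μ k y * (u k y * v y)) :=
          sum_le_sum fun y _ => sq_sqrt_sub_sqrt_le (hμ y) (mul_pos (hu k y) (hv y))
      _ = _ := by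
          rw [sum_add_distrib, sum_sub_distrib, hμ1, hq1]
          ring
  rw [dual, dual, hsum, hmass, ← add_sum_erase _ _ hk, ← add_sum_erase S.leaves _ hk,
    Function.update_self]
  have herase : ∑ l ∈ S.leaves.erase k, ∑ y, S.μ l y *
        Real.log ((Function.update u k fun y => 1 / v y) l y) =
      ∑ l ∈ S.leaves.erase k, ∑ y, S.μ l y * Real.log (u l y) :=
    sum_congr rfl fun l hl => by rw [Function.update_of_ne (mem_erase.1 hl).1]
  have hlog : ∑ y, S.μ k y * Real.log (1 / v y) =
      (∑ y, S.μ k y * Real.log (u k y)) + ∑ y, -(S.μ k y * Real.log (u k y * v y)) := by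
    rw [← sum_add_distrib]
    refine sum_congr rfl fun y _ => ?_
    rw [Real.log_mul (hu k y).ne' (hv y).ne', one_div, Real.log_inv]
    ring
  rw [herase, hlog]
  simp_rw [hq, abs_sub_comm _ (S.μ k _)]
  linarith

/-- Concavity of the dual objective. -/
theorem dual_sub_le {η : ℝ} {u v : Fin m → Fin n → ℝ} (hu : ∀ k y, 0 < u k y)
    (hv : ∀ k y, 0 < v k y) :
    S.dual η v - S.dual η u ≤ ∑ k ∈ S.leaves, ∑ y,
      (S.μ k y - proj (S.scaledTensor η u) k y) * (Real.log (v k y) - Real.log (u k y)) := by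
  have hB : ∀ x, S.scaledTensor η u x +
      ∑ k ∈ S.leaves, (Real.log (v k (x k)) - Real.log (u k (x k))) * S.scaledTensor η u x ≤
        S.scaledTensor η v x := by
    intro x
    have hpos := prod_leaves_pos (S := S) hu x
    have hvx : S.scaledTensor η v x = S.scaledTensor η u x *
        Real.exp (∑ k ∈ S.leaves, (Real.log (v k (x k)) - Real.log (u k (x k)))) := by
      have : ∏ k ∈ S.leaves, v k (x k) = (∏ k ∈ S.leaves, u k (x k)) *
          Real.exp (∑ k ∈ S.leaves, (Real.log (v k (x k)) - Real.log (u k (x k)))) := by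
        rw [Real.exp_sum, ← prod_mul_distrib]
        refine prod_congr rfl fun k _ => ?_
        rw [Real.exp_sub, Real.exp_log (hv k _), Real.exp_log (hu k _),
          mul_div_cancel₀ _ (hu k _).ne']
      rw [scaledTensor_eq, scaledTensor_eq, this]
      ring
    rw [hvx, ← sum_mul]
    have := Real.add_one_le_exp (∑ k ∈ S.leaves, (Real.log (v k (x k)) - Real.log (u k (x k))))
    nlinarith [S.scaledTensor_nonneg η hu x]
  have hsum := sum_le_sum fun x (_ : x ∈ univ) => hB x
  rw [sum_add_distrib, sum_comm] at hsum
  rw [sum_congr rfl fun k _ => (sum_mul_proj (S.scaledTensor η u) k fun y =>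
    Real.log (v k y) - Real.log (u k y)).symm] at hsum
  have : ∑ k ∈ S.leaves, ∑ y,
      (S.μ k y - proj (S.scaledTensor η u) k y) * (Real.log (v k y) - Real.log (u k y)) =
      (∑ k ∈ S.leaves, ∑ y, S.μ k y * Real.log (v k y)) -
      (∑ k ∈ S.leaves, ∑ y, S.μ k y * Real.log (u k y)) -
      ∑ k ∈ S.leaves, ∑ y, (Real.log (v k y) - Real.log (u k y)) *
        proj (S.scaledTensor η u) k y := by
    rw [← sum_sub_distrib, ← sum_sub_distrib]
    refine sum_congr rfl fun k _ => ?_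
    rw [← sum_sub_distrib, ← sum_sub_distrib]
    exact sum_congr rfl fun y _ => by ring
  rw [this, dual, dual]
  linarith

/-- A bounded function pairs with a difference of vectors of equal mass through its
oscillation. -/
theorem sum_mul_le_osc {ι : Type*} [Fintype ι] {p h : ι → ℝ} {C : ℝ} (hp : ∑ i, p i = 0)
    (hh : ∀ i j, |h i - h j| ≤ C) : ∑ i, p i * h i ≤ C * ∑ i, |p i| := by
  rcases isEmpty_or_nonempty ι with hι | ⟨⟨j⟩⟩
  · simp
  have : ∑ i, p i * h i = ∑ i, p i * (h i - h j) := by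
    simp_rw [mul_sub]
    rw [sum_sub_distrib, ← sum_mul, hp]
    ring
  rw [this, mul_sum]
  refine sum_le_sum fun i _ => ?_
  calc p i * (h i - h j) ≤ |p i * (h i - h j)| := le_abs_self _
    _ = |h i - h j| * |p i| := by rw [abs_mul, mul_comm]
    _ ≤ C * |p i| := mul_le_mul_of_nonneg_right (hh i j) (abs_nonneg _)

/-- The distance to every regular dual point is controlled by the residual. -/
theorem dual_sub_le_residual {η : ℝ} {u v : Fin m → Fin n → ℝ} (hu : S.Regular η u)
    (hv : S.Regular η v) (hmass : ∑ x, S.scaledTensor η u x = 1) :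
    S.dual η v - S.dual η u ≤ 2 * (S.leafCost / η) * S.residual η u := by
  refine (dual_sub_le hu.pos hv.pos).trans ?_
  rw [residual, mul_sum]
  refine sum_le_sum fun k hk => ?_
  have h := sum_mul_le_osc (p := fun y => S.μ k y - proj (S.scaledTensor η u) k y)
    (h := fun y => Real.log (v k y) - Real.log (u k y)) (C := 2 * (S.leafCost / η))
    (by rw [sum_sub_distrib, sum_proj, hmass, S.μ_sum k ((S.mem_leaves).1 hk), sub_self])
    (by
      intro y y'
      have h1 := abs_le.1 (hu.abs_log_sub_le hk y y')
      have h2 := abs_le.1 (hv.abs_log_sub_le hk y y')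
      exact abs_le.2 ⟨by linarith, by linarith⟩)
  simpa only [abs_sub_comm (S.μ k _)] using h

/-- How far the dual objective at `u` is below its supremum over all regular scaling vectors. -/
def dualGap (S : TreeMOT m n) (η : ℝ) (u : Fin m → Fin n → ℝ) : ℝ :=
  (⨆ v : {v : Fin m → Fin n → ℝ // S.Regular η v}, S.dual η v) - S.dual η u

theorem dualGap_nonneg {η : ℝ} {u : Fin m → Fin n → ℝ} (hu : S.Regular η u)
    (hmass : ∑ x, S.scaledTensor η u x = 1) : 0 ≤ S.dualGap η u := by
  refine sub_nonneg.2 (le_ciSup (f := fun v : {v // S.Regular η v} => S.dual η v) ?_ ⟨u, hu⟩)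
  refine ⟨S.dual η u + 2 * (S.leafCost / η) * S.residual η u, ?_⟩
  rintro _ ⟨v, rfl⟩
  linarith [dual_sub_le_residual hu v.2 hmass]

theorem dualGap_le {η : ℝ} {u : Fin m → Fin n → ℝ} (hu : S.Regular η u)
    (hmass : ∑ x, S.scaledTensor η u x = 1) :
    S.dualGap η u ≤ 2 * (S.leafCost / η) * S.residual η u := by
  have : Nonempty {v : Fin m → Fin n → ℝ // S.Regular η v} := ⟨⟨u, hu⟩⟩
  rw [dualGap, sub_le_iff_le_add]
  refine ciSup_le fun v => ?_
  linarith [dual_sub_le_residual hu v.2 hmass]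

theorem IsSinkhornStep.dualGap_le {η : ℝ} {k : Fin m} (hk : k ∈ S.leaves)
    {u u' : Fin m → Fin n → ℝ} (h : S.IsSinkhornStep η k u u') (hu : ∀ k y, 0 < u k y)
    (hmass : ∑ x, S.scaledTensor η u x = 1) :
    S.dualGap η u' ≤ S.dualGap η u -
      1 / 4 * (∑ y, |proj (S.scaledTensor η u) k y - S.μ k y|) ^ 2 := by
  have := h.dual_le hk hu hmass
  rw [dualGap, dualGap]
  linarith

end TreeMOT

/-! ### The rounding procedure -/

section RoundMatrix

variable {n : ℕ}

/-- The scaling factor of the columns in the rounding procedure turns the column sum `s` into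
`min c s`. -/
theorem mul_min_div_one {c s : ℝ} (hc : 0 ≤ c) (hs : 0 ≤ s) : s * min (c / s) 1 = min c s := by
  rcases hs.eq_or_lt with rfl | hs
  · simp [hc]
  · rw [mul_min_of_nonneg _ _ hs.le, mul_one, mul_div_cancel₀ _ hs.ne']

/-- If the prescribed row sums are those of `F`, the rounding procedure only rescales the columns
and adds a rank-one matrix. -/
theorem roundMatrix_val (F : Fin n → Fin n → ℝ) (c : Fin n → ℝ) (hF : ∀ i j, 0 ≤ F i j)
    (i j : Fin n) :
    (roundMatrix F (fun i => ∑ j, F i j) c).val i j =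
      F i j * min (c j / ∑ i, F i j) 1 +
        (∑ l, F i l - ∑ l, F i l * min (c l / ∑ i, F i l) 1) *
          (c j - ∑ k, F k j * min (c j / ∑ i, F i j) 1) /
          ∑ k, |∑ l, F k l - ∑ l, F k l * min (c l / ∑ i, F i l) 1| := by
  -- the row scaling is trivial: a row either has factor `1` or is zero
  have h1 : ∀ i j, min ((∑ j, F i j) / ∑ j, F i j) 1 * F i j = F i j := by
    intro i j
    by_cases h : ∑ j, F i j = 0
    · rw [(sum_eq_zero_iff_of_nonneg fun j _ => hF i j).1 h j (mem_univ j), mul_zero]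
    · rw [div_self h, min_self, one_mul]
  have h2 : (roundMatrix F (fun i => ∑ j, F i j) c).val i j =
      (fun F₁ : Fin n → Fin n → ℝ => F₁ i j * min (c j / ∑ i, F₁ i j) 1 +
        (∑ l, F i l - ∑ l, F₁ i l * min (c l / ∑ i, F₁ i l) 1) *
          (c j - ∑ k, F₁ k j * min (c j / ∑ i, F₁ i j) 1) /
          ∑ k, |∑ l, F k l - ∑ l, F₁ k l * min (c l / ∑ i, F₁ i l) 1|)
      (fun i j => min ((∑ j, F i j) / ∑ j, F i j) 1 * F i j) := rfl
  rw [h2]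
  have h3 : (fun i j => min ((∑ j, F i j) / ∑ j, F i j) 1 * F i j) = F :=
    funext fun i => funext fun j => h1 i j
  rw [h3]

/-- The rounding of a probability matrix `F` whose row sums are kept: the result has row sums
those of `F` and column sums `c`, and moves at most the mass `∑ |c_j(F) - c_j|`. -/
theorem roundMatrix_spec {F : Fin n → Fin n → ℝ} {c : Fin n → ℝ} (hF : ∀ i j, 0 ≤ F i j)
    (hF1 : ∑ i, ∑ j, F i j = 1) (hc : ∀ j, 0 ≤ c j) (hc1 : ∑ j, c j = 1)
    {O : Fin n → Fin n → ℝ} (hO : O = (roundMatrix F (fun i => ∑ j, F i j) c).val) :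
    (∀ i j, 0 ≤ O i j) ∧ (∀ i, ∑ j, O i j = ∑ j, F i j) ∧ (∀ j, ∑ i, O i j = c j) ∧
      ∀ (C : Fin n → Fin n → ℝ) (R : ℝ), (∀ i j, 0 ≤ C i j) → (∀ i j, C i j ≤ R) → 0 ≤ R →
        ∑ i, ∑ j, C i j * O i j ≤ ∑ i, ∑ j, C i j * F i j + R * ∑ j, |∑ i, F i j - c j| := by
  set y : Fin n → ℝ := fun j => min (c j / ∑ i, F i j) 1 with hy
  have hs0 : ∀ j, 0 ≤ ∑ i, F i j := fun j => sum_nonneg fun i _ => hF i j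
  have hy0 : ∀ j, 0 ≤ y j := fun j => le_min (div_nonneg (hc j) (hs0 j)) zero_le_one
  have hy1 : ∀ j, y j ≤ 1 := fun j => min_le_right _ _
  have hcol : ∀ j, ∑ i, F i j * y j = min (c j) (∑ i, F i j) := by
    intro j
    rw [← sum_mul, hy, mul_min_div_one (hc j) (hs0 j)]
  set a : Fin n → ℝ := fun i => ∑ l, F i l - ∑ l, F i l * y l with ha
  set b : Fin n → ℝ := fun j => c j - ∑ k, F k j * y j with hb
  have ha0 : ∀ i, 0 ≤ a i := by
    intro i
    rw [ha]
    simp only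
    rw [← sum_sub_distrib]
    exact sum_nonneg fun l _ => sub_nonneg.2 (mul_le_of_le_one_right (hF i l) (hy1 l))
  have hb0 : ∀ j, 0 ≤ b j := fun j => by
    rw [hb]
    simp only
    rw [hcol]
    exact sub_nonneg.2 (min_le_left _ _)
  have hab : ∑ i, a i = ∑ j, b j := by
    rw [ha, hb]
    simp only
    rw [sum_sub_distrib, sum_sub_distrib, hF1, hc1, sum_comm]
  have hOe : ∀ i j, O i j = F i j * y j + a i * b j / ∑ k, a k := by
    intro i j
    rw [hO, roundMatrix_val F c hF]
    have : ∑ k, |∑ l, F k l - ∑ l, F k l * min (c l / ∑ i, F i l) 1| = ∑ k, a k :=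
      sum_congr rfl fun k _ => abs_of_nonneg (ha0 k)
    rw [this]
  have htot : 0 ≤ ∑ k, a k := sum_nonneg fun k _ => ha0 k
  -- the row defects `a` and the column defects `b` have the same total mass
  have hrow : ∀ i, ∑ j, a i * b j / ∑ k, a k = a i := by
    intro i
    rw [← sum_div, ← mul_sum, ← hab]
    by_cases h : ∑ k, a k = 0
    · rw [(sum_eq_zero_iff_of_nonneg fun k _ => ha0 k).1 h i (mem_univ i)]
      simp
    · rw [mul_div_assoc, div_self h, mul_one]
  have hcol' : ∀ j, ∑ i, a i * b j / ∑ k, a k = b j := by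
    intro j
    rw [← sum_div, ← sum_mul]
    by_cases h : ∑ k, a k = 0
    · have h' := hab ▸ h
      rw [(sum_eq_zero_iff_of_nonneg fun k _ => hb0 k).1 h' j (mem_univ j)]
      simp
    · rw [mul_div_assoc, mul_div_cancel₀ _ h]
  have hq0 : ∀ i j, 0 ≤ a i * b j / ∑ k, a k :=
    fun i j => div_nonneg (mul_nonneg (ha0 i) (hb0 j)) htot
  refine ⟨fun i j => ?_, fun i => ?_, fun j => ?_, fun C R hC hCR hR => ?_⟩
  · rw [hOe]
    exact add_nonneg (mul_nonneg (hF i j) (hy0 j)) (hq0 i j)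
  · simp_rw [hOe]
    rw [sum_add_distrib, hrow, ha]
    ring
  · simp_rw [hOe]
    rw [sum_add_distrib, hcol', hb]
    ring
  · calc ∑ i, ∑ j, C i j * O i j
        ≤ ∑ i, ∑ j, (C i j * F i j + R * (a i * b j / ∑ k, a k)) := by
          refine sum_le_sum fun i _ => sum_le_sum fun j _ => ?_
          rw [hOe, mul_add]
          exact add_le_add
            (mul_le_mul_of_nonneg_left (mul_le_of_le_one_right (hF i j) (hy1 j)) (hC i j))
            (mul_le_mul_of_nonneg_right (hCR i j) (hq0 i j))
      _ = ∑ i, ∑ j, C i j * F i j + R * ∑ j, b j := by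
          simp_rw [sum_add_distrib, ← mul_sum]
          rw [sum_congr rfl fun i _ => hrow i, hab]
      _ ≤ _ := by
          refine add_le_add le_rfl (mul_le_mul_of_nonneg_left (sum_le_sum fun j _ => ?_) hR)
          rw [hb]
          simp only
          rw [hcol]
          rcases min_cases (c j) (∑ i, F i j) with ⟨h, -⟩ | ⟨h, -⟩ <;> rw [h]
          · simp
          · rw [abs_sub_comm]
            exact le_abs_self _

end RoundMatrix

namespace TreeMOT

variable {m n : ℕ} {S : TreeMOT m n}

/-! ### Tensors that decouple according to the tree -/

theorem adj_nbr (hm : 3 ≤ m) (k : Fin m) : S.G.Adj k (S.nbr k) := by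
  have : Nontrivial (Fin m) := Fin.nontrivial_iff_two_le.2 (by omega)
  obtain ⟨l, hl⟩ := exists_ne k
  obtain ⟨p, hp⟩ := S.isTree.exists_towardRoot hl.symm
  have h : ∃ l, S.G.Adj k l := ⟨p, hp.1⟩
  rw [nbr, dif_pos h]
  exact h.choose_spec

/-- A tree with at least three vertices has no two adjacent leaves. -/
theorem not_mem_leaves_of_adj (hm : 3 ≤ m) {k l : Fin m} (hk : k ∈ S.leaves) (h : S.G.Adj k l) :
    l ∉ S.leaves := by
  intro hl
  have key : ∀ d v, S.G.dist k v = d → v = k ∨ v = l := by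
    intro d
    induction d with
    | zero => exact fun v hv => Or.inl (S.isTree.connected.dist_eq_zero_iff.1 hv).symm
    | succ d ih =>
      intro v hv
      have hvk : v ≠ k := by
        rintro rfl
        simp at hv
      obtain ⟨p, hp⟩ := S.isTree.exists_towardRoot hvk
      have hpd : S.G.dist k p = d := by
        have := hp.2
        omega
      rcases ih p hpd with rfl | rfl
      · exact Or.inr ((S.eq_nbr_of_adj hk hp.1.symm).trans (S.eq_nbr_of_adj hk h).symm)
      · exact Or.inl ((S.eq_nbr_of_adj hl hp.1.symm).trans (S.eq_nbr_of_adj hl h.symm).symm)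
  have hcard : (univ : Finset (Fin m)) ⊆ {k, l} := by
    intro v _
    rcases key _ v rfl with rfl | rfl <;> simp
  have h1 := card_le_card hcard
  have h2 := card_le_two (a := k) (b := l)
  rw [card_univ, Fintype.card_fin] at h1
  omega

/-- A family of non-negative matrices on the directed edges which is compatible with transposition
and whose row sums `b k` depend only on the first vertex. -/
structure Consistent (S : TreeMOT m n) (E : Fin m → Fin m → Fin n → Fin n → ℝ)
    (b : Fin m → Fin n → ℝ) : Prop where
  nonneg : ∀ k l, S.G.Adj k l → ∀ x y, 0 ≤ E k l x y
  symm : ∀ k l, S.G.Adj k l → ∀ x y, E k l x y = E l k y x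
  row : ∀ k l, S.G.Adj k l → ∀ x, ∑ y, E k l x y = b k x

theorem Consistent.b_nonneg (hm : 3 ≤ m) {E : Fin m → Fin m → Fin n → Fin n → ℝ}
    {b : Fin m → Fin n → ℝ} (h : S.Consistent E b) (k : Fin m) (x : Fin n) : 0 ≤ b k x := by
  rw [← h.row k _ (adj_nbr hm k)]
  exact sum_nonneg fun y _ => h.nonneg _ _ (adj_nbr hm k) _ _

theorem Consistent.treeTensor_nonneg (hm : 3 ≤ m) {E : Fin m → Fin m → Fin n → Fin n → ℝ}
    {b : Fin m → Fin n → ℝ} (h : S.Consistent E b) (x : Fin m → Fin n) :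
    0 ≤ S.treeTensor E x := by
  classical
  refine div_nonneg (prod_nonneg fun k _ => prod_nonneg fun l _ => ?_)
    (prod_nonneg fun k _ => pow_nonneg ?_ _)
  · split_ifs with hkl
    · exact h.nonneg _ _ hkl.1 _ _
    · exact zero_le_one
  · rw [h.row k _ (adj_nbr hm k)]
    exact h.b_nonneg hm k _

/-- The tensor built from a consistent family has this family as its edge marginals: the vertex
marginals themselves serve as messages. -/
theorem Consistent.proj₂_treeTensor (hm : 3 ≤ m) {E : Fin m → Fin m → Fin n → Fin n → ℝ}
    {b : Fin m → Fin n → ℝ} (h : S.Consistent E b) {k l : Fin m} (hkl : S.G.Adj k l) :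
    proj₂ (S.treeTensor E) k l = E k l := by
  classical
  set f : Fin m → Fin n → ℝ := fun v x => (b v x ^ (S.G.degree v - 1))⁻¹ with hf
  have hT : ∀ x, S.treeTensor E x = graphProd S.G f E univ x := by
    intro x
    rw [treeTensor, graphProd, div_eq_mul_inv, mul_comm, hf, ← prod_inv_distrib]
    congr 1
    · refine prod_congr rfl fun v _ => ?_
      rw [h.row v _ (adj_nbr hm v)]
  -- the `deg v - 1` incoming messages cancel the vertex factor
  have hmf : ∀ v p z, S.G.Adj v p → b v z ≠ 0 →
      messageFactor S.G f (fun _ k => b k) v p z = 1 := by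
    intro v p z hvp hb
    have hcard : #(univ.filter fun j => S.G.Adj j v ∧ j ≠ p) = S.G.degree v - 1 := by
      rw [← SimpleGraph.card_neighborFinset_eq_degree,
        ← card_erase_of_mem ((S.G.mem_neighborFinset v p).2 hvp)]
      congr 1
      ext j
      simp [SimpleGraph.adj_comm, and_comm]
    rw [messageFactor, prod_const, hcard, hf]
    exact inv_mul_cancel₀ (pow_ne_zero _ hb)
  -- where the vertex marginal vanishes, so does the edge matrix
  have hE : ∀ v p, S.G.Adj v p → ∀ z y,
      messageFactor S.G f (fun _ k => b k) v p z * E v p z y = E v p z y := by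
    intro v p hvp z y
    by_cases hb : b v z = 0
    · rw [← h.row v p hvp, sum_eq_zero_iff_of_nonneg fun y _ => h.nonneg v p hvp z y] at hb
      rw [hb y (mem_univ y), mul_zero]
    · rw [hmf v p z hvp hb, one_mul]
  funext x y
  have key := sum_graphProd_edge (f := f) (M := fun _ k => b k) S.isTree hkl h.symm
    (fun v p _ hvp y => by
      rw [← h.row p v hvp.1.symm]
      refine sum_congr rfl fun z _ => ?_
      rw [h.symm p v hvp.1.symm, mul_comm, hE v p hvp.1]) x y
  simp only [proj₂, hT]
  rw [key, hE k l hkl, h.symm k l hkl, mul_comm, hE l k hkl.symm]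

/-! ### Costs -/

open Classical in
theorem totalCost_eq_sum_proj₂ (B : (Fin m → Fin n) → ℝ) :
    S.totalCost B = ∑ k, ∑ l, if S.G.Adj k l ∧ k < l then
      ∑ y, ∑ z, S.cost k l y z * proj₂ B k l y z else 0 := by
  simp only [totalCost, costTensor, sum_mul]
  rw [sum_comm]
  refine sum_congr rfl fun k _ => ?_
  rw [sum_comm]
  refine sum_congr rfl fun l _ => ?_
  by_cases h : S.G.Adj k l ∧ k < l
  · simp only [if_pos h, proj₂, mul_sum]
    rw [sum_congr rfl fun y _ => sum_comm, sum_comm]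
    refine sum_congr rfl fun x _ => ?_
    rw [sum_eq_single (x k), sum_eq_single (x l)]
    · simp
    · intro z _ hz
      simp [hz.symm]
    · simp
    · intro y _ hy
      exact sum_eq_zero fun z _ => by simp [hy.symm]
    · simp
  · simp [if_neg h]

open Classical in
/-- Summing vertex weights over both endpoints of every edge counts a vertex once per
neighbour. -/
theorem sum_edges_add_eq (w : Fin m → ℝ) :
    (∑ k, ∑ l, if S.G.Adj k l ∧ k < l then w k + w l else 0) =
      ∑ k, ∑ l, if S.G.Adj k l then w k else 0 := by
  have h1 : (∑ k, ∑ l, if S.G.Adj k l ∧ k < l then w k + w l else 0) =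
      (∑ k, ∑ l, if S.G.Adj k l ∧ k < l then w k else 0) +
        ∑ k, ∑ l, if S.G.Adj k l ∧ k < l then w l else 0 := by
    rw [← sum_add_distrib]
    refine sum_congr rfl fun k _ => ?_
    rw [← sum_add_distrib]
    exact sum_congr rfl fun l _ => by split_ifs <;> simp
  rw [h1, sum_comm (f := fun k l => if S.G.Adj k l ∧ k < l then w l else 0), ← sum_add_distrib]
  refine sum_congr rfl fun k _ => ?_
  rw [← sum_add_distrib]
  refine sum_congr rfl fun l _ => ?_
  by_cases h : S.G.Adj k l
  · rcases lt_or_gt_of_ne h.ne with h' | h'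
    · simp [h, h', not_lt.2 h'.le]
    · simp [h, h', h.symm, not_lt.2 h'.le]
  · have h' : ¬ S.G.Adj l k := fun e => h e.symm
    simp [h, h']

/-! ### Approximate optimality of the scaled tensor -/

/-- The pointwise Gibbs inequality `b log (a / b) ≤ a - b`. -/
theorem mul_log_sub_log_le {a b : ℝ} (ha : 0 < a) (hb : 0 < b) :
    b * (Real.log a - Real.log b) ≤ a - b := by
  have h := Real.log_le_sub_one_of_pos (div_pos ha hb)
  rw [Real.log_div ha.ne' hb.ne'] at h
  calc b * (Real.log a - Real.log b) ≤ b * (a / b - 1) := mul_le_mul_of_nonneg_left h hb.le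
    _ = a - b := by field_simp

theorem entropy_le_log {μ : Fin n → ℝ} (h0 : ∀ y, 0 ≤ μ y) (h1 : ∑ y, μ y = 1) :
    ∑ y, -(μ y * Real.log (μ y)) ≤ Real.log n := by
  have hn : (0 : ℝ) < n := by
    rcases Nat.eq_zero_or_pos n with rfl | hn
    · simp at h1
    · exact_mod_cast hn
  have key : ∀ y, -(μ y * Real.log (μ y)) ≤ μ y * Real.log n + ((n : ℝ)⁻¹ - μ y) := by
    intro y
    rcases (h0 y).eq_or_lt with h | h
    · rw [← h]
      simp
    · have := mul_log_sub_log_le (inv_pos.2 hn) h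
      rw [Real.log_inv] at this
      linarith
  calc _ ≤ ∑ y, (μ y * Real.log n + ((n : ℝ)⁻¹ - μ y)) := sum_le_sum fun y _ => key y
    _ = Real.log n := by
        rw [sum_add_distrib, sum_sub_distrib, ← sum_mul, h1]
        simp [hn.ne']

/-- The product of the leaf marginals has mass `n^(m - |Γ|)`: the coordinates of the other
vertices are free. -/
theorem sum_prod_leaves :
    ∑ x : Fin m → Fin n, ∏ k ∈ S.leaves, S.μ k (x k) = (n : ℝ) ^ (m - #S.leaves) := by
  classical
  have h1 : ∀ x : Fin m → Fin n, ∏ k ∈ S.leaves, S.μ k (x k) =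
      ∏ k, if k ∈ S.leaves then S.μ k (x k) else 1 := by
    intro x
    rw [prod_ite_mem, univ_inter]
  simp_rw [h1]
  rw [← Fintype.prod_sum fun k y => if k ∈ S.leaves then S.μ k y else 1]
  have h2 : ∀ k, (∑ y : Fin n, if k ∈ S.leaves then S.μ k y else 1) =
      if k ∈ S.leavesᶜ then (n : ℝ) else 1 := by
    intro k
    by_cases hk : k ∈ S.leaves
    · simp [hk, S.μ_sum k ((S.mem_leaves).1 hk)]
    · simp [hk]
  simp_rw [h2]
  rw [prod_ite_mem, univ_inter, prod_const, card_compl, Fintype.card_fin]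

theorem log_scaledTensor {η : ℝ} {u : Fin m → Fin n → ℝ} (hu : ∀ k y, 0 < u k y)
    {x : Fin m → Fin n} (hx : ∀ k ∈ S.leaves, 0 < S.μ k (x k)) :
    Real.log (S.scaledTensor η u x) = (∑ k ∈ S.leaves, Real.log (u k (x k))) -
      S.costTensor x / η + ∑ k ∈ S.leaves, Real.log (S.μ k (x k)) := by
  rw [scaledTensor_eq, Real.log_mul (prod_pos fun k _ => hu k _).ne'
    (mul_pos (Real.exp_pos _) (prod_pos hx)).ne',
    Real.log_mul (Real.exp_pos _).ne' (prod_pos hx).ne', Real.log_exp,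
    Real.log_prod fun k _ => (hu k _).ne', Real.log_prod fun k hk => (hx k hk).ne']
  ring

/-- The value of a plan `B` for the cost `C / η - ∑ log u_k`. -/
def reducedCost (S : TreeMOT m n) (η : ℝ) (u : Fin m → Fin n → ℝ) (B : (Fin m → Fin n) → ℝ) : ℝ :=
  ∑ x, (S.costTensor x / η - ∑ k ∈ S.leaves, Real.log (u k (x k))) * B x

theorem reducedCost_eq (η : ℝ) (u : Fin m → Fin n → ℝ) (B : (Fin m → Fin n) → ℝ) :
    S.reducedCost η u B = S.totalCost B / η -
      ∑ k ∈ S.leaves, ∑ y, Real.log (u k y) * proj B k y := by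
  simp_rw [reducedCost, sub_mul, sum_sub_distrib, totalCost, sum_div, sum_mul_proj, sum_mul]
  rw [sum_comm (s := univ)]
  congr 1
  exact sum_congr rfl fun x _ => by ring

theorem le_proj {B : (Fin m → Fin n) → ℝ} (hB : ∀ x, 0 ≤ B x) (k : Fin m) (x : Fin m → Fin n) :
    B x ≤ proj B k (x k) := by
  have := single_le_sum (f := fun z : Fin m → Fin n => if z k = x k then B z else 0)
    (fun z _ => by split_ifs <;> simp [hB z]) (mem_univ x)
  simpa [proj] using this

/-- Every plan has relative entropy at least `0` with respect to the scaled tensor, and entropy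
at least `0`; the leaf marginals contribute at most `|Γ| log n`. -/
theorem neg_reducedCost_le {η : ℝ} {u : Fin m → Fin n → ℝ} (hu : ∀ k y, 0 < u k y)
    (hmass : ∑ x, S.scaledTensor η u x = 1) {B : (Fin m → Fin n) → ℝ} (hB : B ∈ S.feasible)
    (hB1 : ∑ x, B x = 1) : -S.reducedCost η u B ≤ #S.leaves * Real.log n := by
  have hle : ∀ x, B x ≤ 1 := fun x => by
    rw [← hB1]
    exact single_le_sum (fun z _ => hB.1 z) (mem_univ x)
  have key : ∀ x, -((S.costTensor x / η - ∑ k ∈ S.leaves, Real.log (u k (x k))) * B x) ≤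
      S.scaledTensor η u x - B x + ∑ k ∈ S.leaves, -(Real.log (S.μ k (x k)) * B x) := by
    intro x
    rcases (hB.1 x).eq_or_lt with h | h
    · rw [← h]
      simp [S.scaledTensor_nonneg η hu x]
    · have hx : ∀ k ∈ S.leaves, 0 < S.μ k (x k) := fun k hk => by
        rw [← hB.2 k hk]
        exact h.trans_le (le_proj hB.1 k x)
      have hpos : 0 < S.scaledTensor η u x := by
        rw [scaledTensor]
        exact mul_pos (Real.exp_pos _) (prod_pos fun k hk => mul_pos (hu k _) (hx k hk))
      have h1 := mul_log_sub_log_le hpos h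
      have h2 : B x * Real.log (B x) ≤ 0 :=
        mul_nonpos_of_nonneg_of_nonpos h.le (Real.log_nonpos h.le (hle x))
      rw [log_scaledTensor hu hx] at h1
      rw [sum_neg_distrib, ← sum_mul]
      linarith
  have hsum := sum_le_sum fun x (_ : x ∈ univ) => key x
  rw [sum_neg_distrib, sum_add_distrib, sum_sub_distrib, hmass, hB1, sum_comm] at hsum
  have hent : ∀ k ∈ S.leaves, ∑ x, -(Real.log (S.μ k (x k)) * B x) ≤ Real.log n := by
    intro k hk
    have hk' := (S.mem_leaves).1 hk
    have := entropy_le_log (S.μ_nonneg k hk') (S.μ_sum k hk')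
    rw [sum_neg_distrib, ← sum_mul_proj B k fun y => Real.log (S.μ k y), hB.2 k hk,
      ← sum_neg_distrib]
    simpa only [mul_comm] using this
  have h3 := sum_le_sum hent
  rw [sum_const, nsmul_eq_mul] at h3
  change -S.reducedCost η u B ≤ _ at hsum
  linarith

/-- The scaled tensor has entropy at most `(m - |Γ|) log n` relative to the product of the leaf
marginals. -/
theorem reducedCost_scaledTensor_le (hn : 0 < n) {η : ℝ} {u : Fin m → Fin n → ℝ}
    (hu : ∀ k y, 0 < u k y) (hmass : ∑ x, S.scaledTensor η u x = 1) :
    S.reducedCost η u (S.scaledTensor η u) ≤ (m - #S.leaves) * Real.log n := by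
  set N : ℕ := m - #S.leaves with hN
  have hcard : #S.leaves ≤ m := by simpa using card_le_univ S.leaves
  have hNr : (N : ℝ) = m - #S.leaves := by rw [hN, Nat.cast_sub hcard]
  have hn' : (0 : ℝ) < (n : ℝ) ^ N := pow_pos (by exact_mod_cast hn) _
  have hν0 : ∀ x : Fin m → Fin n, 0 ≤ ∏ k ∈ S.leaves, S.μ k (x k) := fun x =>
    prod_nonneg fun k hk => S.μ_nonneg k ((S.mem_leaves).1 hk) _
  have key : ∀ x, (S.costTensor x / η - ∑ k ∈ S.leaves, Real.log (u k (x k))) *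
        S.scaledTensor η u x ≤
      (∏ k ∈ S.leaves, S.μ k (x k)) / (n : ℝ) ^ N - S.scaledTensor η u x +
        N * Real.log n * S.scaledTensor η u x := by
    intro x
    rcases (S.scaledTensor_nonneg η hu x).eq_or_lt with h | h
    · rw [← h]
      simpa using div_nonneg (hν0 x) hn'.le
    · have hx : ∀ k ∈ S.leaves, 0 < S.μ k (x k) := by
        intro k hk
        refine lt_of_le_of_ne (S.μ_nonneg k ((S.mem_leaves).1 hk) _) fun e => h.ne' ?_
        rw [scaledTensor, prod_eq_zero hk (by rw [← e, mul_zero]), mul_zero]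
      have hν := prod_pos hx
      have h1 := mul_log_sub_log_le (div_pos hν hn') h
      rw [log_scaledTensor hu hx, Real.log_div hν.ne' hn'.ne',
        Real.log_prod fun k hk => (hx k hk).ne', Real.log_pow] at h1
      linarith
  have hsum := sum_le_sum fun x (_ : x ∈ univ) => key x
  rw [sum_add_distrib, sum_sub_distrib, hmass, ← sum_div, sum_prod_leaves, div_self hn'.ne',
    ← mul_sum, hmass, hNr] at hsum
  change S.reducedCost η u _ ≤ _ at hsum
  linarith

/-- The scaled tensor, although it only nearly has the prescribed marginals, is nearly as cheap
as every feasible plan. -/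
theorem totalCost_scaledTensor_le (hn : 0 < n) {η : ℝ} (hη : 0 < η) {u : Fin m → Fin n → ℝ}
    (hu : S.Regular η u) (hmass : ∑ x, S.scaledTensor η u x = 1)
    {B : (Fin m → Fin n) → ℝ} (hB : B ∈ S.feasible) (hB1 : ∑ x, B x = 1) :
    S.totalCost (S.scaledTensor η u) ≤
      S.totalCost B + S.leafCost * S.residual η u + η * (m * Real.log n) := by
  have h1 := neg_reducedCost_le hu.pos hmass hB hB1
  have h2 := reducedCost_scaledTensor_le hn hu.pos hmass
  rw [reducedCost_eq] at h1 h2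
  have h3 : (∑ k ∈ S.leaves, ∑ y, Real.log (u k y) * proj (S.scaledTensor η u) k y) -
      ∑ k ∈ S.leaves, ∑ y, Real.log (u k y) * proj B k y ≤
        S.leafCost / η * S.residual η u := by
    rw [← sum_sub_distrib, residual, mul_sum]
    refine sum_le_sum fun k hk => ?_
    rw [← sum_sub_distrib, hB.2 k hk]
    have h := sum_mul_le_osc (p := fun y => proj (S.scaledTensor η u) k y - S.μ k y)
      (h := fun y => Real.log (u k y)) (C := S.leafCost / η)
      (by rw [sum_sub_distrib, sum_proj, hmass, S.μ_sum k ((S.mem_leaves).1 hk), sub_self])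
      (hu.abs_log_sub_le hk)
    refine le_trans (le_of_eq (sum_congr rfl fun y _ => ?_)) h
    ring
  have h4 : S.totalCost (S.scaledTensor η u) / η ≤
      S.totalCost B / η + S.leafCost / η * S.residual η u + m * Real.log n := by linarith
  have h5 := mul_le_mul_of_nonneg_left h4 hη.le
  calc S.totalCost (S.scaledTensor η u) = η * (S.totalCost (S.scaledTensor η u) / η) := by
        field_simp
    _ ≤ _ := h5
    _ = _ := by field_simp

/-! ### The rounded family -/

theorem rowSums_val (F : Fin n → Fin n → ℝ) : (rowSums F).val = fun i => ∑ j, F i j := rfl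

open Classical in
theorem round_val (E : Fin m → Fin m → Fin n → Fin n → ℝ) (k l : Fin m) :
    (S.round E).val k l = if S.G.Adj k l then
      if k ∈ S.leaves then fun x y => (roundMatrix (E l k) (rowSums (E l k)).val (S.μ k)).val y x
      else if l ∈ S.leaves then (roundMatrix (E k l) (rowSums (E k l)).val (S.μ l)).val
      else E k l
    else fun _ _ => 0 := by
  simp only [TreeMOT.round, Counted.vec]
  split_ifs <;> rfl

theorem proj₂_nonneg {B : (Fin m → Fin n) → ℝ} (hB : ∀ x, 0 ≤ B x) (k l : Fin m) (y z : Fin n) :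
    0 ≤ proj₂ B k l y z :=
  sum_nonneg fun x _ => by split_ifs <;> simp [hB x]

theorem sum_proj₂ (B : (Fin m → Fin n) → ℝ) (k l : Fin m) :
    ∑ y, ∑ z, proj₂ B k l y z = ∑ x, B x := by
  simp_rw [← proj_eq_sum_proj₂, sum_proj]

open Classical in
/-- Rounding the edge marginals of a probability tensor gives a consistent family with the
prescribed leaf marginals, and increases the cost by at most `R_C^Γ` times the residual. -/
theorem round_spec (hm : 3 ≤ m) (hR : 0 ≤ S.leafCost) {B : (Fin m → Fin n) → ℝ}
    (hB : ∀ x, 0 ≤ B x) (hB1 : ∑ x, B x = 1) {E Q : Fin m → Fin m → Fin n → Fin n → ℝ}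
    (hE : ∀ k l, S.G.Adj k l → E k l = proj₂ B k l) (hQ : Q = (S.round E).val) :
    S.Consistent Q (fun k => if k ∈ S.leaves then S.μ k else proj B k) ∧
      (∑ k, ∑ l, if S.G.Adj k l ∧ k < l then ∑ y, ∑ z, S.cost k l y z * Q k l y z else 0) ≤
        S.totalCost B + S.leafCost * ∑ k ∈ S.leaves, ∑ y, |proj B k y - S.μ k y| := by
  have hin : ∀ k l, S.G.Adj k l → k ∉ S.leaves → l ∉ S.leaves → Q k l = proj₂ B k l := by
    intro k l h hk hl
    rw [hQ, round_val, if_pos h, if_neg hk, if_neg hl, hE k l h]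
  -- the neighbour of a leaf is not a leaf, so every matrix is rounded for at most one endpoint
  have hleaf : ∀ k l, S.G.Adj k l → l ∈ S.leaves →
      (∀ y z, Q l k z y = Q k l y z) ∧ (∀ y z, 0 ≤ Q k l y z) ∧
      (∀ y, ∑ z, Q k l y z = proj B k y) ∧ (∀ z, ∑ y, Q k l y z = S.μ l z) ∧
      ∑ y, ∑ z, S.cost k l y z * Q k l y z ≤
        ∑ y, ∑ z, S.cost k l y z * proj₂ B k l y z +
          S.leafCost * ∑ z, |proj B l z - S.μ l z| := by
    intro k l h hl
    have hk : k ∉ S.leaves := not_mem_leaves_of_adj hm hl h.symm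
    have hl' := (S.mem_leaves).1 hl
    have hq : Q k l =
        (roundMatrix (proj₂ B k l) (fun i => ∑ j, proj₂ B k l i j) (S.μ l)).val := by
      rw [hQ, round_val, if_pos h, if_neg hk, if_pos hl, rowSums_val, hE k l h]
    have hq' : Q l k = fun x y => Q k l y x := by
      rw [hq, hQ, round_val, if_pos h.symm, if_pos hl, rowSums_val, hE k l h]
    obtain ⟨h1, h2, h3, h4⟩ := roundMatrix_spec (proj₂_nonneg hB k l)
      (by rw [sum_proj₂, hB1]) (S.μ_nonneg l hl') (S.μ_sum l hl') hq
    refine ⟨fun y z => by rw [hq'], h1, fun y => ?_, h3, ?_⟩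
    · rw [h2, ← proj_eq_sum_proj₂]
    · have h5 := h4 (S.cost k l) S.leafCost (S.cost_nonneg k l h) (fun x y => by
        obtain rfl := S.eq_nbr_of_adj hl h.symm
        rw [S.cost_symm _ _ h]
        exact cost_le_leafCost hl y x) hR
      have h6 : ∀ z, ∑ y, proj₂ B k l y z = proj B l z := by
        intro z
        rw [proj_eq_sum_proj₂ B l k]
        exact sum_congr rfl fun y _ => proj₂_comm B k l y z
      simpa only [h6] using h5
  refine ⟨⟨fun k l h x y => ?_, fun k l h x y => ?_, fun k l h x => ?_⟩, ?_⟩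
  · by_cases hk : k ∈ S.leaves
    · rw [(hleaf l k h.symm hk).1]
      exact (hleaf l k h.symm hk).2.1 _ _
    · by_cases hl : l ∈ S.leaves
      · exact (hleaf k l h hl).2.1 _ _
      · rw [hin k l h hk hl]
        exact proj₂_nonneg hB k l x y
  · by_cases hk : k ∈ S.leaves
    · exact (hleaf l k h.symm hk).1 y x
    · by_cases hl : l ∈ S.leaves
      · exact ((hleaf k l h hl).1 x y).symm
      · rw [hin k l h hk hl, hin l k h.symm hl hk, proj₂_comm]
  · by_cases hk : k ∈ S.leaves
    · rw [if_pos hk, ← (hleaf l k h.symm hk).2.2.2.1 x]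
      exact sum_congr rfl fun y _ => (hleaf l k h.symm hk).1 y x
    · rw [if_neg hk]
      by_cases hl : l ∈ S.leaves
      · exact (hleaf k l h hl).2.2.1 x
      · rw [hin k l h hk hl, ← proj_eq_sum_proj₂]
  -- `w k` bounds the cost of rounding for the leaf `k`
  · set w : Fin m → ℝ := fun k =>
      if k ∈ S.leaves then S.leafCost * ∑ z, |proj B k z - S.μ k z| else 0 with hw
    have hw0 : ∀ k, 0 ≤ w k := fun k => by
      rw [hw]
      simp only
      split_ifs
      · exact mul_nonneg hR (sum_nonneg fun z _ => abs_nonneg _)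
      · exact le_rfl
    have hedge : ∀ k l, S.G.Adj k l → ∑ y, ∑ z, S.cost k l y z * Q k l y z ≤
        ∑ y, ∑ z, S.cost k l y z * proj₂ B k l y z + (w k + w l) := by
      intro k l h
      by_cases hk : k ∈ S.leaves
      · have h1 := (hleaf l k h.symm hk).2.2.2.2
        have h2 : ∀ F : Fin m → Fin m → Fin n → Fin n → ℝ, (∀ y z, F l k z y = F k l y z) →
            ∑ y, ∑ z, S.cost l k y z * F l k y z = ∑ y, ∑ z, S.cost k l y z * F k l y z := by
          intro F hF
          rw [sum_comm]
          exact sum_congr rfl fun y _ => sum_congr rfl fun z _ => by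
            rw [hF, S.cost_symm k l h]
        rw [h2 Q fun y z => ((hleaf l k h.symm hk).1 z y).symm,
          h2 (proj₂ B) fun y z => proj₂_comm B l k z y] at h1
        have h3 : w k = S.leafCost * ∑ z, |proj B k z - S.μ k z| := if_pos hk
        linarith [hw0 l]
      · by_cases hl : l ∈ S.leaves
        · have h1 := (hleaf k l h hl).2.2.2.2
          have h3 : w l = S.leafCost * ∑ z, |proj B l z - S.μ l z| := if_pos hl
          linarith [hw0 k]
        · rw [hin k l h hk hl]
          linarith [hw0 k, hw0 l]
    calc (∑ k, ∑ l, if S.G.Adj k l ∧ k < l then ∑ y, ∑ z, S.cost k l y z * Q k l y z else 0)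
        ≤ ∑ k, ∑ l, ((if S.G.Adj k l ∧ k < l then
            ∑ y, ∑ z, S.cost k l y z * proj₂ B k l y z else 0) +
            if S.G.Adj k l ∧ k < l then w k + w l else 0) := by
          refine sum_le_sum fun k _ => sum_le_sum fun l _ => ?_
          split_ifs with h
          · exact hedge k l h.1
          · simp
      _ = S.totalCost B + ∑ k, ∑ l, if S.G.Adj k l then w k else 0 := by
          rw [totalCost_eq_sum_proj₂, ← sum_edges_add_eq w, ← sum_add_distrib]
          exact sum_congr rfl fun k _ => sum_add_distrib
      _ = S.totalCost B + S.leafCost * ∑ k ∈ S.leaves, ∑ y, |proj B k y - S.μ k y| := by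
          congr 1
          rw [mul_sum, ← univ_inter S.leaves, ← sum_ite_mem]
          refine sum_congr rfl fun k _ => ?_
          by_cases hk : k ∈ S.leaves
          · rw [sum_eq_single (S.nbr k), if_pos (S.adj_nbr_of_mem hk)]
            · intro l _ hl
              exact if_neg fun h => hl (S.eq_nbr_of_adj hk h)
            · simp
          · simp [hw, hk]

theorem exists_leaf (hm : 3 ≤ m) : S.leaves.Nonempty := by
  classical
  have : Nontrivial (Fin m) := Fin.nontrivial_iff_two_le.2 (by omega)
  obtain ⟨v, hv⟩ := S.isTree.exists_vert_degree_one_of_nontrivial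
  exact ⟨v, (S.mem_leaves).2 ((S.G.degree_eq_one_iff_existsUnique_adj).1 hv)⟩

/-- The output of construction and rounding, started from regular scaling vectors with small
residual, represents an approximate solution. -/
theorem output_spec (hm : 3 ≤ m) (hn : 2 ≤ n) (hR : 0 < S.leafCost) {ε η : ℝ} (hε : 0 < ε)
    (hη : η = ε / (2 * m * Real.log n)) {u : Fin m → Fin n → ℝ} (hu : S.Regular η u)
    (hmass : ∑ x, S.scaledTensor η u x = 1)
    (hres : S.residual η u < ε / (8 * S.leafCost)) (r : Fin m)
    {Q : Fin m → Fin m → Fin n → Fin n → ℝ}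
    (hQ : Q = (S.round (S.edgeProjections η r u).val).val) :
    (∀ k l, S.G.Adj k l → proj₂ (S.treeTensor Q) k l = Q k l) ∧
      S.IsApproxSolution ε (S.treeTensor Q) := by
  classical
  have hn0 : 0 < n := by omega
  have hlog : 0 < Real.log n := Real.log_pos (by exact_mod_cast hn)
  have hm0 : (0 : ℝ) < m := by exact_mod_cast (by omega : 0 < m)
  have hη0 : 0 < η := by rw [hη]; positivity
  have hB := S.scaledTensor_nonneg η hu.pos
  obtain ⟨hcons, hcost⟩ := round_spec hm hR.le hB hmass
    (fun k l h => by rw [edgeProjections_val hn0 η r hu.pos, if_pos h]) hQ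
  have hproj := fun k l (h : S.G.Adj k l) => hcons.proj₂_treeTensor hm h
  refine ⟨hproj, ⟨hcons.treeTensor_nonneg hm, fun k hk => ?_⟩, fun B' hB' => ?_⟩
  · funext y
    rw [proj_eq_sum_proj₂ _ k (S.nbr k), hproj _ _ (S.adj_nbr_of_mem hk),
      hcons.row _ _ (S.adj_nbr_of_mem hk), if_pos hk]
  · obtain ⟨k, hk⟩ := exists_leaf (S := S) hm
    have hB'1 : ∑ x, B' x = 1 := by
      rw [← sum_proj _ k, hB'.2 k hk, S.μ_sum k ((S.mem_leaves).1 hk)]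
    have h1 := totalCost_scaledTensor_le hn0 hη0 hu hmass hB' hB'1
    have h2 : S.totalCost (S.treeTensor Q) =
        ∑ k, ∑ l, if S.G.Adj k l ∧ k < l then ∑ y, ∑ z, S.cost k l y z * Q k l y z else 0 := by
      rw [totalCost_eq_sum_proj₂]
      refine sum_congr rfl fun k _ => sum_congr rfl fun l _ => ?_
      split_ifs with h
      · rw [hproj k l h.1]
      · rfl
    have h3 : η * (m * Real.log n) = ε / 2 := by
      rw [hη]
      field_simp
    have h4 : S.leafCost * S.residual η u ≤ ε / 8 := by
      have := mul_le_mul_of_nonneg_left hres.le hR.le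
      calc _ ≤ _ := this
        _ = ε / 8 := by field_simp
    rw [h2]
    change _ ≤ _ + S.leafCost * S.residual η u at hcost
    linarith

end TreeMOT

/-! ### Operation counts -/

namespace Counted

@[simp] theorem ops_vec {ι α : Type} [Fintype ι] (f : ι → Counted α) :
    (vec f).ops = ∑ i, (f i).ops := rfl

@[simp] theorem ops_sum {ι : Type} [Fintype ι] (f : ι → Counted ℝ) :
    (sum f).ops = ∑ i, ((f i).ops + 1) := rfl

@[simp] theorem ops_add (a b : ℝ) : (Counted.add a b).ops = 1 := rfl
@[simp] theorem ops_sub (a b : ℝ) : (Counted.sub a b).ops = 1 := rfl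
@[simp] theorem ops_mul (a b : ℝ) : (Counted.mul a b).ops = 1 := rfl
@[simp] theorem ops_div (a b : ℝ) : (Counted.div a b).ops = 1 := rfl
@[simp] theorem ops_log (a : ℝ) : (Counted.log a).ops = 1 := rfl
@[simp] theorem ops_min (a b : ℝ) : (Counted.min a b).ops = 1 := rfl
@[simp] theorem ops_abs (a : ℝ) : (Counted.abs a).ops = 1 := rfl
@[simp] theorem ops_max {ι : Type} [Fintype ι] (f : ι → ℝ) :
    (Counted.max f).ops = Fintype.card ι := rfl

end Counted

theorem rowSums_ops {n : ℕ} (F : Fin n → Fin n → ℝ) : (rowSums F).ops = n * n := by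
  simp [rowSums]

theorem colSums_ops {n : ℕ} (F : Fin n → Fin n → ℝ) : (colSums F).ops = n * n := by
  simp [colSums]

theorem roundMatrix_ops {n : ℕ} (F : Fin n → Fin n → ℝ) (r c : Fin n → ℝ) :
    (roundMatrix F r c).ops = 9 * (n * n) + 8 * n := by
  simp only [roundMatrix, Counted.ops_bind, rowSums_ops, colSums_ops, Counted.ops_vec,
    Counted.ops_div, Counted.ops_min, Counted.ops_mul, Counted.ops_sub, Counted.ops_sum,
    Counted.ops_abs, Counted.ops_add, sum_const, card_univ, Fintype.card_fin, smul_eq_mul]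
  ring

namespace TreeMOT

variable {m n : ℕ} {S : TreeMOT m n}

theorem outgoing_ops (s : State m n) (l k : Fin m) : (S.outgoing s l k).ops = n := by
  rw [outgoing]
  split_ifs <;> simp

theorem kernel_ops (η : ℝ) (k l : Fin m) (x y : Fin n) : (S.kernel η k l x y).ops = 3 := rfl

theorem send_ops (η : ℝ) (s : State m n) (e : Fin m × Fin m) :
    (S.send η s e).ops = 5 * (n * n) + 3 * n := by
  simp only [send, Counted.ops_bind, outgoing_ops, Counted.ops_vec, Counted.ops_sum, kernel_ops,
    Counted.ops_mul, Counted.ops_div, Counted.ops_pure, sum_const, card_univ, Fintype.card_fin,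
    smul_eq_mul]
  ring

theorem sendAll_ops (η : ℝ) (es : List (Fin m × Fin m)) (s : State m n) :
    (S.sendAll η es s).ops = es.length * (5 * (n * n) + 3 * n) := by
  induction es generalizing s with
  | nil => simp [sendAll]
  | cons e es ih =>
    have h : (S.sendAll η (e :: es) s).ops =
        (S.send η s e).ops + (S.sendAll η es (S.send η s e).val).ops := rfl
    rw [h, ih, send_ops, List.length_cons]
    ring

theorem updateScaling_ops (k : Fin m) (s : State m n) : (updateScaling S k s).ops = n := by
  simp [updateScaling]

theorem pathEdges_length_le (a b : Fin m) : (S.pathEdges a b).length ≤ S.G.diam := by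
  have : Nonempty (Fin m) := ⟨a⟩
  rw [pathEdges, List.length_map, SimpleGraph.Walk.length_darts, path_length]
  exact SimpleGraph.dist_le_diam (SimpleGraph.connected_iff_ediam_ne_top.1 S.isTree.connected)

theorem inwardEdges_length_le (r : Fin m) : (S.inwardEdges r).length ≤ m := by
  rw [inwardEdges, List.length_map, List.length_reverse]
  exact order_length r

theorem outwardEdges_length_le (r : Fin m) : (S.outwardEdges r).length ≤ m := by
  rw [outwardEdges, List.length_map]
  exact order_length r

theorem diam_pos (hm : 3 ≤ m) : 1 ≤ S.G.diam := by
  have : Nontrivial (Fin m) := Fin.nontrivial_iff_two_le.2 (by omega)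
  exact Nat.one_le_iff_ne_zero.2 (SimpleGraph.connected_iff_diam_ne_zero.1 S.isTree.connected)

theorem iterate_ops_le (hm : 3 ≤ m) (η : ℝ) (κ : ℕ → Fin m) (t : ℕ) :
    (S.iterate η κ t).ops ≤ 9 * (m * (n * n)) + t * (9 * (S.G.diam * (n * n))) := by
  have hd := diam_pos (S := S) hm
  have hnn : n ≤ n * n := Nat.le_mul_self n
  induction t with
  | zero =>
    have h : (S.iterate η κ 0).ops =
        (S.sendAll η (S.inwardEdges (κ 0)) (freshState fun _ _ => 1)).ops +
          (updateScaling S (κ 0) _).ops := rfl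
    rw [h, sendAll_ops, updateScaling_ops]
    have h1 := Nat.mul_le_mul (inwardEdges_length_le (S := S) (κ 0))
      (show 5 * (n * n) + 3 * n ≤ 8 * (n * n) by omega)
    have h2 : n * n ≤ m * (n * n) := Nat.le_mul_of_pos_left _ (by omega)
    have h3 : m * (8 * (n * n)) = 8 * (m * (n * n)) := by ring
    omega
  | succ t ih =>
    have h : (S.iterate η κ (t + 1)).ops = (S.iterate η κ t).ops +
        ((S.sendAll η (S.pathEdges (κ t) (κ (t + 1))) (S.iterate η κ t).val).ops +
          (updateScaling S (κ (t + 1)) _).ops) := rfl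
    rw [h, sendAll_ops, updateScaling_ops]
    have h1 := Nat.mul_le_mul (pathEdges_length_le (S := S) (κ t) (κ (t + 1)))
      (show 5 * (n * n) + 3 * n ≤ 8 * (n * n) by omega)
    have h2 : n * n ≤ S.G.diam * (n * n) := Nat.le_mul_of_pos_left _ hd
    have h3 : S.G.diam * (8 * (n * n)) = 8 * (S.G.diam * (n * n)) := by ring
    rw [add_mul]
    omega

open Classical in
theorem sum_adj_le (c : ℕ) :
    (∑ k : Fin m, ∑ l, if S.G.Adj k l then c else 0) ≤ 2 * m * c := by
  have h1 : ∀ k : Fin m, (∑ l, if S.G.Adj k l then c else 0) = S.G.degree k * c := by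
    intro k
    rw [← sum_filter, sum_const, smul_eq_mul, ← SimpleGraph.card_neighborFinset_eq_degree]
    congr 2
    ext l
    simp
  simp_rw [h1]
  rw [← sum_mul, S.G.sum_degrees_eq_twice_card_edges]
  have := S.isTree.card_edgeFinset
  rw [Fintype.card_fin] at this
  exact Nat.mul_le_mul_right _ (by omega)

theorem edgeProjections_ops_le (η : ℝ) (r : Fin m) (u : Fin m → Fin n → ℝ) :
    (S.edgeProjections η r u).ops ≤ 30 * (m * (n * n)) := by
  classical
  have hnn : n ≤ n * n := Nat.le_mul_self n
  have h : (S.edgeProjections η r u).ops ≤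
      (S.inwardEdges r).length * (5 * (n * n) + 3 * n) +
        ((S.outwardEdges r).length * (5 * (n * n) + 3 * n) +
          ∑ k : Fin m, ∑ l, if S.G.Adj k l then 7 * (n * n) else 0) := by
    simp only [edgeProjections, Counted.ops_bind, sendAll_ops, Counted.ops_vec]
    refine Nat.add_le_add_left (Nat.add_le_add_left
      (sum_le_sum fun k _ => sum_le_sum fun l _ => ?_) _) _
    split_ifs with hkl
    · simp only [Counted.ops_bind, outgoing_ops, Counted.ops_vec, kernel_ops, Counted.ops_mul,
        sum_const, card_univ, Fintype.card_fin, smul_eq_mul]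
      have : n * (n * (3 + (1 + 1))) = 5 * (n * n) := by ring
      omega
    · simp
  have h1 := Nat.mul_le_mul (inwardEdges_length_le (S := S) r)
    (show 5 * (n * n) + 3 * n ≤ 8 * (n * n) by omega)
  have h2 := Nat.mul_le_mul (outwardEdges_length_le (S := S) r)
    (show 5 * (n * n) + 3 * n ≤ 8 * (n * n) by omega)
  have h3 := sum_adj_le (S := S) (7 * (n * n))
  have h4 : m * (8 * (n * n)) = 8 * (m * (n * n)) := by ring
  have h5 : 2 * m * (7 * (n * n)) = 14 * (m * (n * n)) := by ring
  omega

theorem round_ops_le (E : Fin m → Fin m → Fin n → Fin n → ℝ) :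
    (S.round E).ops ≤ 36 * (m * (n * n)) := by
  classical
  have hnn : n ≤ n * n := Nat.le_mul_self n
  have h : (S.round E).ops ≤ ∑ k : Fin m, ∑ l, if S.G.Adj k l then 18 * (n * n) else 0 := by
    simp only [TreeMOT.round, Counted.ops_vec]
    refine sum_le_sum fun k _ => sum_le_sum fun l _ => ?_
    split_ifs <;>
      simp only [Counted.ops_bind, rowSums_ops, roundMatrix_ops, Counted.ops_pure] <;> omega
  refine (h.trans (sum_adj_le _)).trans (le_of_eq ?_)
  ring

theorem parameters_ops_le (hm : 3 ≤ m) (hn : 2 ≤ n) (ε : ℝ) :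
    (S.parameters ε).ops ≤ 2 * (m * (n * n)) := by
  have h : (S.parameters ε).ops = 6 + #S.leaves * (n * n) := by
    simp only [parameters, Counted.ops_bind, Counted.ops_log, Counted.ops_mul, Counted.ops_div,
      Counted.ops_max, Counted.ops_pure, Fintype.card_prod, Fintype.card_fin, Fintype.card_coe]
    ring
  have hcard : #S.leaves ≤ m := by simpa using card_le_univ S.leaves
  have h1 := Nat.mul_le_mul_right (n * n) hcard
  have h2 : 3 * (2 * 2) ≤ m * (n * n) := Nat.mul_le_mul hm (Nat.mul_le_mul hn hn)
  omega

theorem parameters_val (ε : ℝ) : (S.parameters ε).val =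
    (ε / (2 * m * Real.log n), ε / (8 * S.leafCost)) := rfl

/-- The result and the cost of the complete method in terms of the number of Sinkhorn steps. -/
theorem solve_spec (hm : 3 ≤ m) (hn : 2 ≤ n) {ε η ε' : ℝ} (hη : η = ε / (2 * m * Real.log n))
    (hε' : ε' = ε / (8 * S.leafCost)) {κ : ℕ → Fin m} {t : ℕ}
    (ht : S.residual η (S.iterate η κ t).val.scal < ε') :
    ∃ r s, s ≤ t ∧ S.solve ε κ = some r ∧ S.residual η (S.iterate η κ s).val.scal < ε' ∧
      (∀ i < s, ε' ≤ S.residual η (S.iterate η κ i).val.scal) ∧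
      r.val = (S.round (S.edgeProjections η (κ 0) (S.iterate η κ s).val.scal).val).val ∧
      r.ops ≤ 77 * (m * (n * n)) + s * (9 * (S.G.diam * (n * n))) := by
  classical
  have hex : ∃ t, S.residual η (S.iterate η κ t).val.scal < ε' := ⟨t, ht⟩
  set s := Nat.find hex with hs
  have hsolve : S.solve ε κ = some (do
      let p ← S.parameters ε
      let u ← (do
        let s ← S.iterate η κ s
        pure s.scal)
      let E ← S.edgeProjections p.1 (κ 0) u
      S.round E) := by
    rw [solve, parameters_val, ← hη, ← hε', sinkhornBP, dif_pos hex, Option.map_some]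
  refine ⟨_, s, Nat.find_min' hex ht, hsolve, Nat.find_spec hex,
    fun i hi => not_lt.1 (Nat.find_min hex hi), ?_, ?_⟩
  · simp only [Counted.val_bind, parameters_val, ← hη, Counted.val_pure]
  · simp only [Counted.ops_bind, parameters_val, ← hη, Counted.val_bind, Counted.val_pure,
      Counted.ops_pure]
    have h1 := parameters_ops_le (S := S) hm hn ε
    have h2 := iterate_ops_le (S := S) (n := n) hm η κ s
    have h3 := edgeProjections_ops_le (S := S) η (κ 0) (S.iterate η κ s).val.scal
    have h4 := round_ops_le (S := S)
      (S.edgeProjections η (κ 0) (S.iterate η κ s).val.scal).val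
    omega

end TreeMOT

/-! ### Random update orders -/

section RandomOrder

variable {V Ω : Type*}

/-- The sequence that starts with `p` and is constant afterwards. -/
def extendPath {t : ℕ} (p : Fin (t + 1) → V) (s : ℕ) : V := p ⟨min s t, by omega⟩

theorem extendPath_restrict (a : ℕ → V) {t s : ℕ} (hs : s ≤ t) :
    extendPath (fun i : Fin (t + 1) => a i) s = a s := by
  simp [extendPath, hs]

theorem extendPath_snoc {t : ℕ} (p : Fin (t + 1) → V) (b : V) {s : ℕ} (hs : s ≤ t + 1) :
    extendPath (Fin.snoc (α := fun _ => V) p b) s = Function.update (extendPath p) (t + 1) b s := by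
  by_cases h : s = t + 1
  · subst h
    simp [extendPath, Fin.snoc]
  · have h' : s ≤ t := by omega
    rw [Function.update_of_ne h]
    simp [extendPath, Fin.snoc, hs, h', Nat.lt_succ_of_le h']

/-- The event that the update order starts with `a 0, …, a t`. -/
def prefixEvent (κ : ℕ → Ω → V) (t : ℕ) (a : ℕ → V) : Set Ω := {ω | ∀ s ≤ t, κ s ω = a s}

theorem prefixEvent_congr {κ : ℕ → Ω → V} {t : ℕ} {a a' : ℕ → V} (h : ∀ s ≤ t, a s = a' s) :
    prefixEvent κ t a = prefixEvent κ t a' := by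
  ext ω
  exact forall₂_congr fun s hs => by rw [h s hs]

theorem mem_prefixEvent_restrict (κ : ℕ → Ω → V) (t : ℕ) (ω : Ω) :
    ω ∈ prefixEvent κ t (extendPath fun i : Fin (t + 1) => κ i ω) := fun _ hs =>
  (extendPath_restrict (fun s => κ s ω) hs).symm

/-- The expectation of a function of the first `t + 1` updates, as a finite sum. -/
def pathExpectation [Fintype V] [MeasurableSpace Ω] (P : Measure Ω)
    (κ : ℕ → Ω → V) (t : ℕ) (F : (ℕ → V) → ℝ) : ℝ :=
  ∑ p : Fin (t + 1) → V, P.real (prefixEvent κ t (extendPath p)) * F (extendPath p)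

/-- Markov's inequality for events that depend on the first `t + 1` updates. -/
theorem measureReal_le_pathExpectation [Fintype V] [MeasurableSpace Ω] {P : Measure Ω}
    [IsFiniteMeasure P] {κ : ℕ → Ω → V} {t : ℕ} {A : (ℕ → V) → Prop} {F : (ℕ → V) → ℝ}
    (hA : ∀ a a' : ℕ → V, (∀ s ≤ t, a s = a' s) → A a → A a')
    (hF0 : ∀ a, 0 ≤ F a) (hF1 : ∀ a, A a → 1 ≤ F a) :
    P.real {ω | A fun s => κ s ω} ≤ pathExpectation P κ t F := by
  classical
  have hsub : {ω | A fun s => κ s ω} ⊆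
      ⋃ p ∈ univ.filter fun p : Fin (t + 1) → V => A (extendPath p),
        prefixEvent κ t (extendPath p) := by
    intro ω hω
    refine Set.mem_iUnion₂.2 ⟨fun i => κ i ω, mem_filter.2 ⟨mem_univ _, ?_⟩,
      mem_prefixEvent_restrict κ t ω⟩
    exact hA _ _ (fun s hs => (extendPath_restrict (fun s => κ s ω) hs).symm) hω
  calc P.real {ω | A fun s => κ s ω}
      ≤ P.real (⋃ p ∈ univ.filter fun p : Fin (t + 1) → V => A (extendPath p),
          prefixEvent κ t (extendPath p)) := measureReal_mono hsub (measure_ne_top P _)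
    _ ≤ ∑ p ∈ univ.filter fun p : Fin (t + 1) → V => A (extendPath p),
          P.real (prefixEvent κ t (extendPath p)) := measureReal_biUnion_finset_le _ _
    _ ≤ ∑ p ∈ univ.filter fun p : Fin (t + 1) → V => A (extendPath p),
          P.real (prefixEvent κ t (extendPath p)) * F (extendPath p) :=
        sum_le_sum fun p hp =>
          le_mul_of_one_le_right measureReal_nonneg (hF1 _ (mem_filter.1 hp).2)
    _ ≤ _ := sum_le_sum_of_subset_of_nonneg (filter_subset _ _) fun p _ _ =>
        mul_nonneg measureReal_nonneg (hF0 _)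

variable [DecidableEq V] [MeasurableSpace V] [MeasurableSpace Ω]
  {Γ : Finset V} {P : Measure Ω} {κ : ℕ → Ω → V}

theorem IsRandomUpdateOrder.measure_prefixEvent_update (h : IsRandomUpdateOrder Γ P κ) (t : ℕ)
    (a : ℕ → V) (b : V) :
    P (prefixEvent κ (t + 1) (Function.update a (t + 1) b)) =
      P (prefixEvent κ t a) *
        if b ∈ Γ.erase (a t) then ((Γ.erase (a t)).card : ℝ≥0∞)⁻¹ else 0 := by
  have h1 := h.step t (Function.update a (t + 1) b)
  rw [Function.update_self, Function.update_of_ne (by omega : t ≠ t + 1)] at h1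
  rw [prefixEvent, h1]
  congr 2
  change prefixEvent κ t _ = _
  exact prefixEvent_congr fun s hs => Function.update_of_ne (by omega) _ _

theorem IsRandomUpdateOrder.measureReal_prefixEvent_update (h : IsRandomUpdateOrder Γ P κ)
    (t : ℕ) (a : ℕ → V) (b : V) :
    P.real (prefixEvent κ (t + 1) (Function.update a (t + 1) b)) =
      P.real (prefixEvent κ t a) *
        if b ∈ Γ.erase (a t) then ((Γ.erase (a t)).card : ℝ)⁻¹ else 0 := by
  rw [Measure.real, h.measure_prefixEvent_update, ENNReal.toReal_mul, Measure.real]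
  congr 1
  split_ifs <;> simp

/-- Almost surely all vertices of the update order lie in `Γ`. -/
theorem IsRandomUpdateOrder.ae_mem [Fintype V] (h : IsRandomUpdateOrder Γ P κ) :
    ∀ᵐ ω ∂P, ∀ t, κ t ω ∈ Γ := by
  rw [ae_all_iff]
  intro t
  cases t with
  | zero => exact h.initial
  | succ t =>
    have hsub : {ω | ¬ κ (t + 1) ω ∈ Γ} ⊆ ⋃ p : Fin (t + 1) → V, ⋃ b : {b : V // b ∉ Γ},
        prefixEvent κ (t + 1) (Function.update (extendPath p) (t + 1) b) := by
      intro ω hω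
      refine Set.mem_iUnion₂.2 ⟨fun i => κ i ω, ⟨κ (t + 1) ω, hω⟩, fun s hs => ?_⟩
      by_cases hs' : s = t + 1
      · subst hs'
        rw [Function.update_self]
      · rw [Function.update_of_ne hs', extendPath_restrict (fun s => κ s ω) (by omega)]
    refine measure_mono_null hsub ?_
    refine measure_iUnion_null fun p => measure_iUnion_null fun b => ?_
    rw [h.measure_prefixEvent_update, if_neg fun hb => b.2 (mem_of_mem_erase hb), mul_zero]

/-- One step of a geometric supermartingale along the random update order. -/
theorem IsRandomUpdateOrder.pathExpectation_succ_le [Fintype V]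
    (h : IsRandomUpdateOrder Γ P κ) {F : ℕ → (ℕ → V) → ℝ} {ρ : ℝ} (t : ℕ)
    (hF : ∀ a a' : ℕ → V, (∀ s ≤ t + 1, a s = a' s) → F (t + 1) a = F (t + 1) a')
    (hstep : ∀ a : ℕ → V, ∑ b ∈ Γ.erase (a t), ((Γ.erase (a t)).card : ℝ)⁻¹ *
      F (t + 1) (Function.update a (t + 1) b) ≤ ρ * F t a) :
    pathExpectation P κ (t + 1) (F (t + 1)) ≤ ρ * pathExpectation P κ t (F t) := by
  have h1 : pathExpectation P κ (t + 1) (F (t + 1)) =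
      ∑ p : Fin (t + 1) → V, ∑ b : V,
        P.real (prefixEvent κ (t + 1) (Function.update (extendPath p) (t + 1) b)) *
          F (t + 1) (Function.update (extendPath p) (t + 1) b) := by
    rw [pathExpectation, ← (Fin.snocEquiv fun _ : Fin (t + 2) => V).sum_comp,
      Fintype.sum_prod_type, sum_comm]
    refine sum_congr rfl fun p _ => sum_congr rfl fun b _ => ?_
    have e : ∀ s ≤ t + 1, extendPath (Fin.snocEquiv (fun _ : Fin (t + 2) => V) (b, p)) s =
        Function.update (extendPath p) (t + 1) b s := fun s hs => extendPath_snoc p b hs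
    rw [prefixEvent_congr e, hF _ _ e]
  rw [h1, pathExpectation, mul_sum]
  refine sum_le_sum fun p _ => ?_
  have h2 : ∀ b : V, P.real (prefixEvent κ (t + 1) (Function.update (extendPath p) (t + 1) b)) *
        F (t + 1) (Function.update (extendPath p) (t + 1) b) =
      P.real (prefixEvent κ t (extendPath p)) *
        if b ∈ Γ.erase (extendPath p t) then ((Γ.erase (extendPath p t)).card : ℝ)⁻¹ *
          F (t + 1) (Function.update (extendPath p) (t + 1) b) else 0 := by
    intro b
    rw [h.measureReal_prefixEvent_update]
    split_ifs <;> ring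
  simp_rw [h2]
  rw [← mul_sum, sum_ite_mem, univ_inter]
  calc _ ≤ P.real (prefixEvent κ t (extendPath p)) * (ρ * F t (extendPath p)) :=
        mul_le_mul_of_nonneg_left (hstep _) measureReal_nonneg
    _ = _ := by ring

theorem IsRandomUpdateOrder.pathExpectation_zero_le [Fintype V] [MeasurableSingletonClass V]
    [IsProbabilityMeasure P] (h : IsRandomUpdateOrder Γ P κ) {F : (ℕ → V) → ℝ} {C : ℝ}
    (hC : ∀ a, F a ≤ C) : pathExpectation P κ 0 F ≤ C := by
  have h1 : pathExpectation P κ 0 F ≤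
      ∑ p : Fin 1 → V, P.real (prefixEvent κ 0 (extendPath p)) * C :=
    sum_le_sum fun p _ => mul_le_mul_of_nonneg_left (hC _) measureReal_nonneg
  have h2 : ∀ p : Fin 1 → V, prefixEvent κ 0 (extendPath p) = κ 0 ⁻¹' {p 0} := by
    intro p
    ext ω
    simp [prefixEvent, extendPath]
  have h3 : ∑ p : Fin 1 → V, P.real (prefixEvent κ 0 (extendPath p)) = 1 := by
    simp_rw [h2]
    rw [← (Equiv.funUnique (Fin 1) V).symm.sum_comp]
    have := sum_measureReal_preimage_singleton (μ := P) (univ : Finset V) (f := κ 0)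
      fun b _ => h.measurable 0 (measurableSet_singleton b)
    simpa using this
  rwa [← sum_mul, h3, one_mul] at h1

theorem IsRandomUpdateOrder.measurableSet_of_prefix [Fintype V] [MeasurableSingletonClass V]
    (h : IsRandomUpdateOrder Γ P κ) {t : ℕ} {A : (ℕ → V) → Prop}
    (hA : ∀ a a' : ℕ → V, (∀ s ≤ t, a s = a' s) → A a → A a') :
    MeasurableSet {ω | A fun s => κ s ω} := by
  have hm : Measurable fun ω => fun i : Fin (t + 1) => κ i ω :=
    measurable_pi_lambda _ fun i => h.measurable i
  have hset : {ω | A fun s => κ s ω} = (fun ω => fun i : Fin (t + 1) => κ i ω) ⁻¹'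
      {p | A (extendPath p)} := by
    ext ω
    constructor
    · exact hA _ _ fun s hs => (extendPath_restrict (fun s => κ s ω) hs).symm
    · exact hA _ _ fun s hs => extendPath_restrict (fun s => κ s ω) hs
  rw [hset]
  exact hm (Set.toFinite _).measurableSet

end RandomOrder

/-! ### A concave potential for the stopping time -/

/-- The potential `z ↦ ∫₀^z min (1, s⁻²) ds`, which is concave and bounded by `2`. -/
def stopPotential (z : ℝ) : ℝ := if z ≤ 1 then z else 2 - 1 / z

theorem stopPotential_nonneg {z : ℝ} (hz : 0 ≤ z) : 0 ≤ stopPotential z := by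
  rw [stopPotential]
  split_ifs with h
  · exact hz
  · have : 1 / z ≤ 1 := by
      rw [div_le_one (by linarith)]
      linarith
    linarith

theorem stopPotential_le_two {z : ℝ} (hz : 0 ≤ z) : stopPotential z ≤ 2 := by
  rw [stopPotential]
  split_ifs with h
  · linarith
  · have : 0 ≤ 1 / z := by positivity
    linarith

/-- Concavity: the potential lies below its tangents, whose slope at `z` is `max 1 z ^ (-2)`. -/
theorem stopPotential_le {z w : ℝ} :
    stopPotential w ≤ stopPotential z + (w - z) / max 1 z ^ 2 := by
  rw [stopPotential, stopPotential]
  by_cases hz1 : z ≤ 1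
  · rw [if_pos hz1, max_eq_left hz1]
    split_ifs with hw1
    · linarith
    · have hw0 : 0 < w := by linarith
      have : 2 - w ≤ 1 / w := by
        rw [le_div_iff₀ hw0]
        nlinarith [sq_nonneg (w - 1)]
      linarith
  · push Not at hz1
    have hz0 : 0 < z := by linarith
    rw [if_neg (not_le.2 hz1), max_eq_right hz1.le]
    have e : 2 - 1 / z + (w - z) / z ^ 2 = 2 - 2 * z⁻¹ + w * z⁻¹ ^ 2 := by
      field_simp
      ring
    rw [e]
    have hi : z⁻¹ < 1 := inv_lt_one_of_one_lt₀ hz1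
    have hi0 : 0 < z⁻¹ := by positivity
    split_ifs with hw1
    · nlinarith [mul_nonneg (sub_nonneg.2 hi.le) (sub_nonneg.2 hw1),
        mul_nonneg (mul_nonneg (sub_nonneg.2 hi.le) (sub_nonneg.2 hw1)) hi0.le,
        sq_nonneg (z⁻¹ - 1)]
    · have hw0 : 0 < w := by linarith
      have hw' : w * w⁻¹ = 1 := mul_inv_cancel₀ hw0.ne'
      have : 2 * z⁻¹ ≤ w⁻¹ + w * z⁻¹ ^ 2 := by
        have h1 : w⁻¹ + w * z⁻¹ ^ 2 - 2 * z⁻¹ = w * (w⁻¹ - z⁻¹) ^ 2 := by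
          linear_combination (-w⁻¹ + 2 * z⁻¹) * hw'
        have h2 : 0 ≤ w * (w⁻¹ - z⁻¹) ^ 2 := by positivity
        linarith
      rw [one_div]
      linarith

namespace TreeMOT

variable {m n : ℕ} {S : TreeMOT m n}

/-! ### The number of Sinkhorn steps -/

theorem iterate_regular (hn : 0 < n) {η : ℝ} (hη : 0 < η) (hR : 0 ≤ S.leafCost)
    {κ : ℕ → Fin m} {t : ℕ} (hκ : ∀ s ≤ t, κ s ∈ S.leaves) :
    S.Regular η (S.iterate η κ t).val.scal ∧
      (∑ x, S.scaledTensor η (S.iterate η κ t).val.scal x = 1) ∧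
      proj (S.scaledTensor η (S.iterate η κ t).val.scal) (κ t) = S.μ (κ t) := by
  induction t with
  | zero =>
    have h := iterate_zero_isSinkhornStep (S := S) hn hη κ (hκ 0 le_rfl)
    have h1 := S.regular_one hη hR
    exact ⟨h.regular h1, h.sum_eq_one (hκ 0 le_rfl) h1.pos, h.proj_eq (hκ 0 le_rfl) h1.pos⟩
  | succ t ih =>
    have ih' := (ih fun s hs => hκ s (by omega)).1
    have hk := hκ (t + 1) le_rfl
    have h := iterate_succ_isSinkhornStep (S := S) hn hη κ t hk
    exact ⟨h.regular ih', h.sum_eq_one hk ih'.pos, h.proj_eq hk ih'.pos⟩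

/-- The Sinkhorn loop is still running after step `t`. -/
def Running (S : TreeMOT m n) (η ε' : ℝ) (t : ℕ) (κ : ℕ → Fin m) : Prop :=
  ∀ s ≤ t, ε' ≤ S.residual η (S.iterate η κ s).val.scal

theorem Running.congr {η ε' : ℝ} {t : ℕ} {κ κ' : ℕ → Fin m} (h : ∀ s ≤ t, κ s = κ' s)
    (hκ : S.Running η ε' t κ) : S.Running η ε' t κ' := by
  intro s hs
  rw [← iterate_congr fun i hi => h i (hi.trans hs)]
  exact hκ s hs

open Classical in
/-- The supermartingale that bounds the stopping time: one plus the potential of the rescaled dual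
gap while the loop is running in `Γ`, and `0` afterwards. -/
def runPotential (S : TreeMOT m n) (η ε' : ℝ) (t : ℕ) (κ : ℕ → Fin m) : ℝ :=
  if (∀ s ≤ t, κ s ∈ S.leaves) ∧ S.Running η ε' t κ then
    1 + stopPotential (S.dualGap η (S.iterate η κ t).val.scal / (2 * (S.leafCost / η) * ε'))
  else 0

theorem runPotential_congr {η ε' : ℝ} {t : ℕ} {κ κ' : ℕ → Fin m} (h : ∀ s ≤ t, κ s = κ' s) :
    S.runPotential η ε' t κ = S.runPotential η ε' t κ' := by
  have h1 : (∀ s ≤ t, κ s ∈ S.leaves) ↔ ∀ s ≤ t, κ' s ∈ S.leaves :=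
    forall₂_congr fun s hs => by rw [h s hs]
  have h2 : S.Running η ε' t κ ↔ S.Running η ε' t κ' :=
    ⟨Running.congr h, Running.congr fun s hs => (h s hs).symm⟩
  classical
  rw [runPotential, runPotential, iterate_congr h]
  exact if_congr (and_congr h1 h2) rfl rfl

section Drift

variable {η ε' : ℝ}

theorem runPotential_arg_nonneg (hn : 0 < n) (hη : 0 < η) (hε' : 0 < ε') (hR : 0 < S.leafCost)
    {t : ℕ} {κ : ℕ → Fin m} (hκ : ∀ s ≤ t, κ s ∈ S.leaves) :
    0 ≤ S.dualGap η (S.iterate η κ t).val.scal / (2 * (S.leafCost / η) * ε') := by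
  obtain ⟨h1, h2, -⟩ := iterate_regular hn hη hR.le hκ
  exact div_nonneg (dualGap_nonneg h1 h2) (by positivity)

theorem runPotential_nonneg (hn : 0 < n) (hη : 0 < η) (hε' : 0 < ε') (hR : 0 < S.leafCost)
    (t : ℕ) (κ : ℕ → Fin m) : 0 ≤ S.runPotential η ε' t κ := by
  rw [runPotential]
  split_ifs with h
  · have := stopPotential_nonneg (runPotential_arg_nonneg hn hη hε' hR h.1)
    linarith
  · exact le_rfl

theorem runPotential_le_three (hn : 0 < n) (hη : 0 < η) (hε' : 0 < ε') (hR : 0 < S.leafCost)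
    (t : ℕ) (κ : ℕ → Fin m) : S.runPotential η ε' t κ ≤ 3 := by
  rw [runPotential]
  split_ifs with h
  · have := stopPotential_le_two (runPotential_arg_nonneg hn hη hε' hR h.1)
    linarith
  · norm_num

theorem one_le_runPotential (hn : 0 < n) (hη : 0 < η) (hε' : 0 < ε') (hR : 0 < S.leafCost)
    {t : ℕ} {κ : ℕ → Fin m} (h : (∀ s ≤ t, κ s ∈ S.leaves) ∧ S.Running η ε' t κ) :
    1 ≤ S.runPotential η ε' t κ := by
  rw [runPotential, if_pos h]
  have := stopPotential_nonneg (runPotential_arg_nonneg hn hη hε' hR h.1)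
  linarith

/-- Averaging `-e_b²` over the candidates `b` for the next update. -/
theorem sum_average_le {ι : Type*} {s : Finset ι} {c : ℕ} (hs : #s ≤ c) {e W : ι → ℝ}
    {p r E : ℝ} (hr : 0 ≤ r) (hE : 0 < E) (hsum : ∑ b ∈ s, e b = E)
    (hW : ∀ b ∈ s, W b ≤ p - r * e b ^ 2) :
    ∑ b ∈ s, (#s : ℝ)⁻¹ * W b ≤ p - r * (E ^ 2 / (c : ℝ) ^ 2) := by
  have hpos : (0 : ℝ) < #s := by
    rcases s.eq_empty_or_nonempty with rfl | h
    · simp at hsum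
      exact absurd hsum hE.ne
    · exact_mod_cast card_pos.2 h
  have hcs : E ^ 2 ≤ #s * ∑ b ∈ s, e b ^ 2 := by
    rw [← hsum]
    exact sq_sum_le_card_mul_sum_sq
  have hc : (#s : ℝ) ≤ c := by exact_mod_cast hs
  have h1 : ∑ b ∈ s, W b ≤ #s * p - r * ∑ b ∈ s, e b ^ 2 := by
    refine (sum_le_sum hW).trans (le_of_eq ?_)
    rw [sum_sub_distrib, sum_const, nsmul_eq_mul, mul_sum]
  have h2 : E ^ 2 / (c : ℝ) ^ 2 ≤ (∑ b ∈ s, e b ^ 2) / #s := by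
    calc E ^ 2 / (c : ℝ) ^ 2 ≤ E ^ 2 / (#s : ℝ) ^ 2 := by gcongr
      _ ≤ (#s * ∑ b ∈ s, e b ^ 2) / (#s : ℝ) ^ 2 := by gcongr
      _ = _ := by field_simp
  rw [← mul_sum]
  calc (#s : ℝ)⁻¹ * ∑ b ∈ s, W b ≤ (#s : ℝ)⁻¹ * (#s * p - r * ∑ b ∈ s, e b ^ 2) := by gcongr
    _ = p - r * ((∑ b ∈ s, e b ^ 2) / #s) := by field_simp
    _ ≤ _ := by
      have := mul_le_mul_of_nonneg_left h2 hr
      linarith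

/-- The drift of the supermartingale. Let `A = 2 R_C^Γ / η`. As long as the residual `E` is at
least `ε'`, an update decreases the dual gap on average by `E² / (4 |Γ|²)`; since the gap is at
most `A E`, the potential decreases by a fixed amount, the reciprocal of `4 |Γ|² A / ε'`. -/
theorem runPotential_step (hn : 0 < n) (hη : 0 < η) (hε' : 0 < ε') (hR : 0 < S.leafCost)
    {N : ℝ} (hN : N = 4 * (#S.leaves : ℝ) ^ 2 * (2 * (S.leafCost / η)) / ε')
    (t : ℕ) (κ : ℕ → Fin m) :
    ∑ b ∈ S.leaves.erase (κ t), ((S.leaves.erase (κ t)).card : ℝ)⁻¹ *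
      S.runPotential η ε' (t + 1) (Function.update κ (t + 1) b) ≤
        Real.exp (-(1 / (3 * N))) * S.runPotential η ε' t κ := by
  have hold : ∀ b, ∀ s ≤ t, Function.update κ (t + 1) b s = κ s := fun b s hs =>
    Function.update_of_ne (by omega) _ _
  by_cases hrun : (∀ s ≤ t, κ s ∈ S.leaves) ∧ S.Running η ε' t κ
  swap
  · have hzero : ∀ b, S.runPotential η ε' (t + 1) (Function.update κ (t + 1) b) = 0 := by
      intro b
      rw [runPotential, if_neg]
      rintro ⟨h1, h2⟩
      refine hrun ⟨fun s hs => ?_, Running.congr (hold b) fun s hs => h2 s (by omega)⟩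
      rw [← hold b s hs]
      exact h1 s (by omega)
    simp_rw [hzero, runPotential, if_neg hrun]
    simp
  obtain ⟨hκ, hrun'⟩ := hrun
  obtain ⟨hreg, hmass, hproj⟩ := iterate_regular hn hη hR.le hκ
  set u := (S.iterate η κ t).val.scal with hu
  set A : ℝ := 2 * (S.leafCost / η) with hA
  have hA0 : 0 < A := by positivity
  have hAε : 0 < A * ε' := mul_pos hA0 hε'
  set E := S.residual η u with hE
  have hEε : ε' ≤ E := hrun' t le_rfl
  have hE0 : 0 < E := hε'.trans_le hEε
  set z := S.dualGap η u / (A * ε') with hz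
  have hz0 : 0 ≤ z := div_nonneg (dualGap_nonneg hreg hmass) hAε.le
  set e : Fin m → ℝ := fun k => ∑ y, |proj (S.scaledTensor η u) k y - S.μ k y| with he
  -- the leaf updated last contributes nothing to the residual
  have hesum : ∑ b ∈ S.leaves.erase (κ t), e b = E := by
    have h0 : e (κ t) = 0 := by simp [he, hproj]
    rw [hE, residual, ← add_sum_erase _ _ (hκ t le_rfl)]
    change _ = e (κ t) + _
    rw [h0, zero_add]
  set M := max 1 z with hM
  have hM0 : 0 < M := lt_max_of_lt_left one_pos
  -- the residual controls the slope `M ^ (-2)` of the potential, since the gap is at most `A E`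
  have hME : ε' * M ≤ E := by
    rw [hM, mul_max_of_nonneg _ _ hε'.le, mul_one]
    refine max_le hEε ?_
    have h1 : S.dualGap η u ≤ A * E := dualGap_le hreg hmass
    rw [hz, ← mul_div_assoc, div_le_iff₀ hAε]
    nlinarith
  have hW : ∀ b ∈ S.leaves.erase (κ t),
      S.runPotential η ε' (t + 1) (Function.update κ (t + 1) b) ≤
        (1 + stopPotential z) - 1 / (4 * (A * ε') * M ^ 2) * e b ^ 2 := by
    intro b hb
    have hbΓ := mem_of_mem_erase hb
    have hκ' : ∀ s ≤ t + 1, Function.update κ (t + 1) b s ∈ S.leaves := by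
      intro s hs
      by_cases h : s = t + 1
      · subst h
        rwa [Function.update_self]
      · rw [Function.update_of_ne h]
        exact hκ s (by omega)
    have hstep := iterate_succ_isSinkhornStep (S := S) hn hη (Function.update κ (t + 1) b) t
      (hκ' _ le_rfl)
    rw [Function.update_self, iterate_congr (hold b), ← hu] at hstep
    have hgap := hstep.dualGap_le hbΓ hreg.pos hmass
    set u' := (S.iterate η (Function.update κ (t + 1) b) (t + 1)).val.scal with hu'
    have hw0 := runPotential_arg_nonneg hn hη hε' hR hκ'
    rw [← hu', ← hA] at hw0
    have hpot := stopPotential_le (z := z) (w := S.dualGap η u' / (A * ε'))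
    have hdiff : (S.dualGap η u' / (A * ε') - z) / M ^ 2 ≤
        -(1 / (4 * (A * ε') * M ^ 2) * e b ^ 2) := by
      have h1 : S.dualGap η u' - S.dualGap η u ≤ -(1 / 4 * e b ^ 2) := by
        change _ ≤ _ - 1 / 4 * e b ^ 2 at hgap
        linarith
      calc (S.dualGap η u' / (A * ε') - z) / M ^ 2
          = (S.dualGap η u' - S.dualGap η u) / (A * ε' * M ^ 2) := by
            rw [hz]
            field_simp
        _ ≤ -(1 / 4 * e b ^ 2) / (A * ε' * M ^ 2) := by gcongr
        _ = _ := by field_simp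
    have hle : S.runPotential η ε' (t + 1) (Function.update κ (t + 1) b) ≤
        1 + stopPotential (S.dualGap η u' / (A * ε')) := by
      rw [runPotential]
      split_ifs
      · exact le_rfl
      · have := stopPotential_nonneg hw0
        linarith
    linarith
  have havg := sum_average_le (card_le_card (erase_subset _ S.leaves)) (by positivity) hE0 hesum hW
  have hN0 : 0 < N := by
    have : (0 : ℝ) < #S.leaves := by exact_mod_cast card_pos.2 ⟨_, hκ t le_rfl⟩
    rw [hN]
    positivity
  have hdrop : 1 / N ≤ 1 / (4 * (A * ε') * M ^ 2) * (E ^ 2 / (#S.leaves : ℝ) ^ 2) := by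
    have h1 : (ε' * M) ^ 2 ≤ E ^ 2 := by gcongr
    have hΓ : (0 : ℝ) < #S.leaves := by exact_mod_cast card_pos.2 ⟨_, hκ t le_rfl⟩
    calc 1 / N = 1 / (4 * (A * ε') * M ^ 2) * ((ε' * M) ^ 2 / (#S.leaves : ℝ) ^ 2) := by
          rw [hN]
          field_simp
      _ ≤ _ := by gcongr
  have hψ2 := stopPotential_le_two hz0
  have hψ0 := stopPotential_nonneg hz0
  have hexp := Real.add_one_le_exp (-(1 / (3 * N)))
  rw [runPotential, if_pos ⟨hκ, hrun'⟩]
  calc _ ≤ (1 + stopPotential z) - 1 / N := by linarith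
    _ ≤ (-(1 / (3 * N)) + 1) * (1 + stopPotential z) := by
        have h3 : 1 / N = 1 / (3 * N) * 3 := by field_simp
        have h4 : 1 / (3 * N) * (1 + stopPotential z) ≤ 1 / (3 * N) * 3 := by
          gcongr
          linarith
        linarith
    _ ≤ _ := mul_le_mul_of_nonneg_right hexp (by linarith)

/-- The number of Sinkhorn steps has an exponential tail. -/
theorem measureReal_running_le (hn : 0 < n) (hη : 0 < η) (hε' : 0 < ε') (hR : 0 < S.leafCost)
    {N : ℝ} (hN : N = 4 * (#S.leaves : ℝ) ^ 2 * (2 * (S.leafCost / η)) / ε')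
    {Ω : Type*} [MeasurableSpace Ω] {P : Measure Ω} [IsProbabilityMeasure P]
    {κ : ℕ → Ω → Fin m} (hκ : IsRandomUpdateOrder S.leaves P κ) (t : ℕ) :
    P.real {ω | S.Running η ε' t fun s => κ s ω} ≤ 3 * Real.exp (-(1 / (3 * N))) ^ t := by
  have h1 : P.real {ω | S.Running η ε' t fun s => κ s ω} =
      P.real {ω | (fun a : ℕ → Fin m => (∀ s ≤ t, a s ∈ S.leaves) ∧ S.Running η ε' t a)
        fun s => κ s ω} := by
    refine measureReal_congr ?_
    filter_upwards [hκ.ae_mem] with ω hω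
    refine propext ⟨fun h => ⟨fun s _ => hω s, h⟩, fun h => h.2⟩
  have h2 : ∀ t, pathExpectation P κ t (S.runPotential η ε' t) ≤
      3 * Real.exp (-(1 / (3 * N))) ^ t := by
    intro t
    induction t with
    | zero =>
      simpa using hκ.pathExpectation_zero_le (runPotential_le_three hn hη hε' hR 0)
    | succ t ih =>
      refine (hκ.pathExpectation_succ_le t (fun a a' h => runPotential_congr h)
        (runPotential_step hn hη hε' hR hN t)).trans ?_
      rw [pow_succ]
      have := mul_le_mul_of_nonneg_left ih (Real.exp_pos (-(1 / (3 * N)))).le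
      linarith
  rw [h1]
  refine (measureReal_le_pathExpectation
    (A := fun a => (∀ s ≤ t, a s ∈ S.leaves) ∧ S.Running η ε' t a) ?_
    (runPotential_nonneg hn hη hε' hR t) ?_).trans (h2 t)
  · rintro a a' h ⟨h3, h4⟩
    exact ⟨fun s hs => h s hs ▸ h3 s hs, h4.congr h⟩
  · exact fun a ha => one_le_runPotential hn hη hε' hR ha

end Drift

/-! ### Expected and high-probability operation counts -/

/-- The sum of the tail bounds for the number of steps. -/
theorem tsum_exp_le {N : ℝ} (hN : 0 < N) :
    Summable (fun t : ℕ => 3 * Real.exp (-(1 / (3 * N))) ^ t) ∧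
      ∑' t : ℕ, 3 * Real.exp (-(1 / (3 * N))) ^ t ≤ 3 + 9 * N := by
  set a : ℝ := 1 / (3 * N) with ha
  have ha0 : 0 < a := by positivity
  have hr : Real.exp (-a) < 1 := Real.exp_lt_one_iff.2 (neg_lt_zero.2 ha0)
  have hr0 := (Real.exp_pos (-a)).le
  refine ⟨(summable_geometric_of_lt_one hr0 hr).mul_left 3, ?_⟩
  rw [tsum_mul_left, tsum_geometric_of_lt_one hr0 hr]
  have h1 : Real.exp (-a) ≤ 1 / (1 + a) := by
    rw [Real.exp_neg, ← one_div]
    have := Real.add_one_le_exp a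
    exact one_div_le_one_div_of_le (by positivity) (by linarith)
  have h2 : a / (1 + a) ≤ 1 - Real.exp (-a) := by
    have : a / (1 + a) = 1 - 1 / (1 + a) := by field_simp; ring
    linarith
  calc 3 * (1 - Real.exp (-a))⁻¹ ≤ 3 * (a / (1 + a))⁻¹ := by gcongr
    _ = 3 + 9 * N := by rw [ha]; field_simp; ring

/-- The number of operations, if the loop has stopped by step `t`. -/
theorem operations_le_of_not_running (hm : 3 ≤ m) (hn : 2 ≤ n) {ε η ε' : ℝ}
    (hη : η = ε / (2 * m * Real.log n)) (hε' : ε' = ε / (8 * S.leafCost)) {κ : ℕ → Fin m} {t : ℕ}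
    (ht : ¬ S.Running η ε' t κ) :
    ∃ s ≤ t, (∀ i < s, S.Running η ε' i κ) ∧ ¬ S.Running η ε' s κ ∧
      S.operations ε κ ≤ ((77 * (m * (n * n)) + s * (9 * (S.G.diam * (n * n))) : ℕ) : ℝ≥0∞) := by
  simp only [Running, not_forall, not_le] at ht
  obtain ⟨i, hi, hres⟩ := ht
  obtain ⟨r, s, hs, hsolve, hress, hprev, -, hops⟩ := solve_spec hm hn hη hε' hres
  refine ⟨s, hs.trans hi, fun i hi j hj => hprev j (by omega),
    fun h => absurd (h s le_rfl) (not_le.2 hress), ?_⟩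
  rw [operations, hsolve]
  exact Nat.cast_le.2 hops

section Assembly

variable {ε η ε' N : ℝ} {Ω : Type*} [MeasurableSpace Ω] {P : Measure Ω} [IsProbabilityMeasure P]
  {κ : ℕ → Ω → Fin m}

theorem ae_not_running (hn : 0 < n) (hη : 0 < η) (hε' : 0 < ε') (hR : 0 < S.leafCost)
    (hκ : IsRandomUpdateOrder S.leaves P κ) :
    ∀ᵐ ω ∂P, ∃ t, ¬ S.Running η ε' t fun s => κ s ω := by
  have hpos : 0 < 4 * (#S.leaves : ℝ) ^ 2 * (2 * (S.leafCost / η)) / ε' ∨ #S.leaves = 0 := by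
    rcases Nat.eq_zero_or_pos #S.leaves with h | h
    · exact Or.inr h
    · have : (0 : ℝ) < #S.leaves := by exact_mod_cast h
      exact Or.inl (by positivity)
  rcases hpos with hN | h0
  swap
  · filter_upwards [hκ.ae_mem] with ω hω
    have := hω 0
    rw [card_eq_zero.1 h0] at this
    simp at this
  have htail := measureReal_running_le (S := S) hn hη hε' hR rfl hκ
  set N := 4 * (#S.leaves : ℝ) ^ 2 * (2 * (S.leafCost / η)) / ε'
  have hr : Real.exp (-(1 / (3 * N))) < 1 := Real.exp_lt_one_iff.2 (neg_lt_zero.2 (by positivity))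
  have hlim : Filter.Tendsto (fun t : ℕ => 3 * Real.exp (-(1 / (3 * N))) ^ t) Filter.atTop
      (nhds 0) := by
    simpa using (tendsto_pow_atTop_nhds_zero_of_lt_one (Real.exp_pos _).le hr).const_mul 3
  have hzero : P.real {ω | ∀ t, S.Running η ε' t fun s => κ s ω} = 0 := by
    refine le_antisymm (ge_of_tendsto' hlim fun t => ?_) measureReal_nonneg
    exact (measureReal_mono (Set.ofPred_subset_ofPred.2 fun ω hω => hω t)
      (measure_ne_top P _)).trans (htail t)
  rw [measureReal_eq_zero_iff] at hzero
  rw [ae_iff]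
  simpa only [not_exists, not_not] using hzero

/-- Almost sure correctness. -/
theorem ae_solve (hm : 3 ≤ m) (hn : 2 ≤ n) (hR : 0 < S.leafCost) (hε : 0 < ε)
    (hκ : IsRandomUpdateOrder S.leaves P κ) :
    ∀ᵐ ω ∂P, ∃ r, S.solve ε (fun t => κ t ω) = some r ∧
      (∀ k l, S.G.Adj k l → proj₂ (S.treeTensor r.val) k l = r.val k l) ∧
      S.IsApproxSolution ε (S.treeTensor r.val) := by
  have hn0 : 0 < n := by omega
  have hlog : 0 < Real.log n := Real.log_pos (by exact_mod_cast hn)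
  have hm0 : (0 : ℝ) < m := by exact_mod_cast (by omega : 0 < m)
  have hη : 0 < ε / (2 * m * Real.log n) := by positivity
  have hε' : 0 < ε / (8 * S.leafCost) := by positivity
  filter_upwards [ae_not_running hn0 hη hε' hR hκ, hκ.ae_mem] with ω ⟨t, ht⟩ hω
  simp only [Running, not_forall, not_le] at ht
  obtain ⟨i, -, hres⟩ := ht
  obtain ⟨r, s, -, hsolve, hress, -, hval, -⟩ := solve_spec hm hn rfl rfl hres
  obtain ⟨hreg, hmass, -⟩ := iterate_regular hn0 hη hR.le (κ := fun t => κ t ω) (t := s)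
    fun s _ => hω s
  exact ⟨r, hsolve, output_spec hm hn hR hε rfl hreg hmass hress _ hval⟩

/-- The expected number of operations: the number of steps is the sum of the indicators of the
events that the loop is still running. -/
theorem lintegral_operations_le (hm : 3 ≤ m) (hn : 2 ≤ n) (hR : 0 < S.leafCost) (hε : 0 < ε)
    (hκ : IsRandomUpdateOrder S.leaves P κ)
    (hη : η = ε / (2 * m * Real.log n)) (hε' : ε' = ε / (8 * S.leafCost))
    (hN : N = 4 * (#S.leaves : ℝ) ^ 2 * (2 * (S.leafCost / η)) / ε') (hN0 : 0 < N) :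
    ∫⁻ ω, S.operations ε (fun t => κ t ω) ∂P ≤
      ENNReal.ofReal (77 * (m * (n * n)) + 9 * (S.G.diam * (n * n)) * (3 + 9 * N)) := by
  have hn0 : 0 < n := by omega
  have hlog : 0 < Real.log n := Real.log_pos (by exact_mod_cast hn)
  have hm0 : (0 : ℝ) < m := by exact_mod_cast (by omega : 0 < m)
  have hη0 : 0 < η := by rw [hη]; positivity
  have hε'0 : 0 < ε' := by rw [hε']; positivity
  set D : ℕ → Set Ω := fun t => {ω | S.Running η ε' t fun s => κ s ω} with hD
  have hDm : ∀ t, MeasurableSet (D t) := fun t =>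
    hκ.measurableSet_of_prefix (t := t) (A := S.Running η ε' t) fun a a' h ha => ha.congr h
  have hpt : ∀ᵐ ω ∂P, S.operations ε (fun t => κ t ω) ≤
      ((77 * (m * (n * n)) : ℕ) : ℝ≥0∞) + ((9 * (S.G.diam * (n * n)) : ℕ) : ℝ≥0∞) *
        ∑' t, (D t).indicator 1 ω := by
    filter_upwards [ae_not_running hn0 hη0 hε'0 hR hκ] with ω ⟨t, ht⟩
    obtain ⟨s, -, hs, -, hops⟩ := operations_le_of_not_running hm hn hη hε' ht
    refine hops.trans ?_
    rw [Nat.cast_add, Nat.cast_mul s, mul_comm (s : ℝ≥0∞)]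
    gcongr
    calc (s : ℝ≥0∞) = ∑ t ∈ range s, (D t).indicator 1 ω := by
          rw [sum_congr rfl fun t ht => Set.indicator_of_mem (f := (1 : Ω → ℝ≥0∞))
            (show ω ∈ D t from hs t (mem_range.1 ht))]
          simp
      _ ≤ _ := ENNReal.sum_le_tsum _
  have hPD : ∀ t, P (D t) ≤ ENNReal.ofReal (3 * Real.exp (-(1 / (3 * N))) ^ t) := fun t => by
    rw [← ofReal_measureReal (μ := P) (s := D t)]
    exact ENNReal.ofReal_le_ofReal (measureReal_running_le hn0 hη0 hε'0 hR hN hκ t)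
  obtain ⟨hsum, htsum⟩ := tsum_exp_le hN0
  have hDsum : ∑' t, P (D t) ≤ ENNReal.ofReal (3 + 9 * N) := by
    refine (ENNReal.tsum_le_tsum hPD).trans ?_
    rw [← ENNReal.ofReal_tsum_of_nonneg (fun t => by positivity) hsum]
    exact ENNReal.ofReal_le_ofReal htsum
  calc ∫⁻ ω, S.operations ε (fun t => κ t ω) ∂P
      ≤ ∫⁻ ω, (((77 * (m * (n * n)) : ℕ) : ℝ≥0∞) + ((9 * (S.G.diam * (n * n)) : ℕ) : ℝ≥0∞) *
          ∑' t, (D t).indicator 1 ω) ∂P := lintegral_mono_ae hpt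
    _ = ((77 * (m * (n * n)) : ℕ) : ℝ≥0∞) +
          ((9 * (S.G.diam * (n * n)) : ℕ) : ℝ≥0∞) * ∑' t, P (D t) := by
        have hmeas : ∀ t, Measurable ((D t).indicator (1 : Ω → ℝ≥0∞)) := fun t =>
          measurable_one.indicator (hDm t)
        rw [lintegral_add_left measurable_const, lintegral_const, measure_univ, mul_one,
          lintegral_const_mul _ (Measurable.tsum hmeas),
          lintegral_tsum fun t => (hmeas t).aemeasurable]
        simp_rw [lintegral_indicator_one (hDm _)]
    _ ≤ ENNReal.ofReal (77 * (m * (n * n))) +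
          ENNReal.ofReal (9 * (S.G.diam * (n * n))) * ENNReal.ofReal (3 + 9 * N) := by
        gcongr
        · rw [← ENNReal.ofReal_natCast]
          push_cast
          exact le_rfl
        · rw [← ENNReal.ofReal_natCast]
          push_cast
          exact le_rfl
    _ = _ := by
        rw [← ENNReal.ofReal_mul (by positivity), ← ENNReal.ofReal_add (by positivity)
          (by positivity)]

/-- The number of operations that suffices with probability `1 - δ`. -/
theorem measure_operations_ge (hm : 3 ≤ m) (hn : 2 ≤ n) (hR : 0 < S.leafCost) (hε : 0 < ε)
    (hκ : IsRandomUpdateOrder S.leaves P κ)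
    (hη : η = ε / (2 * m * Real.log n)) (hε' : ε' = ε / (8 * S.leafCost))
    (hN : N = 4 * (#S.leaves : ℝ) ^ 2 * (2 * (S.leafCost / η)) / ε') (hN0 : 0 < N)
    {δ : ℝ} (hδ : 0 < δ) (hδ2 : δ < 1 / 2) :
    ENNReal.ofReal (1 - δ) ≤ P {ω | S.operations ε (fun t => κ t ω) ≤
      ENNReal.ofReal (77 * (m * (n * n)) +
        9 * (S.G.diam * (n * n)) * (9 * N * Real.log (1 / δ) + 1))} := by
  have hn0 : 0 < n := by omega
  have hlog : 0 < Real.log n := Real.log_pos (by exact_mod_cast hn)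
  have hm0 : (0 : ℝ) < m := by exact_mod_cast (by omega : 0 < m)
  have hη0 : 0 < η := by rw [hη]; positivity
  have hε'0 : 0 < ε' := by rw [hε']; positivity
  set L := Real.log (1 / δ) with hL
  have hL2 : Real.log 2 ≤ L := by
    refine Real.log_le_log two_pos ?_
    rw [le_div_iff₀ hδ]
    linarith
  have hL0 : 0 < L := (Real.log_pos one_lt_two).trans_le hL2
  set t := ⌈9 * N * L⌉₊ with ht
  have ht1 : 9 * N * L ≤ t := Nat.le_ceil _
  have ht2 : (t : ℝ) ≤ 9 * N * L + 1 := (Nat.ceil_lt_add_one (by positivity)).le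
  have hDm : MeasurableSet {ω | S.Running η ε' t fun s => κ s ω} :=
    hκ.measurableSet_of_prefix (t := t) (A := S.Running η ε' t) fun a a' h ha => ha.congr h
  -- the number of steps is chosen such that `3 exp (-t / (3 N)) ≤ 3 δ³ ≤ δ`
  have hδt : 3 * Real.exp (-(1 / (3 * N))) ^ t ≤ δ := by
    have h1 : Real.exp (-(1 / (3 * N))) ^ t ≤ Real.exp (-(3 * L)) := by
      rw [← Real.exp_nat_mul, Real.exp_le_exp]
      have : 3 * L ≤ t * (1 / (3 * N)) := by
        rw [mul_one_div, le_div_iff₀ (by positivity)]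
        linarith
      linarith
    have h2 : Real.exp (-(3 * L)) = δ ^ 3 := by
      rw [hL, one_div, Real.log_inv, mul_neg, neg_neg, show (3 : ℝ) = (3 : ℕ) by norm_num,
        Real.exp_nat_mul, Real.exp_log hδ]
    rw [h2] at h1
    have h3 : δ ^ 2 ≤ 1 / 4 := by nlinarith
    nlinarith
  have hP : P {ω | S.Running η ε' t fun s => κ s ω} ≤ ENNReal.ofReal δ := by
    rw [← ofReal_measureReal (μ := P)]
    exact ENNReal.ofReal_le_ofReal ((measureReal_running_le hn0 hη0 hε'0 hR hN hκ t).trans hδt)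
  calc ENNReal.ofReal (1 - δ) = 1 - ENNReal.ofReal δ := by
        rw [ENNReal.ofReal_sub _ hδ.le, ENNReal.ofReal_one]
    _ ≤ 1 - P {ω | S.Running η ε' t fun s => κ s ω} := tsub_le_tsub_left hP 1
    _ = P {ω | S.Running η ε' t fun s => κ s ω}ᶜ := (prob_compl_eq_one_sub hDm).symm
    _ ≤ _ := by
        refine measure_mono fun ω hω => ?_
        obtain ⟨s, hs, -, -, hops⟩ := operations_le_of_not_running hm hn hη hε' hω
        refine hops.trans ?_
        rw [← ENNReal.ofReal_natCast]
        refine ENNReal.ofReal_le_ofReal ?_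
        push_cast
        have hst : (s : ℝ) ≤ t := by exact_mod_cast hs
        rw [mul_comm (s : ℝ)]
        gcongr
        exact hst.trans ht2

end Assembly

/-- Both parts of the operation count are controlled by the quantity in the complexity bound. -/
theorem operation_bounds (hm : 3 ≤ m) (hn : 2 ≤ n) (hR : 0 < S.leafCost) {ε : ℝ} (hε : 0 < ε)
    (hle : ε ≤ 16 * #S.leaves * S.leafCost) {η ε' N Q : ℝ}
    (hη : η = ε / (2 * m * Real.log n)) (hε' : ε' = ε / (8 * S.leafCost))
    (hN : N = 4 * (#S.leaves : ℝ) ^ 2 * (2 * (S.leafCost / η)) / ε')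
    (hQ : Q = S.G.diam * m * (#S.leaves : ℝ) ^ 2 * (n : ℝ) ^ 2 * S.leafCost ^ 2 *
      Real.log n / ε ^ 2) :
    0 < N ∧ 0 < Q ∧ (m : ℝ) * (n * n) ≤ 512 * Q ∧ (S.G.diam : ℝ) * (n * n) ≤ 512 * Q ∧
      (S.G.diam : ℝ) * (n * n) * N = 128 * Q := by
  have hΓ : (0 : ℝ) < #S.leaves := by exact_mod_cast card_pos.2 (exists_leaf hm)
  have hn2 : (2 : ℝ) ≤ n := by exact_mod_cast hn
  have hlog2 : 1 / 2 ≤ Real.log n := by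
    have := Real.log_le_log two_pos hn2
    linarith [Real.log_two_gt_d9]
  have hlog : 0 < Real.log n := by linarith
  have hm1 : (1 : ℝ) ≤ m := by exact_mod_cast (by omega : 1 ≤ m)
  have hd1 : (1 : ℝ) ≤ S.G.diam := by exact_mod_cast diam_pos hm
  -- `q ≥ 1 / 256` is the hypothesis `ε ≤ 16 |Γ| R`; with `log n ≥ 1 / 2` it gives the factor `512`
  have hNe : N = 128 * (m * (#S.leaves : ℝ) ^ 2 * S.leafCost ^ 2 * Real.log n / ε ^ 2) := by
    rw [hN, hη, hε']
    field_simp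
    ring
  set q := (#S.leaves : ℝ) ^ 2 * S.leafCost ^ 2 / ε ^ 2 with hq
  have hq1 : 1 / 256 ≤ q := by
    rw [hq, div_le_div_iff₀ (by norm_num) (by positivity)]
    nlinarith
  have hqlog : 1 ≤ 512 * (q * Real.log n) := by nlinarith
  have hQe : Q = S.G.diam * m * (n * n) * (q * Real.log n) := by
    rw [hQ, hq]
    ring
  have hn0 : (0 : ℝ) < n := by linarith
  refine ⟨by rw [hNe]; positivity, by rw [hQ]; positivity, ?_, ?_, ?_⟩
  · rw [hQe]
    calc (m : ℝ) * (n * n) = 1 * m * (n * n) * 1 := by ring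
      _ ≤ S.G.diam * m * (n * n) * (512 * (q * Real.log n)) := by gcongr
      _ = _ := by ring
  · rw [hQe]
    calc (S.G.diam : ℝ) * (n * n) = S.G.diam * 1 * (n * n) * 1 := by ring
      _ ≤ S.G.diam * m * (n * n) * (512 * (q * Real.log n)) := by gcongr
      _ = _ := by ring
  · rw [hNe, hQ]
    ring

end TreeMOT
end

theorem mainTheorem2 :
    ∃ c : ℝ, 0 < c ∧
      ∀ (m n : ℕ), 3 ≤ m → 2 ≤ n →
      ∀ (S : TreeMOT m n), 0 < S.leafCost →
      ∀ (ε : ℝ), 0 < ε →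
      ∀ (Ω : Type*) [MeasurableSpace Ω] (P : Measure Ω) [IsProbabilityMeasure P]
        (κ : ℕ → Ω → Fin m), IsRandomUpdateOrder S.leaves P κ →
      (∀ᵐ ω ∂P, ∃ r, S.solve ε (fun t => κ t ω) = some r ∧
        (∀ k l, S.G.Adj k l → TreeMOT.proj₂ (S.treeTensor r.val) k l = r.val k l) ∧
        S.IsApproxSolution ε (S.treeTensor r.val)) ∧
      (ε ≤ 16 * S.leaves.card * S.leafCost →
        (∫⁻ ω, S.operations ε (fun t => κ t ω) ∂P ≤
          ENNReal.ofReal (c * (S.G.diam * m * (S.leaves.card : ℝ) ^ 2 * (n : ℝ) ^ 2 *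
            S.leafCost ^ 2 * Real.log n / ε ^ 2))) ∧
        ∀ δ : ℝ, 0 < δ → δ < 1 / 2 →
          ENNReal.ofReal (1 - δ) ≤
            P {ω | S.operations ε (fun t => κ t ω) ≤
              ENNReal.ofReal (c * S.G.diam * m * (S.leaves.card : ℝ) ^ 2 * (n : ℝ) ^ 2 *
                S.leafCost ^ 2 * Real.log n * Real.log (1 / δ) / ε ^ 2)}) := by
  refine ⟨100000, by norm_num, ?_⟩
  intro m n hm hn S hR ε hε Ω _ P _ κ hκ
  refine ⟨TreeMOT.ae_solve hm hn hR hε hκ, fun hle => ?_⟩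
  obtain ⟨hN0, hQ0, h1, h2, h3⟩ := TreeMOT.operation_bounds hm hn hR hε hle rfl rfl rfl rfl
  refine ⟨(TreeMOT.lintegral_operations_le hm hn hR hε hκ rfl rfl rfl hN0).trans
    (ENNReal.ofReal_le_ofReal (by linarith)), fun δ hδ hδ2 => ?_⟩
  refine (TreeMOT.measure_operations_ge hm hn hR hε hκ rfl rfl rfl hN0 hδ hδ2).trans
    (measure_mono fun ω hω => le_trans hω (ENNReal.ofReal_le_ofReal ?_))
  have hL : 1 / 2 ≤ Real.log (1 / δ) := by
    have : Real.log 2 ≤ Real.log (1 / δ) := Real.log_le_log two_pos (by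
      rw [le_div_iff₀ hδ]
      linarith)
    linarith [Real.log_two_gt_d9]
  set L := Real.log (1 / δ)
  set Q := S.G.diam * m * (S.leaves.card : ℝ) ^ 2 * (n : ℝ) ^ 2 * S.leafCost ^ 2 *
    Real.log n / ε ^ 2 with hQ
  have e : 100000 * S.G.diam * m * (S.leaves.card : ℝ) ^ 2 * (n : ℝ) ^ 2 *
      S.leafCost ^ 2 * Real.log n * L / ε ^ 2 = 100000 * (Q * L) := by
    rw [hQ]
    ring
  rw [e]
  have h4 : Q ≤ 2 * (Q * L) := by nlinarith
  have h5 := congrArg (· * L) h3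
  linarith
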